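/- **Setting.** Let $X=(X_t)_{t\ge 0}$ be a real-valued Lévy process with no positive jumps: $X_0=0$ a.s., independent and stationary increments, and almost surely càdlàg paths with $X_t\le X_{t-}$ for all $t>0$. Let $\kappa\ge 0$, let $\zeta$ be independent of $X$, exponentially distributed with parameter $\kappa$ if $\kappa>0$ and a.s. infinite if $\kappa=0$, and let $\xi$ be $X$ killed at time $\zeta$ (with $e^{u\xi_t}:=0$ for $t\ge\zeta$). For $\ell\le 0$, let $\Psi_\ell$ be the set of Laplace exponents $\psi$ of such processes (for any $\kappa\geq 0$) that are well defined on $(\ell,\infty)$, that is, $$\mathbb E\big(e^{u\xi_t}\big)=e^{t\psi(u)}<\infty ,\qquad t\ge 0,\ u\in(\ell,\infty)\cup[0,\infty).$$ Then $\kappa=-\psi(0)$ is the killing rate of $\psi$. We say that $\psi$ has Gaussian coefficient $\sigma\ge 0$ and jump (Lévy) measure $\Pi$ if $\Pi$ is a measure concentrated on $(-\infty,0)$ with $\int(1\wedge x^2)\,\Pi(dx)<\infty$ and, for some $a\in\mathbb R$ and all $u\ge 0$, $$\psi(u)=-\kappa+au+\tfrac12\sigma^2u^2+\int_{(-\infty,0)}\big(e^{ux}-1-ux\mathbf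 1_{\{|x|<1\}}\big)\,\Pi(dx).$$ Let $\ell\le 0$, let $\psi\in\Psi_\ell$ have killing rate $\kappa$, and let $\delta,\beta\ge 0$, where $\psi(0)=\psi'(0+)=0$ is assumed if $\beta=0$. Put $$\mathcal T_{\delta,\beta}\psi(u)=\frac{u+\beta-\delta}{u+\beta}\,\psi(u+\beta)-\frac{\beta-\delta}{\beta}\,\psi(\beta),$$ where $\frac{v-\delta}{v}\psi(v)$ is read as $\psi(0)-\delta\psi'(0+)$ at $v=0$ if $\psi(0)=0$, and as $\psi(0)$ at $v=0$ if $\delta=0$. **Proposition.** 1. If $\kappa=0$ or $\delta=0$ or $\ell=0$, then $\mathcal T_{\delta,\beta}\psi\in\Psi_{\ell-\beta}\subseteq\Psi_\ell$, with killing rate $0$. In every case $\mathcal T_{\delta,\beta}\psi\in\Psi_{-\beta}$, with killing rate $0$. 2. If $\psi$ has Gaussian coefficient $\sigma$ and jump measure $\Pi$, then $\mathcal T_{\delta,\beta}\psi$ has Gaussian coefficient $\sigma$ and its jump measure is $$e^{\beta x}\,\Pi(dx)+\delta e^{\beta x}\,\overline\Pi(x)\,dx+\delta\kappa\, e^{\beta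 x}\,dx\quad\text{on }(-\infty,0),\qquad \overline\Pi(x)=\Pi(-\infty,x).$$ -/

import Mathlib

open MeasureTheory ProbabilityTheory Filter Topology Set
open scoped NNReal ENNReal

noncomputable section

namespace SNLevy

/-- The path `x` is càdlàg and has no positive jumps: at every time `t` it is right-continuous and
has a finite left limit `l` with `x t ≤ l`.  (At `t = 0` the requirement on `l` is void.) -/
def IsCadlagNoPosJumps (x : ℝ≥0 → ℝ) : Prop :=
  ∀ t : ℝ≥0, ContinuousWithinAt x (Ici t) t ∧ ∃ l : ℝ, Tendsto x (𝓝[<] t) (𝓝 l) ∧ x t ≤ l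

/-- A real-valued Lévy process (without killing) with no positive jumps. -/
structure IsSpectrallyNegative {Ω : Type*} [MeasurableSpace Ω] (P : Measure Ω)
    (X : ℝ≥0 → Ω → ℝ) : Prop where
  measurable : ∀ t, Measurable (X t)
  start : ∀ᵐ ω ∂P, X 0 ω = 0
  indep : HasIndepIncrements X P
  stationary : ∀ s t : ℝ≥0, IdentDistrib (fun ω => X (s + t) ω - X s ω) (X t) P P
  paths : ∀ᵐ ω ∂P, IsCadlagNoPosJumps (fun t => X t ω)

/-- `ζ` is a killing time of rate `κ` independent of `X`: it is exponentially distributed with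
parameter `κ` if `κ > 0`, and almost surely infinite if `κ = 0`. -/
structure IsKillingTime {Ω : Type*} [MeasurableSpace Ω] (P : Measure Ω)
    (X : ℝ≥0 → Ω → ℝ) (κ : ℝ) (ζ : Ω → ℝ≥0∞) : Prop where
  rate_nonneg : 0 ≤ κ
  measurable : Measurable ζ
  law : ∀ t : ℝ≥0, P {ω | (t : ℝ≥0∞) < ζ ω} = ENNReal.ofReal (Real.exp (-κ * t))
  indep : IndepFun ζ (fun ω t => X t ω) P

/-- `ψ` is the Laplace exponent of a Lévy process with no positive jumps, killed at the independent
rate `κ`, and is well defined on `(ℓ, ∞)` (and, as always, on `[0, ∞)`): there,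
`E[exp (u ξ_t)]` is finite and equal to `exp (t ψ(u))`, where `ξ` is `X` killed at time `ζ`
and `exp (u ξ_t)` is `0` from the killing time on.  The values of `ψ` elsewhere are irrelevant. -/
def IsLaplaceExponent (ℓ κ : ℝ) (ψ : ℝ → ℝ) : Prop :=
  ∃ (Ω : Type) (_ : MeasurableSpace Ω) (P : Measure Ω) (_ : IsProbabilityMeasure P)
    (X : ℝ≥0 → Ω → ℝ) (ζ : Ω → ℝ≥0∞),
    IsSpectrallyNegative P X ∧ IsKillingTime P X κ ζ ∧
    ∀ u : ℝ, (ℓ < u ∨ 0 ≤ u) → ∀ t : ℝ≥0,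
      Integrable ({ω | (t : ℝ≥0∞) < ζ ω}.indicator fun ω => Real.exp (u * X t ω)) P ∧
      ∫ ω, {ω | (t : ℝ≥0∞) < ζ ω}.indicator (fun ω => Real.exp (u * X t ω)) ω ∂P
        = Real.exp (t * ψ u)

/-- The class `Ψ_ℓ`. -/
def Psi (ℓ : ℝ) : Set (ℝ → ℝ) := {ψ | ∃ κ : ℝ, IsLaplaceExponent ℓ κ ψ}

/-- `Π` is a measure concentrated on `(-∞, 0)` with `∫ (1 ∧ x²) Π(dx) < ∞`. -/
structure IsLevyMeasure (Lam : Measure ℝ) : Prop where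
  conc : Lam (Ici 0) = 0
  finite : ∫⁻ x, ENNReal.ofReal (min 1 (x ^ 2)) ∂Lam < ∞

/-- The Lévy–Khintchine formula: `ψ` has killing rate `κ`, linear coefficient `a`,
Gaussian coefficient `σ` and jump measure `Lam`.  (For `u ≥ 0` the integrand is bounded by a
multiple of `1 ∧ x²`, hence integrable.) -/
structure HasCharacteristics (ψ : ℝ → ℝ) (κ a σ : ℝ) (Lam : Measure ℝ) : Prop where
  rate_nonneg : 0 ≤ κ
  gauss_nonneg : 0 ≤ σ
  levy : IsLevyMeasure Lam
  formula : ∀ u : ℝ, 0 ≤ u → ψ u = -κ + a * u + 1 / 2 * σ ^ 2 * u ^ 2 +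
    ∫ x in Iio (0 : ℝ), (Real.exp (u * x) - 1 - u * x * (if |x| < 1 then 1 else 0)) ∂Lam

/-- `(v - δ) / v * ψ(v)`, read at `v = 0` as `ψ(0) - δ ψ'(0+)`, its limit when `ψ(0) = 0`. -/
def ratioTerm (δ : ℝ) (ψ : ℝ → ℝ) (v : ℝ) : ℝ :=
  if v = 0 then ψ 0 - δ * derivWithin ψ (Ioi 0) 0 else (v - δ) / v * ψ v

/-- `𝒯_{δ,β} ψ(u) = (u + β - δ) / (u + β) * ψ(u + β) - (β - δ) / β * ψ(β)`. -/
def T (δ β : ℝ) (ψ : ℝ → ℝ) (u : ℝ) : ℝ :=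
  ratioTerm δ ψ (u + β) - ratioTerm δ ψ β

/-- The measure `e^{βx} Π(dx) + δ e^{βx} Π(-∞,x) dx + δ κ e^{βx} dx` on `(-∞, 0)`, for a measure
`Π = Lam` concentrated there. -/
def newJumpMeasure (δ β κ : ℝ) (Lam : Measure ℝ) : Measure ℝ :=
  Lam.withDensity (fun x => ENNReal.ofReal (Real.exp (β * x)))
  + (volume.restrict (Iio 0)).withDensity
      (fun x => ENNReal.ofReal (δ * Real.exp (β * x)) * Lam (Iio x))
  + (volume.restrict (Iio 0)).withDensity
      (fun x => ENNReal.ofReal (δ * κ * Real.exp (β * x)))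

end SNLevy

end

open MeasureTheory ProbabilityTheory Filter Topology Set
open scoped NNReal ENNReal

noncomputable section

namespace SNLevy

/-! With r(v) = ψ(v)/v the transform splits as Tψ(u) = [ψ(u+β) − ψ(β)] − δ[r(u+β) − r(β)] (`T_eq`).
The first bracket is the Esscher transform, realised by tilting the laws with e^{βx}. The second
summand is the exponent of laws on (−∞,0], those of the negative of a subordinator. The reason is
(e^{vx} − 1)/v = ∫_0^x e^{vy} dy (`expPrim`): by Tonelli, a jump measure Π is turned into the
density e^{βy} Π(−∞,y), and the Gaussian part becomes a drift. Convolving the two families of laws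
gives the laws of the transformed process.

Part 1 avoids the Lévy–Khintchine formula by letting n P(X_{1/n} ∈ dx) play the role of Π. The
negative part of X_{1/n} yields a compound Poisson law with the tail density. The positive part
contributes only a drift in the limit, because n P(X_{1/n} > ε) → 0 for a process without positive
jumps (`IsSpectrallyNegative.tendsto_mul_measure_Ioi`). Laws on (−∞,0] are closed under limits of
Laplace transforms (`exists_hasLaplace_of_tendsto`), so n → ∞ gives `LevyLaws.isSubExponent_ratio`;
β = 0 is the limit β ↓ 0. Killing adds κ(1/(u+β) − 1/β), which comes from exponentially distributed
jumps and makes sense only for u > −β; this is why a positive rate costs the strip below −β.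

The exponent has to come from an actual process. Uniqueness of Laplace transforms turns the laws
into a convolution semigroup, and `exists_levy` builds the process: consistent random walks on the
dyadic times have a projective limit, the number of large oscillations has geometric tails (hence
one-sided limits exist), and 2^k P(X_{2^{-k}} > ε) → 0 rules out upward jumps.

Part 2 substitutes the Lévy–Khintchine formula into `T_eq`. For β = 0 the assumption ψ'(0+) = 0
first yields, by monotone convergence, that large jumps have finite mean. -/

/-! ### Laplace transforms of measures and convolution -/

/-- The two-sided Laplace transform of `ν` exists on `(c, ∞) ∪ [0, ∞)` and equals `exp ∘ f`. -/
def HasLaplace (c : ℝ) (ν : Measure ℝ) (f : ℝ → ℝ) : Prop :=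
  ∀ u : ℝ, (c < u ∨ 0 ≤ u) → ∫⁻ x, ENNReal.ofReal (Real.exp (u * x)) ∂ν = ENNReal.ofReal (Real.exp (f u))

lemma integrable_of_lintegral_eq {α : Type*} [MeasurableSpace α] {μ : Measure α} {h : α → ℝ}
    (hm : AEMeasurable h μ) (h0 : ∀ x, 0 ≤ h x) {y : ℝ} (hy : 0 ≤ y)
    (H : ∫⁻ x, ENNReal.ofReal (h x) ∂μ = ENNReal.ofReal y) :
    Integrable h μ ∧ ∫ x, h x ∂μ = y := by
  refine ⟨(lintegral_ofReal_ne_top_iff_integrable hm.aestronglyMeasurable (.of_forall h0)).1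
    (by simp [H]), ?_⟩
  rw [integral_eq_lintegral_of_nonneg_ae (.of_forall h0) hm.aestronglyMeasurable, H,
    ENNReal.toReal_ofReal hy]

lemma HasLaplace.integrable {c : ℝ} {ν : Measure ℝ} {f : ℝ → ℝ} (h : HasLaplace c ν f) {u : ℝ}
    (hu : c < u ∨ 0 ≤ u) : Integrable (fun x => Real.exp (u * x)) ν :=
  (integrable_of_lintegral_eq (by fun_prop) (fun _ => (Real.exp_pos _).le) (Real.exp_pos _).le
    (h u hu)).1

lemma HasLaplace.integral {c : ℝ} {ν : Measure ℝ} {f : ℝ → ℝ} (h : HasLaplace c ν f) {u : ℝ}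
    (hu : c < u ∨ 0 ≤ u) : ∫ x, Real.exp (u * x) ∂ν = Real.exp (f u) :=
  (integrable_of_lintegral_eq (by fun_prop) (fun _ => (Real.exp_pos _).le) (Real.exp_pos _).le
    (h u hu)).2

lemma hasLaplace_of_integral {c : ℝ} {ν : Measure ℝ} {f : ℝ → ℝ}
    (h : ∀ u : ℝ, (c < u ∨ 0 ≤ u) → Integrable (fun x => Real.exp (u * x)) ν ∧
      ∫ x, Real.exp (u * x) ∂ν = Real.exp (f u)) : HasLaplace c ν f := fun u hu => by
  rw [← ofReal_integral_eq_lintegral_ofReal (h u hu).1 (.of_forall fun _ => (Real.exp_pos _).le),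
    (h u hu).2]

lemma HasLaplace.mono {c c' : ℝ} {ν : Measure ℝ} {f : ℝ → ℝ} (h : HasLaplace c ν f) (hc : c ≤ c') :
    HasLaplace c' ν f := fun u hu => h u (hu.imp_left hc.trans_lt)

lemma HasLaplace.congr {c : ℝ} {ν : Measure ℝ} {f g : ℝ → ℝ} (h : HasLaplace c ν f)
    (hfg : ∀ u, (c < u ∨ 0 ≤ u) → f u = g u) : HasLaplace c ν g := fun u hu => by
  rw [h u hu, hfg u hu]

lemma HasLaplace.conv {c : ℝ} {μ ν : Measure ℝ} [SFinite ν] {f g : ℝ → ℝ}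
    (hf : HasLaplace c μ f) (hg : HasLaplace c ν g) :
    HasLaplace c (μ.conv ν) (fun u => f u + g u) := fun u hu => by
  rw [Measure.lintegral_conv (by fun_prop)]
  simp_rw [mul_add, Real.exp_add, ENNReal.ofReal_mul (Real.exp_pos _).le]
  simp_rw [lintegral_const_mul' _ _ ENNReal.ofReal_ne_top, hg u hu,
    lintegral_mul_const' _ _ ENNReal.ofReal_ne_top, hf u hu]

lemma hasLaplace_dirac (c a : ℝ) : HasLaplace c (Measure.dirac a) (fun u => u * a) := fun u _ => by
  rw [lintegral_dirac' _ (by fun_prop)]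

lemma conv_Ioi_zero {μ ν : Measure ℝ} [SFinite μ] [SFinite ν] (hμ : μ (Ioi 0) = 0)
    (hν : ν (Ioi 0) = 0) : (μ.conv ν) (Ioi 0) = 0 := by
  rw [Measure.conv, Measure.map_apply (by fun_prop) measurableSet_Ioi]
  refine measure_mono_null (t := (Ioi 0 ×ˢ univ) ∪ (univ ×ˢ Ioi 0)) ?_ ?_
  · rintro ⟨x, y⟩ h
    simp only [mem_preimage, mem_Ioi] at h
    simp only [mem_union, mem_prod, mem_Ioi, mem_univ, and_true, true_and]
    by_contra! hh
    linarith
  · rw [measure_union_null_iff]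
    simp [Measure.prod_prod, hμ, hν]

/-! ### Uniqueness, tightness and limits of Laplace transforms -/

/-- Finite measures on the line are determined by their Laplace transform on `(0, ∞)`. -/
theorem measure_eq_of_integral_exp_eq {μ ν : Measure ℝ} [IsFiniteMeasure μ] [IsFiniteMeasure ν]
    (hμ : ∀ u : ℝ, 0 < u → Integrable (fun x => Real.exp (u * x)) μ)
    (hν : ∀ u : ℝ, 0 < u → Integrable (fun x => Real.exp (u * x)) ν)
    (h : ∀ u : ℝ, 0 < u → ∫ x, Real.exp (u * x) ∂μ = ∫ x, Real.exp (u * x) ∂ν) : μ = ν := by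
  have hint : ∀ {μ : Measure ℝ}, (∀ u : ℝ, 0 < u → Integrable (fun x => Real.exp (u * x)) μ) →
      AnalyticOnNhd ℂ (complexMGF id μ) {z | 0 < z.re} := fun {μ} hμ => by
    refine analyticOnNhd_complexMGF.mono fun z hz => ?_
    refine mem_interior.2 ⟨Ioi 0, fun u hu => ?_, isOpen_Ioi, hz⟩
    exact hμ u hu
  -- Identity theorem: both transforms are analytic on Re z > 0 and agree at real points near 1.
  have heq : EqOn (complexMGF id μ) (complexMGF id ν) {z | 0 < z.re} := by
    refine AnalyticOnNhd.eqOn_of_preconnected_of_frequently_eq (hint hμ) (hint hν)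
      ((convex_Ioi (0 : ℝ)).linear_preimage Complex.reLm).isPreconnected (z₀ := 1) (by simp) ?_
    have h_real : ∃ᶠ (x : ℝ) in 𝓝[≠] 1, complexMGF id μ x = complexMGF id ν x := by
      have : ∀ᶠ x : ℝ in 𝓝[≠] 1, complexMGF id μ x = complexMGF id ν x := by
        filter_upwards [mem_nhdsWithin_of_mem_nhds (Ioi_mem_nhds (zero_lt_one))] with x hx
        rw [complexMGF_ofReal, complexMGF_ofReal]
        simpa [mgf] using h x hx
      exact this.frequently
    rw [frequently_iff_seq_forall] at h_real ⊢
    obtain ⟨xs, hx_tendsto, hx_eq⟩ := h_real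
    refine ⟨fun n => xs n, ?_, fun n => ?_⟩
    · rw [tendsto_nhdsWithin_iff] at hx_tendsto ⊢
      constructor
      · exact_mod_cast (Complex.continuous_ofReal.tendsto 1).comp hx_tendsto.1
      · simpa using hx_tendsto.2
    · simp [hx_eq]
  have hlim : ∀ {μ : Measure ℝ} [IsFiniteMeasure μ],
      (∀ u : ℝ, 0 < u → Integrable (fun x => Real.exp (u * x)) μ) → ∀ t : ℝ,
      Tendsto (fun n : ℕ => complexMGF id μ (((1 / ((n : ℝ) + 1) : ℝ) : ℂ) + t * Complex.I)) atTop
        (𝓝 (charFun μ t)) := fun {μ} _ hμ t => by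
    rw [← complexMGF_id_mul_I]
    unfold complexMGF
    -- The characteristic function is the boundary value on Re z = 0. Since 0 < 1/(n+1) ≤ 1, the
    -- modulus is at most 1 for x ≤ 0 and at most e^x for x ≥ 0.
    refine tendsto_integral_of_dominated_convergence (fun x => 1 + Real.exp (1 * x))
      (fun n => by fun_prop) ((integrable_const _).add (hμ 1 one_pos)) (fun n => ?_) ?_
    · refine .of_forall fun x => ?_
      rw [Complex.norm_exp]
      have : ((((1 / ((n : ℝ) + 1) : ℝ) : ℂ) + t * Complex.I) * (id x : ℝ)).re
          = 1 / ((n : ℝ) + 1) * x := by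
        generalize 1 / ((n : ℝ) + 1) = a
        simp
      rw [this]
      have h1 : 1 / ((n : ℝ) + 1) ≤ 1 := by
        rw [div_le_one (by positivity)]; linarith [(Nat.cast_nonneg n : (0 : ℝ) ≤ n)]
      have h0 : 0 < 1 / ((n : ℝ) + 1) := by positivity
      rcases le_total x 0 with hx | hx
      · have : Real.exp (1 / ((n : ℝ) + 1) * x) ≤ 1 := Real.exp_le_one_iff.2 (by nlinarith)
        linarith [Real.exp_pos (1 * x)]
      · have : Real.exp (1 / ((n : ℝ) + 1) * x) ≤ Real.exp (1 * x) :=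
          Real.exp_le_exp.2 (by nlinarith)
        linarith
    · refine .of_forall fun x => ?_
      refine (Complex.continuous_exp.tendsto _).comp (Tendsto.mul_const _ ?_)
      have : Tendsto (fun n : ℕ => ((1 / ((n : ℝ) + 1) : ℝ) : ℂ)) atTop (𝓝 ((0 : ℝ) : ℂ)) :=
        (Complex.continuous_ofReal.tendsto 0).comp tendsto_one_div_add_atTop_nhds_zero_nat
      simpa using this.add_const ((t : ℂ) * Complex.I)
  refine Measure.ext_of_charFun (funext fun t => ?_)
  refine tendsto_nhds_unique (hlim hμ t) ((hlim hν t).congr fun n => (heq ?_).symm)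
  have : 0 < 1 / ((n : ℝ) + 1) := by positivity
  change (0 : ℝ) < (((1 / ((n : ℝ) + 1) : ℝ) : ℂ) + t * Complex.I).re
  generalize 1 / ((n : ℝ) + 1) = a at this ⊢
  simpa using this

lemma HasLaplace.unique {c : ℝ} {μ ν : Measure ℝ} [IsFiniteMeasure μ] [IsFiniteMeasure ν]
    {f : ℝ → ℝ} (hμ : HasLaplace c μ f) (hν : HasLaplace c ν f) : μ = ν :=
  measure_eq_of_integral_exp_eq (fun _ hu => hμ.integrable (.inr hu.le))
    (fun _ hu => hν.integrable (.inr hu.le))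
    (fun _ hu => by rw [hμ.integral (.inr hu.le), hν.integral (.inr hu.le)])

/-- On (−∞,0], |x| > 1/u forces e^{ux} ≤ e^{-1} ≤ 1/2, so Markov's inequality bounds the tail by 2(1
− e^{f_n(u)}). This tends to 2(1 − e^{g(u)}) in n, which is small for small u because g vanishes at
0+. -/
lemma isTight_of_hasLaplace {ν : ℕ → Measure ℝ} [∀ n, IsProbabilityMeasure (ν n)]
    (hsupp : ∀ n, ν n (Ioi 0) = 0) {f : ℕ → ℝ → ℝ} {g : ℝ → ℝ}
    (h : ∀ n, HasLaplace 0 (ν n) (f n))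
    (hlim : ∀ u, 0 ≤ u → Tendsto (fun n => f n u) atTop (𝓝 (g u)))
    (h0 : Tendsto g (𝓝[>] 0) (𝓝 0)) : IsTightMeasureSet (range ν) := by
  have key : ∀ n, ∀ u : ℝ, 0 < u →
      ν n {x | 1 / u < ‖x‖} ≤ ENNReal.ofReal (2 * (1 - Real.exp (f n u))) := by
    intro n u hu
    have hi := (h n).integrable (u := u) (.inr hu.le)
    have h1 : ν n {x | 1 / u < ‖x‖} ≤ ν n {x | 1 ≤ 2 * (1 - Real.exp (u * x))} := by
      refine measure_mono_ae ?_
      have : ∀ᵐ x ∂ν n, ¬ (0 < x) := by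
        rw [ae_iff]; simpa [Ioi] using hsupp n
      filter_upwards [this] with x hx hx'
      change 1 ≤ 2 * (1 - Real.exp (u * x))
      change 1 / u < ‖x‖ at hx'
      rw [Real.norm_eq_abs, abs_of_nonpos (not_lt.1 hx), div_lt_iff₀ hu] at hx'
      have : Real.exp (u * x) ≤ Real.exp (-1) := Real.exp_le_exp.2 (by linarith)
      have h2 : Real.exp (-1) ≤ 1 / 2 := by
        rw [Real.exp_neg, inv_eq_one_div]
        exact one_div_le_one_div_of_le two_pos (by linarith [Real.add_one_le_exp (1 : ℝ)])
      linarith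
    refine h1.trans ?_
    have h3 := mul_meas_ge_le_integral_of_nonneg (μ := ν n)
      (f := fun x => 2 * (1 - Real.exp (u * x))) ?_ (((integrable_const 1).sub hi).const_mul 2) 1
    · have h4 : ∫ x, 2 * (1 - Real.exp (u * x)) ∂ν n = 2 * (1 - Real.exp (f n u)) := by
        rw [integral_const_mul, integral_sub (integrable_const _) hi,
          (h n).integral (.inr hu.le)]
        simp
      rw [h4, one_mul] at h3
      rw [← ENNReal.ofReal_toReal (measure_ne_top (ν n) {x | 1 ≤ 2 * (1 - Real.exp (u * x))})]
      exact ENNReal.ofReal_le_ofReal h3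
    · have : ∀ᵐ x ∂ν n, ¬ (0 < x) := by
        rw [ae_iff]; simpa [Ioi] using hsupp n
      filter_upwards [this] with x hx
      have : Real.exp (u * x) ≤ 1 := Real.exp_le_one_iff.2 (by nlinarith)
      simp only [Pi.zero_apply]
      linarith
  refine isTightMeasureSet_range_of_tendsto_limsup_measure_norm_gt ?_
  have hb : ∀ r : ℝ, 0 < r → limsup (fun n => ν n {x | r < ‖x‖}) atTop
      ≤ ENNReal.ofReal (2 * (1 - Real.exp (g (1 / r)))) := by
    intro r hr
    have hl : Tendsto (fun n => ENNReal.ofReal (2 * (1 - Real.exp (f n (1 / r))))) atTop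
        (𝓝 (ENNReal.ofReal (2 * (1 - Real.exp (g (1 / r)))))) :=
      ENNReal.tendsto_ofReal ((((Real.continuous_exp.tendsto _).comp
        (hlim (1 / r) (by positivity))).const_sub 1).const_mul 2)
    rw [← hl.limsup_eq]
    refine limsup_le_limsup (.of_forall fun n => ?_)
    have := key n (1 / r) (by positivity)
    simpa using this
  have hz : Tendsto (fun r : ℝ => ENNReal.ofReal (2 * (1 - Real.exp (g (1 / r))))) atTop (𝓝 0) := by
    have h1 : Tendsto (fun r : ℝ => g (1 / r)) atTop (𝓝 0) := by
      refine h0.comp ?_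
      exact tendsto_inv_atTop_nhdsGT_zero.congr fun r => (one_div r).symm
    have := ENNReal.tendsto_ofReal ((((Real.continuous_exp.tendsto _).comp h1).const_sub 1).const_mul 2)
    simpa using this
  refine tendsto_of_tendsto_of_tendsto_of_le_of_le' tendsto_const_nhds hz
    (.of_forall fun _ => zero_le) ?_
  filter_upwards [eventually_gt_atTop 0] with r hr using hb r hr

/-- Laws on `(-∞, 0]` are closed under pointwise limits of Laplace transforms. -/
theorem exists_hasLaplace_of_tendsto {c : ℝ} {ν : ℕ → Measure ℝ}
    [hp : ∀ n, IsProbabilityMeasure (ν n)]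
    (hsupp : ∀ n, ν n (Ioi 0) = 0) {f : ℕ → ℝ → ℝ} {g : ℝ → ℝ}
    (h : ∀ n, HasLaplace c (ν n) (f n))
    (hlim : ∀ u, (c < u ∨ 0 ≤ u) → Tendsto (fun n => f n u) atTop (𝓝 (g u)))
    (h0 : Tendsto g (𝓝[>] 0) (𝓝 0)) :
    ∃ μ : Measure ℝ, IsProbabilityMeasure μ ∧ μ (Ioi 0) = 0 ∧ HasLaplace c μ g := by
  have htight : IsTightMeasureSet (range ν) :=
    isTight_of_hasLaplace hsupp (fun n u hu => h n u (.inr (by rcases hu with hu | hu <;> linarith)))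
      (fun u hu => hlim u (.inr hu)) h0
  let ν' : ℕ → ProbabilityMeasure ℝ := fun n => ⟨ν n, hp n⟩
  have hc : IsCompact (closure (range ν')) := by
    refine isCompact_closure_of_isTightMeasureSet (htight.subset ?_)
    rintro _ ⟨_, ⟨n, rfl⟩, rfl⟩
    exact ⟨n, rfl⟩
  obtain ⟨μ, -, φ, hφ, hμ⟩ := hc.tendsto_subseq (x := ν') (fun n => subset_closure ⟨n, rfl⟩)
  have hopen : ∀ G : Set ℝ, IsOpen G → (μ : Measure ℝ) G ≤ liminf (fun i => ν (φ i) G) atTop :=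
    fun G hG => ProbabilityMeasure.le_liminf_measure_open_of_tendsto hμ hG
  -- Portmanteau on open sets gives one inequality for any continuous nonnegative function, bounded
  -- or not. The reverse inequality for e^{ux} is obtained below by applying it to a dominating
  -- function minus e^{ux}.
  have fatou : ∀ k : ℝ → ℝ, Continuous k → 0 ≤ k →
      ∫⁻ x, ENNReal.ofReal (k x) ∂(μ : Measure ℝ) ≤
        liminf (fun i => ∫⁻ x, ENNReal.ofReal (k x) ∂(ν (φ i))) atTop := fun k hk hk0 =>
    lintegral_le_liminf_lintegral_of_forall_isOpen_measure_le_liminf_measure hk hk0 hopen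
  have hzero : (μ : Measure ℝ) (Ioi 0) = 0 := by
    have := hopen (Ioi 0) isOpen_Ioi
    simpa [hsupp] using this
  have hlim' : ∀ u, (c < u ∨ 0 ≤ u) →
      Tendsto (fun n => Real.exp (f (φ n) u)) atTop (𝓝 (Real.exp (g u))) := fun u hu =>
    (Real.continuous_exp.tendsto _).comp ((hlim u hu).comp hφ.tendsto_atTop)
  have hle : ∀ u, (c < u ∨ 0 ≤ u) → ∫⁻ x, ENNReal.ofReal (Real.exp (u * x)) ∂(μ : Measure ℝ) ≤
      ENNReal.ofReal (Real.exp (g u)) := by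
    intro u hu
    refine (fatou _ (by fun_prop) (fun _ => (Real.exp_pos _).le)).trans ?_
    simp_rw [h _ u hu]
    rw [(ENNReal.tendsto_ofReal (hlim' u hu)).liminf_eq]
  have hint : ∀ u, (c < u ∨ 0 ≤ u) → Integrable (fun x => Real.exp (u * x)) (μ : Measure ℝ) :=
    fun u hu => (lintegral_ofReal_ne_top_iff_integrable (by fun_prop)
      (.of_forall fun _ => (Real.exp_pos _).le)).1 (ne_top_of_le_ne_top ENNReal.ofReal_ne_top (hle u hu))
  have hle' : ∀ u, (c < u ∨ 0 ≤ u) →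
      ∫ x, Real.exp (u * x) ∂(μ : Measure ℝ) ≤ Real.exp (g u) := fun u hu => by
    have := hle u hu
    rw [← ofReal_integral_eq_lintegral_ofReal (hint u hu) (.of_forall fun _ => (Real.exp_pos _).le),
      ENNReal.ofReal_le_ofReal_iff (Real.exp_pos _).le] at this
    exact this
  refine ⟨μ, inferInstance, hzero, hasLaplace_of_integral fun u hu => ⟨hint u hu,
    le_antisymm (hle' u hu) ?_⟩⟩
  -- Uniform integrability on (−∞,0]. For u < 0 take u' halfway to c and split at (u − u')x = log η:
  -- on one side e^{ux} ≤ η e^{u'x}, on the other e^{ux} is bounded by its value at the splitting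
  -- point. For u ≥ 0 the constant 1 suffices.
  obtain ⟨u', hu', hdom⟩ : ∃ u', (c < u' ∨ 0 ≤ u') ∧ ∀ η : ℝ, 0 < η → ∃ B : ℝ, ∀ x : ℝ, x ≤ 0 →
      Real.exp (u * x) ≤ η * Real.exp (u' * x) + B := by
    rcases lt_or_ge u 0 with h' | h'
    · have hcu : c < u := hu.resolve_right (not_le.2 h')
      refine ⟨(c + u) / 2, .inl (by linarith), fun η hη => ?_⟩
      set d := u - (c + u) / 2 with hd
      have hd0 : 0 < d := by rw [hd]; linarith
      refine ⟨Real.exp (u * (Real.log η / d)), fun x _ => ?_⟩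
      rcases le_total (d * x) (Real.log η) with hx | hx
      · have : Real.exp (u * x) ≤ η * Real.exp ((c + u) / 2 * x) := by
          calc Real.exp (u * x) = Real.exp (d * x) * Real.exp ((c + u) / 2 * x) := by
                rw [← Real.exp_add]; congr 1; rw [hd]; ring
            _ ≤ Real.exp (Real.log η) * Real.exp ((c + u) / 2 * x) := by gcongr
            _ = _ := by rw [Real.exp_log hη]
        linarith [Real.exp_pos (u * (Real.log η / d))]
      · have : Real.exp (u * x) ≤ Real.exp (u * (Real.log η / d)) := by
          refine Real.exp_le_exp.2 (mul_le_mul_of_nonpos_left ?_ h'.le)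
          rw [div_le_iff₀ hd0]; linarith
        have := mul_pos hη (Real.exp_pos ((c + u) / 2 * x))
        linarith
    · refine ⟨0, .inr le_rfl, fun η hη => ⟨1, fun x hx => ?_⟩⟩
      have : Real.exp (u * x) ≤ 1 := Real.exp_le_one_iff.2 (by nlinarith)
      have := mul_pos hη (Real.exp_pos (0 * x))
      linarith
  have main : ∀ η : ℝ, 0 < η → Real.exp (g u) ≤
      ∫ x, Real.exp (u * x) ∂(μ : Measure ℝ) + η * Real.exp (g u') := by
    intro η hη
    obtain ⟨B, hB⟩ := hdom η hη
    -- The truncation at 0 makes the function nonnegative on the whole line; it changes nothing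
    -- almost everywhere, since (0,∞) has measure zero.
    let k : ℝ → ℝ := fun x => max 0 (η * Real.exp (u' * x) + B - Real.exp (u * x))
    have hk : ∀ {ρ : Measure ℝ} [IsProbabilityMeasure ρ], ρ (Ioi 0) = 0 →
        Integrable (fun x => Real.exp (u * x)) ρ → Integrable (fun x => Real.exp (u' * x)) ρ →
        ∫⁻ x, ENNReal.ofReal (k x) ∂ρ = ENNReal.ofReal
          (η * ∫ x, Real.exp (u' * x) ∂ρ + B - ∫ x, Real.exp (u * x) ∂ρ) ∧
          0 ≤ η * ∫ x, Real.exp (u' * x) ∂ρ + B - ∫ x, Real.exp (u * x) ∂ρ := by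
      intro ρ _ hρ hi hi'
      have h1 : (fun x => k x) =ᵐ[ρ] fun x => η * Real.exp (u' * x) + B - Real.exp (u * x) := by
        have : ∀ᵐ x ∂ρ, ¬ (0 < x) := by
          rw [ae_iff]; simpa [Ioi] using hρ
        filter_upwards [this] with x hx
        exact max_eq_right (by linarith [hB x (not_lt.1 hx)])
      have h2 : Integrable (fun x => η * Real.exp (u' * x) + B - Real.exp (u * x)) ρ :=
        ((hi'.const_mul η).add (integrable_const B)).sub hi
      have h3 : ∫ x, k x ∂ρ = η * ∫ x, Real.exp (u' * x) ∂ρ + B - ∫ x, Real.exp (u * x) ∂ρ := by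
        have h4 : Integrable (fun x => η * Real.exp (u' * x) + B) ρ :=
          (hi'.const_mul η).add (integrable_const B)
        rw [integral_congr_ae h1, integral_sub h4 hi,
          integral_add (hi'.const_mul η) (integrable_const B), integral_const_mul]
        simp
      rw [← h3]
      exact ⟨(ofReal_integral_eq_lintegral_ofReal (h2.congr h1.symm)
        (.of_forall fun x => le_max_left _ _)).symm, integral_nonneg fun x => le_max_left _ _⟩
    have hF := fatou k (by fun_prop) (fun x => le_max_left _ _)
    rw [(hk hzero (hint u hu) (hint u' hu')).1] at hF
    simp_rw [(hk (hsupp _) ((h _).integrable hu) ((h _).integrable hu')).1,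
      (h _).integral hu, (h _).integral hu'] at hF
    have hL := (((hlim' u' hu').const_mul η).add_const B).sub (hlim' u hu)
    rw [(ENNReal.tendsto_ofReal hL).liminf_eq, ENNReal.ofReal_le_ofReal_iff] at hF
    · have := (mul_nonneg hη.le (integral_nonneg (μ := (μ : Measure ℝ))
        fun x : ℝ => (Real.exp_pos (u' * x)).le))
      linarith
    · refine ge_of_tendsto' hL fun n => ?_
      have := (hk (hsupp (φ n)) ((h _).integrable hu) ((h _).integrable hu')).2
      rwa [(h _).integral hu, (h _).integral hu'] at this
  refine le_of_forall_pos_le_add fun ε hε => ?_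
  have := main (ε / Real.exp (g u')) (div_pos hε (Real.exp_pos _))
  rwa [div_mul_cancel₀ _ (Real.exp_pos _).ne'] at this

/-! ### Projective limits of sequences of laws -/

/-- A projective sequence of probability measures on a standard Borel space has a projective
limit. -/
theorem exists_projective_limit {E : Type} [MeasurableSpace E] [StandardBorelSpace E] [Nonempty E]
    (p : E → E) (hp : Measurable p) (μ : ℕ → Measure E) [hμ : ∀ n, IsProbabilityMeasure (μ n)]
    (hμp : ∀ n, (μ (n + 1)).map p = μ n) :
    ∃ (P : Measure (ℕ → E)) (_ : IsProbabilityMeasure P),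
      (∀ n, P.map (fun ω => ω n) = μ n) ∧ ∀ᵐ ω ∂P, ∀ n, p (ω (n + 1)) = ω n := by
  -- Conditional law of the finer level given its image under `p`.
  let K : ℕ → Kernel E E := fun n => condDistrib id p (μ (n + 1))
  have hK : ∀ n, (μ n) ⊗ₘ K n = (μ (n + 1)).map (fun x => (p x, x)) := fun n => by
    have := compProd_map_condDistrib (mβ := inferInstance) (μ := μ (n + 1)) (X := p)
      (Y := (id : E → E)) aemeasurable_id
    rwa [hμp n] at this
  -- Coordinate 0 is a dummy starting point: the law `μ n` sits at coordinate n + 1, and the shift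
  -- at the end removes the dummy.
  let κ : (n : ℕ) → Kernel (Π i : Finset.Iic n, E) E := fun n => match n with
    | 0 => Kernel.const _ (μ 0)
    | n + 1 => (K n).comap (fun x => x ⟨n + 1, by simp⟩) (by fun_prop)
  have hκ : ∀ n, IsMarkovKernel (κ n) := fun n => by
    cases n with
    | zero => simp only [κ]; infer_instance
    | succ n => simp only [κ, K]; infer_instance
  let e : E := Classical.arbitrary E
  let Q : Measure (ℕ → E) := Kernel.traj (X := fun _ => E) κ 0 (fun _ => e)
  have hstep : ∀ b, (Kernel.partialTraj (X := fun _ => E) κ 0 b (fun _ => e)) ⊗ₘ (κ b)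
      = Q.map (fun x => (Preorder.frestrictLe b x, x (b + 1))) := fun b =>
    Kernel.partialTraj_compProd_eq_map_traj (X := fun _ => E) (κ := κ) (a := 0) (b := b)
      (x₀ := fun _ => e) (Nat.zero_le b)
  have hpart : ∀ b, Kernel.partialTraj (X := fun _ => E) κ 0 b (fun _ => e) = Q.map (Preorder.frestrictLe b) :=
    fun b => (Kernel.traj_map_frestrictLe_apply 0 b _).symm
  have hlaw0 : Q.map (fun ω => ω 1) = μ 0 := by
    have h1 : Q.map (fun ω => ω 1)
        = (Q.map (fun x => (Preorder.frestrictLe 0 x, x (0 + 1)))).map Prod.snd := by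
      rw [Measure.map_map (by fun_prop) (by fun_prop)]; rfl
    rw [h1, ← hstep 0]
    simp only [κ]
    rw [Measure.compProd_const, Measure.map_snd_prod]
    simp
  have hpair : ∀ n, Q.map (fun ω => (ω (n + 1), ω (n + 2)))
      = (Q.map (fun ω => ω (n + 1))) ⊗ₘ K n := by
    intro n
    have h1 : Q.map (fun ω => (ω (n + 1), ω (n + 2)))
        = (Q.map (fun x => (Preorder.frestrictLe (n + 1) x, x (n + 1 + 1)))).map
          (fun z => (z.1 ⟨n + 1, by simp⟩, z.2)) := by
      rw [Measure.map_map (by fun_prop) (by fun_prop)]; rfl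
    rw [h1, ← hstep (n + 1)]
    ext s hs
    rw [Measure.map_apply (by fun_prop) hs, Measure.compProd_apply (by
      exact (show Measurable (fun z : (Π i : Finset.Iic (n + 1), E) × E =>
        (z.1 ⟨n + 1, by simp⟩, z.2)) by fun_prop) hs), Measure.compProd_apply hs, hpart,
      lintegral_map _ (by fun_prop), lintegral_map _ (by fun_prop)]
    · rfl
    · exact Kernel.measurable_kernel_prodMk_left hs
    · exact Kernel.measurable_kernel_prodMk_left
        ((show Measurable (fun z : (Π i : Finset.Iic (n + 1), E) × E =>
          (z.1 ⟨n + 1, by simp⟩, z.2)) by fun_prop) hs)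
  have hlaw : ∀ n, Q.map (fun ω => ω (n + 1)) = μ n := by
    intro n
    induction n with
    | zero => exact hlaw0
    | succ n ih =>
      have h1 : Q.map (fun ω => ω (n + 1 + 1))
          = (Q.map (fun ω => (ω (n + 1), ω (n + 2)))).map Prod.snd := by
        rw [Measure.map_map (by fun_prop) (by fun_prop)]; rfl
      rw [h1, hpair n, ih, hK n, Measure.map_map (by fun_prop) (by fun_prop)]
      exact Measure.map_id
  have hshift : Measurable (fun (ω : ℕ → E) n => ω (n + 1)) := by fun_prop
  refine ⟨Q.map (fun ω n => ω (n + 1)), Measure.isProbabilityMeasure_map hshift.aemeasurable,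
    fun n => ?_, ?_⟩
  · rw [Measure.map_map (by fun_prop) hshift]
    exact hlaw n
  · rw [ae_all_iff]
    intro n
    have hset : MeasurableSet {z : E × E | p z.2 = z.1} :=
      measurableSet_eq_fun (hp.comp measurable_snd) measurable_fst
    have h2 : ∀ᵐ z ∂((μ (n + 1)).map (fun x => (p x, x))), p z.2 = z.1 := by
      rw [ae_map_iff (by fun_prop) hset]
      simp
    rw [← hK n, ← hlaw n, ← hpair n, ae_map_iff (by fun_prop) hset] at h2
    rw [ae_map_iff hshift.aemeasurable]
    · exact h2
    · exact measurableSet_eq_fun (by fun_prop) (by fun_prop)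

/-! ### Oscillations of random walks -/

section Walk

variable {Ω : Type*} {Y : ℕ → Ω → ℝ}

/-- Partial sums of a sequence of random variables. -/
def walk (Y : ℕ → Ω → ℝ) (n : ℕ) (ω : Ω) : ℝ := ∑ i ∈ Finset.range n, Y i ω

/-- Events determined by the first `k` steps. -/
abbrev pastAlg (Y : ℕ → Ω → ℝ) (k : ℕ) : MeasurableSpace Ω :=
  ⨆ i ∈ Iio k, (inferInstance : MeasurableSpace ℝ).comap (Y i)

/-- Events determined by the steps from `k` on. -/
abbrev futureAlg (Y : ℕ → Ω → ℝ) (k : ℕ) : MeasurableSpace Ω :=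
  ⨆ i ∈ Ici k, (inferInstance : MeasurableSpace ℝ).comap (Y i)

lemma measurableSet_lt_abs {m : MeasurableSpace Ω} {f : Ω → ℝ} (hf : Measurable[m] f) (c : ℝ) :
    MeasurableSet[m] {ω | c < |f ω|} :=
  measurableSet_lt measurable_const (measurable_abs.comp hf)

lemma measurable_walk_past {j k : ℕ} (hjk : j ≤ k) : Measurable[pastAlg Y k] (walk Y j) := by
  refine Finset.measurable_fun_sum _ fun i hi => ?_
  have : (inferInstance : MeasurableSpace ℝ).comap (Y i) ≤ pastAlg Y k :=
    le_iSup₂_of_le i (show i ∈ Iio k from (Finset.mem_range.1 hi).trans_le hjk) le_rfl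
  exact (comap_measurable (Y i)).mono this le_rfl

lemma walk_sub {i j : ℕ} (hij : i ≤ j) (ω : Ω) :
    walk Y j ω - walk Y i ω = ∑ l ∈ Finset.Ico i j, Y l ω := by
  rw [walk, walk, Finset.sum_Ico_eq_sub _ hij]

lemma measurable_walk_future {i j k : ℕ} (hk : k ≤ i) (hij : i ≤ j) :
    Measurable[futureAlg Y k] (fun ω => walk Y j ω - walk Y i ω) := by
  simp_rw [walk_sub hij]
  refine Finset.measurable_fun_sum _ fun l hl => ?_
  have : (inferInstance : MeasurableSpace ℝ).comap (Y l) ≤ futureAlg Y k :=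
    le_iSup₂_of_le l (show l ∈ Ici k from hk.trans (Finset.mem_Ico.1 hl).1) le_rfl
  exact (comap_measurable (Y l)).mono this le_rfl

/-- `s` has `p` successive oscillations larger than `δ` between the times `a` and `n`. -/
def Osc (s : ℕ → ℝ) (δ : ℝ) (n : ℕ) : ℕ → ℕ → Prop
  | 0, _ => True
  | p + 1, a => ∃ i j, a ≤ i ∧ i ≤ j ∧ j ≤ n ∧ δ < |s j - s i| ∧ Osc s δ n p j

lemma Osc.mono {s : ℕ → ℝ} {δ : ℝ} {n p a b : ℕ} (h : Osc s δ n p a) (hba : b ≤ a) :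
    Osc s δ n p b := by
  cases p with
  | zero => trivial
  | succ p => obtain ⟨i, j, h1, h2⟩ := h; exact ⟨i, j, hba.trans h1, h2⟩

lemma measurableSet_osc {m : MeasurableSpace Ω} {S : ℕ → Ω → ℝ} {k : ℕ}
    (hS : ∀ i j, k ≤ i → i ≤ j → Measurable (fun ω => S j ω - S i ω)) (δ : ℝ) (n p : ℕ) :
    ∀ a, k ≤ a → MeasurableSet {ω | Osc (fun j => S j ω) δ n p a} := by
  induction p with
  | zero => intro a _; simp [Osc]
  | succ p ih =>
    intro a ha
    have : {ω | Osc (fun j => S j ω) δ n (p + 1) a} = ⋃ i, ⋃ j, ⋃ (_ : a ≤ i), ⋃ (_ : i ≤ j),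
        ⋃ (_ : j ≤ n), {ω | δ < |S j ω - S i ω|} ∩ {ω | Osc (fun j => S j ω) δ n p j} := by
      ext ω; simp only [Osc, mem_ofPred_eq, mem_iUnion, mem_inter_iff, exists_prop]
    rw [this]
    refine .iUnion fun i => .iUnion fun j => .iUnion fun hi => .iUnion fun hj => .iUnion fun _ => ?_
    exact (measurableSet_lt measurable_const (measurable_abs.comp (hS i j (ha.trans hi) hj))).inter
      (ih j (ha.trans (hi.trans hj)))

variable [mΩ : MeasurableSpace Ω] {P : Measure Ω}

lemma indep_past_future (hY : ∀ i, Measurable (Y i)) (h : iIndepFun Y P) (k : ℕ) :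
    Indep (pastAlg Y k) (futureAlg Y k) P :=
  indep_iSup_of_disjoint (fun i => (hY i).comap_le) h.iIndep
    (Set.disjoint_left.2 fun _ h1 h2 => absurd (mem_Iio.1 h1) (not_lt.2 (mem_Ici.1 h2)))

lemma pastAlg_le (hY : ∀ i, Measurable (Y i)) (k : ℕ) : pastAlg Y k ≤ mΩ :=
  iSup₂_le fun i _ => (hY i).comap_le

lemma futureAlg_le (hY : ∀ i, Measurable (Y i)) (k : ℕ) : futureAlg Y k ≤ mΩ :=
  iSup₂_le fun i _ => (hY i).comap_le

/-- Decomposition at the first time one of the events `E k` happens. -/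
lemma measure_first_time [IsProbabilityMeasure P] (hY : ∀ i, Measurable (Y i)) (h : iIndepFun Y P)
    {E B : ℕ → Set Ω} (hE : ∀ k, MeasurableSet[pastAlg Y k] (E k))
    (hB : ∀ k, MeasurableSet[futureAlg Y k] (B k)) (n : ℕ) :
    ∃ q : ℕ → ℝ≥0∞, (∀ k, q k ≤ P (E k)) ∧ P (⋃ k ∈ Finset.range n, E k) = ∑ k ∈ Finset.range n, q k ∧
      P (⋃ k ∈ Finset.range n, (E k \ ⋃ j ∈ Finset.range k, E j) ∩ B k)
        = ∑ k ∈ Finset.range n, q k * P (B k) := by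
  have hmono : ∀ {j k}, j ≤ k → pastAlg Y j ≤ pastAlg Y k := fun hjk =>
    biSup_mono fun _ hi => lt_of_lt_of_le hi hjk
  set T : ℕ → Set Ω := fun k => E k \ ⋃ j ∈ Finset.range k, E j with hT
  have hTm : ∀ k, MeasurableSet[pastAlg Y k] (T k) := fun k =>
    MeasurableSet.diff (hE k) (Finset.measurableSet_biUnion _ fun j hj =>
      hmono (Finset.mem_range.1 hj).le _ (hE j))
  have hdisj : Pairwise (Function.onFun Disjoint T) := by
    intro i j hij
    rw [Function.onFun, Set.disjoint_left]
    rintro ω ⟨h1, h2⟩ ⟨h3, h4⟩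
    simp only [mem_iUnion, not_exists, Finset.mem_range] at h2 h4
    rcases lt_or_gt_of_ne hij with h' | h'
    · exact h4 i h' h1
    · exact h2 j h' h3
  refine ⟨fun k => P (T k), fun k => measure_mono sdiff_subset, ?_, ?_⟩
  · have : (⋃ k ∈ Finset.range n, E k) = ⋃ k ∈ Finset.range n, T k := by
      refine subset_antisymm (fun ω hω => ?_) (iUnion₂_mono fun k _ => sdiff_subset)
      simp only [mem_iUnion, Finset.mem_range, exists_prop] at hω ⊢
      classical
      have hex : ∃ k, ω ∈ E k := let ⟨k, _, hk⟩ := hω; ⟨k, hk⟩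
      obtain ⟨k, hk, hk'⟩ := hω
      refine ⟨Nat.find hex, (Nat.find_min' hex hk').trans_lt hk, Nat.find_spec hex, ?_⟩
      simp only [mem_iUnion, not_exists, Finset.mem_range]
      exact fun j hj => Nat.find_min hex hj
    rw [this, measure_biUnion_finset (hdisj.set_pairwise _)
      fun k _ => pastAlg_le hY k _ (hTm k)]
  · rw [measure_biUnion_finset]
    · refine Finset.sum_congr rfl fun k _ => ?_
      exact (Indep_iff _ _ _).1 (indep_past_future hY h k) _ _ (hTm k) (hB k)
    · exact fun i _ j _ hij => (hdisj hij).mono inter_subset_left inter_subset_left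
    · exact fun k _ => (pastAlg_le hY k _ (hTm k)).inter (futureAlg_le hY k _ (hB k))

/-- Ottaviani's inequality. At the first k where the walk is more than 2ε away from its value at a,
the independent remaining increment is at most ε with probability at least 1 − α ≥ 1/2, and then the
walk is still more than ε away at time n. Hence half the probability of the maximum is at most α. -/
lemma measure_max_walk_le [IsProbabilityMeasure P] (hY : ∀ i, Measurable (Y i))
    (h : iIndepFun Y P) {ε : ℝ} {α : ℝ≥0∞} {a n : ℕ} (hα : α ≤ 1 / 2)
    (hS : ∀ i j, a ≤ i → i ≤ j → j ≤ n → P {ω | ε < |walk Y j ω - walk Y i ω|} ≤ α) (han : a ≤ n) :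
    P {ω | ∃ j, a ≤ j ∧ j ≤ n ∧ 2 * ε < |walk Y j ω - walk Y a ω|} ≤ 2 * α := by
  let E : ℕ → Set Ω := fun k => {ω | a ≤ k ∧ 2 * ε < |walk Y k ω - walk Y a ω|}
  let B : ℕ → Set Ω := fun k => {ω | k ≤ n → |walk Y n ω - walk Y k ω| ≤ ε}
  have hE : ∀ k, MeasurableSet[pastAlg Y k] (E k) := fun k => by
    by_cases hk : a ≤ k
    · have : E k = {ω | 2 * ε < |walk Y k ω - walk Y a ω|} := by ext; simp [E, hk]
      rw [this]
      exact measurableSet_lt_abs ((measurable_walk_past (le_refl k)).sub (measurable_walk_past hk)) _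
    · have : E k = ∅ := by ext; simp [E, hk]
      rw [this]; exact @MeasurableSet.empty _ (pastAlg Y k)
  have hB : ∀ k, MeasurableSet[futureAlg Y k] (B k) := fun k => by
    by_cases hk : k ≤ n
    · have h1 := measurable_walk_future (Y := Y) (le_refl k) hk
      have : B k = {ω | |walk Y n ω - walk Y k ω| ≤ ε} := by ext; simp [B, hk]
      rw [this]
      simp_rw [← not_lt]
      exact (measurableSet_lt_abs h1 _).compl
    · have : B k = univ := by ext; simp [B, hk]
      rw [this]; exact MeasurableSet.univ
  obtain ⟨q, hqE, hq1, hq2⟩ := measure_first_time hY h hE hB (n + 1)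
  have hset : {ω | ∃ j, a ≤ j ∧ j ≤ n ∧ 2 * ε < |walk Y j ω - walk Y a ω|}
      = ⋃ k ∈ Finset.range (n + 1), E k := by
    ext ω
    simp only [mem_ofPred_eq, mem_iUnion, Finset.mem_range, Nat.lt_succ_iff, exists_prop, E]
    exact exists_congr fun j => by tauto
  rw [hset, hq1]
  have hq0 : ∀ k ∈ Finset.range (n + 1), q k ≤ 2 * (q k * P (B k)) := by
    intro k hk
    by_cases hak : a ≤ k
    · have hc : P (B k)ᶜ ≤ α := by
        refine (measure_mono ?_).trans (hS k n hak (Nat.lt_succ_iff.1 (Finset.mem_range.1 hk)) le_rfl)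
        intro ω hω
        simp only [B, mem_compl_iff, mem_ofPred_eq, not_forall, not_le] at hω
        exact hω.2
      have h1 : 1 ≤ 2 * P (B k) := by
        have h2 : 1 - P (B k)ᶜ = P (B k) := by
          have := prob_compl_eq_one_sub (μ := P) (futureAlg_le hY k _ (hB k)).compl
          rw [compl_compl] at this
          exact this.symm
        have h3 : (1 : ℝ≥0∞) / 2 ≤ P (B k) := by
          rw [← h2]
          calc (1 : ℝ≥0∞) / 2 = 1 - 1 / 2 := by
                rw [one_div, ENNReal.one_sub_inv_two]
            _ ≤ _ := tsub_le_tsub_left (hc.trans hα) _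
        calc (1 : ℝ≥0∞) = 2 * (1 / 2) := by
              rw [one_div, ENNReal.mul_inv_cancel two_ne_zero ENNReal.ofNat_ne_top]
          _ ≤ _ := by gcongr
      calc q k = q k * 1 := (mul_one _).symm
        _ ≤ q k * (2 * P (B k)) := by gcongr
        _ = _ := by ring
    · have h1 : E k = ∅ := by ext; simp [E, hak]
      have h2 := hqE k
      rw [h1, measure_empty] at h2
      exact h2.trans zero_le
  calc ∑ k ∈ Finset.range (n + 1), q k ≤ ∑ k ∈ Finset.range (n + 1), 2 * (q k * P (B k)) :=
        Finset.sum_le_sum hq0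
    _ = 2 * P (⋃ k ∈ Finset.range (n + 1), (E k \ ⋃ j ∈ Finset.range k, E j) ∩ B k) := by
        rw [hq2, Finset.mul_sum]
    _ ≤ 2 * α := by
        gcongr
        refine (measure_mono ?_).trans (hS a n le_rfl han le_rfl)
        intro ω hω
        simp only [mem_iUnion, Finset.mem_range, Nat.lt_succ_iff, exists_prop] at hω
        obtain ⟨k, hk, ⟨⟨-, h1⟩, -⟩, h2⟩ := hω
        have h3 := h2 hk
        simp only [mem_ofPred_eq]
        have : |walk Y k ω - walk Y a ω| ≤ |walk Y n ω - walk Y a ω| + |walk Y n ω - walk Y k ω| := by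
          rw [abs_sub_comm (walk Y n ω) (walk Y k ω)]
          calc _ = |(walk Y n ω - walk Y a ω) + (walk Y k ω - walk Y n ω)| := by ring_nf
            _ ≤ _ := abs_add_le _ _
        linarith

/-- The probability of many oscillations of a random walk decays geometrically. -/
lemma measure_osc_walk_le [IsProbabilityMeasure P] (hY : ∀ i, Measurable (Y i))
    (h : iIndepFun Y P) {ε : ℝ} {α : ℝ≥0∞} {n : ℕ} (hα : α ≤ 1 / 2) (p : ℕ) : ∀ a, a ≤ n →
    (∀ i j, a ≤ i → i ≤ j → j ≤ n → P {ω | ε < |walk Y j ω - walk Y i ω|} ≤ α) →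
    P {ω | Osc (fun j => walk Y j ω) (4 * ε) n p a} ≤ (2 * α) ^ p := by
  induction p with
  | zero => intro a _ _; simpa using prob_le_one
  | succ p ih =>
    intro a ha hS
    -- Strong Markov argument: stop when the first oscillation is completed; the remaining p
    -- oscillations then depend only on later steps.
    let E : ℕ → Set Ω := fun k => {ω | ∃ i, a ≤ i ∧ i ≤ k ∧ 4 * ε < |walk Y k ω - walk Y i ω|}
    let B : ℕ → Set Ω := fun k => {ω | a ≤ k ∧ k ≤ n ∧ Osc (fun j => walk Y j ω) (4 * ε) n p k}
    have hE : ∀ k, MeasurableSet[pastAlg Y k] (E k) := fun k => by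
      have : E k = ⋃ i, ⋃ (_ : a ≤ i), ⋃ (_ : i ≤ k), {ω | 4 * ε < |walk Y k ω - walk Y i ω|} := by
        ext ω; simp only [E, mem_ofPred_eq, mem_iUnion, exists_prop]
      rw [this]
      refine .iUnion fun i => .iUnion fun _ => .iUnion fun hi => ?_
      exact measurableSet_lt_abs ((measurable_walk_past (le_refl k)).sub (measurable_walk_past hi)) _
    have hB : ∀ k, MeasurableSet[futureAlg Y k] (B k) := fun k =>
      (MeasurableSet.const _).inter ((MeasurableSet.const _).inter
        (measurableSet_osc (fun i j h1 h2 => measurable_walk_future h1 h2) _ n p k le_rfl))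
    obtain ⟨q, -, hq1, hq2⟩ := measure_first_time hY h hE hB (n + 1)
    have hBb : ∀ k, P (B k) ≤ (2 * α) ^ p := fun k => by
      by_cases hk : a ≤ k ∧ k ≤ n
      · exact (measure_mono fun ω hω => hω.2.2).trans (ih k hk.2 fun i j h1 => hS i j (hk.1.trans h1))
      · have : B k = ∅ := by ext ω; simp only [B, mem_ofPred_eq, mem_empty_iff_false]; tauto
        rw [this]; simp
    -- If two values differ by more than 4ε, one of them is more than 2ε away from the value at a.
    have hEmax : P (⋃ k ∈ Finset.range (n + 1), E k) ≤ 2 * α := by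
      refine (measure_mono ?_).trans (measure_max_walk_le hY h hα hS ha)
      intro ω hω
      simp only [mem_iUnion, Finset.mem_range, Nat.lt_succ_iff, exists_prop] at hω
      obtain ⟨k, hk, i, hai, hik, h1⟩ := hω
      by_contra hcon
      simp only [mem_ofPred_eq, not_exists, not_and, not_lt] at hcon
      have h2 := hcon k (hai.trans hik) hk
      have h3 := hcon i hai (hik.trans hk)
      have : |walk Y k ω - walk Y i ω| ≤ |walk Y k ω - walk Y a ω| + |walk Y i ω - walk Y a ω| := by
        calc _ = |(walk Y k ω - walk Y a ω) - (walk Y i ω - walk Y a ω)| := by ring_nf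
          _ ≤ _ := abs_sub _ _
      linarith
    calc P {ω | Osc (fun j => walk Y j ω) (4 * ε) n (p + 1) a}
        ≤ P (⋃ k ∈ Finset.range (n + 1), (E k \ ⋃ j ∈ Finset.range k, E j) ∩ B k) := by
          refine measure_mono ?_
          rintro ω ⟨i, j, hai, hij, hjn, hδ, ho⟩
          classical
          have hex : ∃ k, ω ∈ E k := ⟨j, i, hai, hij, hδ⟩
          -- The first completed oscillation ends no later than the given one, so the later
          -- oscillations still start after it.
          have hle : Nat.find hex ≤ j := Nat.find_min' hex ⟨i, hai, hij, hδ⟩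
          obtain ⟨i', hai', hik', -⟩ := Nat.find_spec hex
          simp only [mem_iUnion, Finset.mem_range, Nat.lt_succ_iff, exists_prop]
          refine ⟨Nat.find hex, hle.trans hjn, ⟨Nat.find_spec hex, ?_⟩, hai'.trans hik',
            hle.trans hjn, ho.mono hle⟩
          simp only [mem_iUnion, not_exists]
          exact fun j hj => Nat.find_min hex (by simpa using hj)
      _ = ∑ k ∈ Finset.range (n + 1), q k * P (B k) := hq2
      _ ≤ ∑ k ∈ Finset.range (n + 1), q k * (2 * α) ^ p := by gcongr with k _; exact hBb k
      _ = P (⋃ k ∈ Finset.range (n + 1), E k) * (2 * α) ^ p := by rw [← Finset.sum_mul, hq1]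
      _ ≤ 2 * α * (2 * α) ^ p := by gcongr
      _ = (2 * α) ^ (p + 1) := by ring

end Walk

/-! ### Independence and laws of the increments of a walk -/

section WalkLaw

variable {Ω : Type*} [mΩ : MeasurableSpace Ω] {P : Measure Ω} {Y : ℕ → Ω → ℝ}

lemma measurable_walk (hY : ∀ i, Measurable (Y i)) (n : ℕ) : Measurable (walk Y n) :=
  Finset.measurable_fun_sum _ fun i _ => hY i

/-- Induction on the largest index: its increment depends on the steps from its left endpoint on,
all the others on the steps before. -/
lemma iIndepFun_walk_sub [IsProbabilityMeasure P] (hY : ∀ i, Measurable (Y i))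
    (h : iIndepFun Y P) {t : ℕ → ℕ} (ht : Monotone t) :
    iIndepFun (fun i ω => walk Y (t (i + 1)) ω - walk Y (t i) ω) P := by
  rw [iIndepFun_iff_measure_inter_preimage_eq_mul]
  intro S sets hsets
  induction S using Finset.induction_on_max with
  | empty => simp
  | insert a S hS ih =>
    have haS : a ∉ S := fun h' => lt_irrefl _ (hS a h')
    rw [Finset.set_biInter_insert, Finset.prod_insert haS, inter_comm, mul_comm]
    rw [← ih fun i hi => hsets i (Finset.mem_insert_of_mem hi)]
    refine (Indep_iff _ _ _).1 (indep_past_future hY h (t a)) _ _ ?_ ?_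
    · refine Finset.measurableSet_biInter _ fun i hi => ?_
      have h1 : Measurable[pastAlg Y (t a)] (fun ω => walk Y (t (i + 1)) ω - walk Y (t i) ω) :=
        Measurable.sub (measurable_walk_past (ht (hS i hi)))
          (measurable_walk_past (ht (hS i hi).le))
      exact h1 (hsets i (Finset.mem_insert_of_mem hi))
    · exact measurable_walk_future le_rfl (ht (Nat.le_succ a)) (hsets a (Finset.mem_insert_self _ _))

lemma map_walk_sub [IsProbabilityMeasure P] (hY : ∀ i, Measurable (Y i))
    (h : iIndepFun Y P) {μ : ℝ≥0 → Measure ℝ} {r : ℝ≥0} (hlaw : ∀ i, P.map (Y i) = μ r)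
    (h0 : μ 0 = Measure.dirac 0) (hμ : ∀ s t, μ (s + t) = (μ s).conv (μ t)) (i m : ℕ) :
    P.map (fun ω => walk Y (i + m) ω - walk Y i ω) = μ (m * r) := by
  induction m with
  | zero => simp [h0]
  | succ m ih =>
    have hind : IndepFun (fun ω => walk Y (i + m) ω - walk Y i ω) (Y (i + m)) P := by
      refine (IndepFun_iff_Indep _ _ _).2 ?_
      refine indep_of_indep_of_le_left (indep_of_indep_of_le_right
        (indep_past_future hY h (i + m)) ?_) ?_
      · exact le_iSup₂_of_le (i + m) (mem_Ici.2 le_rfl) le_rfl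
      · have h1 : Measurable[pastAlg Y (i + m)] (fun ω => walk Y (i + m) ω - walk Y i ω) :=
          Measurable.sub (measurable_walk_past le_rfl) (measurable_walk_past (Nat.le_add_right _ _))
        exact h1.comap_le
    have h2 : (fun ω => walk Y (i + (m + 1)) ω - walk Y i ω)
        = (fun ω => walk Y (i + m) ω - walk Y i ω) + Y (i + m) := by
      ext ω
      simp only [Pi.add_apply, ← add_assoc, walk, Finset.sum_range_succ]
      ring
    have h3 : Measurable (fun ω => walk Y (i + m) ω - walk Y i ω) :=
      (measurable_walk hY _).sub (measurable_walk hY _)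
    have h4 := hind.map_add_eq_map_conv_map₀ h3.aemeasurable (hY (i + m)).aemeasurable
    rw [h2, h4, ih, hlaw, ← hμ]
    congr 1
    push_cast
    ring

end WalkLaw

/-! ### Passing to the limit in laws and in independence -/

section Limits

variable {Ω : Type*} [mΩ : MeasurableSpace Ω] {P : Measure Ω} [IsProbabilityMeasure P]

lemma tendsto_charFun_of_ae {E : Type*} [NormedAddCommGroup E] [InnerProductSpace ℝ E]
    [MeasurableSpace E] [BorelSpace E] [SecondCountableTopology E] {Z : ℕ → Ω → E} {W : Ω → E}
    (hZ : ∀ k, Measurable (Z k)) (hW : Measurable W)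
    (hlim : ∀ᵐ ω ∂P, Tendsto (fun k => Z k ω) atTop (𝓝 (W ω))) (t : E) :
    Tendsto (fun k => charFun (P.map (Z k)) t) atTop (𝓝 (charFun (P.map W) t)) := by
  have hmap : ∀ V : Ω → E, Measurable V → charFun (P.map V) t
      = ∫ ω, Complex.exp (inner ℝ (V ω) t * Complex.I) ∂P := fun V hV => by
    rw [charFun_apply, integral_map hV.aemeasurable (by fun_prop)]
  rw [hmap W hW]
  simp_rw [fun k => hmap (Z k) (hZ k)]
  refine tendsto_integral_of_dominated_convergence (fun _ => 1) (fun k => ?_) (integrable_const _)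
    (fun k => .of_forall fun ω => ?_) ?_
  · exact (Continuous.measurable (f := fun x => Complex.exp (inner ℝ x t * Complex.I))
      (by fun_prop)).comp (hZ k) |>.aestronglyMeasurable
  · rw [Complex.norm_exp_ofReal_mul_I]
  · filter_upwards [hlim] with ω hω
    exact ((Continuous.tendsto (f := fun x => Complex.exp (inner ℝ x t * Complex.I))
      (by fun_prop) _)).comp hω

/-- Independence is preserved by almost sure limits. -/
lemma iIndepFun_of_tendsto_ae {ι : Type*} {Z : ℕ → ι → Ω → ℝ} {W : ι → Ω → ℝ}
    (hZ : ∀ k i, Measurable (Z k i)) (hW : ∀ i, Measurable (W i))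
    (hind : ∀ k, iIndepFun (Z k) P)
    (hlim : ∀ i, ∀ᵐ ω ∂P, Tendsto (fun k => Z k i ω) atTop (𝓝 (W i ω))) : iIndepFun W P := by
  rw [iIndepFun_iff_finset]
  intro s
  change iIndepFun (fun (i : s) => W i) P
  rw [iIndepFun_iff_charFun_pi (X := fun (i : s) => W i) (fun i => (hW i).aemeasurable)]
  intro t
  -- Independence of finitely many variables is the factorisation of the joint characteristic
  -- function, and both sides pass to the limit.
  have h1 : Tendsto (fun k => charFun (P.map (fun ω => WithLp.toLp 2 (fun i : s => Z k i ω))) t)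
      atTop (𝓝 (charFun (P.map (fun ω => WithLp.toLp 2 (fun i : s => W i ω))) t)) := by
    refine tendsto_charFun_of_ae (fun k => ?_) ?_ ?_ t
    · exact (PiLp.continuous_toLp 2 _).measurable.comp (measurable_pi_lambda _ fun i => hZ k i)
    · exact (PiLp.continuous_toLp 2 _).measurable.comp (measurable_pi_lambda _ fun i => hW i)
    · have : ∀ᵐ ω ∂P, ∀ i : s, Tendsto (fun k => Z k i ω) atTop (𝓝 (W i ω)) :=
        ae_all_iff.2 fun i => hlim i
      filter_upwards [this] with ω hω
      exact ((PiLp.continuous_toLp 2 _).tendsto _).comp (tendsto_pi_nhds.2 hω)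
  have h2 : Tendsto (fun k => ∏ i : s, charFun (P.map (Z k i)) (t i)) atTop
      (𝓝 (∏ i : s, charFun (P.map (W i)) (t i))) :=
    tendsto_finsetProd _ fun i _ => tendsto_charFun_of_ae (fun k => hZ k i) (hW i) (hlim i) (t i)
  refine tendsto_nhds_unique h1 (h2.congr fun k => ?_)
  exact ((iIndepFun_iff_charFun_pi (X := fun (i : s) => Z k i) (fun i => (hZ k i).aemeasurable)).1
    ((iIndepFun_iff_finset.1 (hind k)) s) t).symm

/-- Characteristic functions of a convolution semigroup are continuous in time. -/
lemma tendsto_charFun_semigroup {μ : ℝ≥0 → Measure ℝ} [∀ t, IsProbabilityMeasure (μ t)]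
    (hμ : ∀ s t, μ (s + t) = (μ s).conv (μ t))
    (hc : ∀ θ, Tendsto (fun s => charFun (μ s) θ) (𝓝 0) (𝓝 1)) {r : ℕ → ℝ≥0} {t : ℝ≥0}
    (hr : Tendsto r atTop (𝓝 t)) (θ : ℝ) :
    Tendsto (fun k => charFun (μ (r k)) θ) atTop (𝓝 (charFun (μ t) θ)) := by
  -- Factoring the law at b through the law at a reduces continuity at any time to continuity at 0.
  have key : ∀ a b : ℝ≥0, a ≤ b → ‖charFun (μ b) θ - charFun (μ a) θ‖
      ≤ ‖charFun (μ (b - a)) θ - 1‖ := fun a b hab => by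
    have : μ b = (μ a).conv (μ (b - a)) := by rw [← hμ, add_tsub_cancel_of_le hab]
    rw [this, charFun_conv]
    calc _ = ‖charFun (μ a) θ‖ * ‖charFun (μ (b - a)) θ - 1‖ := by rw [← norm_mul]; ring_nf
      _ ≤ 1 * ‖charFun (μ (b - a)) θ - 1‖ := by gcongr; exact norm_charFun_le_one θ
      _ = _ := one_mul _
  -- Subtraction is truncated, so this sum is |r k − t|; one of its two terms is always zero.
  have h1 : Tendsto (fun k => (r k - t) + (t - r k)) atTop (𝓝 0) := by
    have h2 : Tendsto (fun k => r k - t) atTop (𝓝 (t - t)) := hr.sub tendsto_const_nhds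
    have h3 : Tendsto (fun k => t - r k) atTop (𝓝 (t - t)) := tendsto_const_nhds.sub hr
    simpa using h2.add h3
  rw [tendsto_iff_norm_sub_tendsto_zero]
  have h4 : Tendsto (fun k => ‖charFun (μ ((r k - t) + (t - r k))) θ - 1‖) atTop (𝓝 0) := by
    have := ((hc θ).comp h1).sub_const 1 |>.norm
    simpa using this
  refine squeeze_zero (fun _ => norm_nonneg _) (fun k => ?_) h4
  rcases le_total (r k) t with h | h
  · rw [norm_sub_rev, tsub_eq_zero_of_le h, zero_add]
    exact key _ _ h
  · rw [tsub_eq_zero_of_le h, add_zero]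
    exact key _ _ h

end Limits

/-! ### Càdlàg regularisation along the dyadics -/

section Dyadic

/-- Nonnegative dyadic rationals. -/
def dyadics : Set ℝ≥0 := {t | ∃ k j : ℕ, t = j / 2 ^ k}

lemma exists_dyadic_btwn {a b : ℝ≥0} (hab : a < b) : ∃ q ∈ dyadics, a < q ∧ q < b := by
  obtain ⟨k, hk⟩ := exists_pow_lt_of_lt_one (tsub_pos_of_lt hab) (by norm_num : (1 / 2 : ℝ≥0) < 1)
  have h2 : (0 : ℝ≥0) < 2 ^ k := by positivity
  refine ⟨((⌊a * 2 ^ k⌋₊ + 1 : ℕ) : ℝ≥0) / 2 ^ k, ⟨k, _, rfl⟩, ?_, ?_⟩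
  · rw [lt_div_iff₀ h2]
    exact_mod_cast Nat.lt_floor_add_one (a * 2 ^ k)
  · have h1 : ((⌊a * 2 ^ k⌋₊ + 1 : ℕ) : ℝ≥0) / 2 ^ k ≤ a + (1 / 2) ^ k := by
      rw [div_le_iff₀ h2, add_mul, one_div, inv_pow, inv_mul_cancel₀ h2.ne']
      push_cast
      gcongr
      exact Nat.floor_le (zero_le)
    refine h1.trans_lt ?_
    calc a + (1 / 2) ^ k < a + (b - a) := by gcongr
      _ = b := add_tsub_cancel_of_le hab.le

/-- Along the dyadics, `g` has `p` successive oscillations larger than `δ` between `a` and `s`. -/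
def OscOn (g : ℝ≥0 → ℝ) (δ : ℝ) (s : ℝ≥0) : ℕ → ℝ≥0 → Prop
  | 0, _ => True
  | p + 1, a => ∃ x ∈ dyadics, ∃ y ∈ dyadics, a ≤ x ∧ x ≤ y ∧ y ≤ s ∧ δ < |g y - g x| ∧
      OscOn g δ s p y

lemma OscOn.mono {g : ℝ≥0 → ℝ} {δ : ℝ} {s a b : ℝ≥0} {p : ℕ} (h : OscOn g δ s p a) (hba : b ≤ a) :
    OscOn g δ s p b := by
  cases p with
  | zero => trivial
  | succ p => obtain ⟨x, hx, y, hy, h1, h2⟩ := h; exact ⟨x, hx, y, hy, hba.trans h1, h2⟩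

lemma exists_tendsto_of_small_osc {g : ℝ≥0 → ℝ} {l : Filter ℝ≥0} [l.NeBot]
    (h : ∀ ε > 0, ∃ S ∈ l, ∀ x ∈ S, ∀ y ∈ S, x ≤ y → |g y - g x| ≤ ε) :
    ∃ L, Tendsto g l (𝓝 L) := by
  refine cauchy_map_iff_exists_tendsto.1 (Metric.cauchy_iff.2 ⟨inferInstance, fun ε hε => ?_⟩)
  obtain ⟨S, hS, h1⟩ := h (ε / 2) (by positivity)
  refine ⟨g '' S, image_mem_map hS, ?_⟩
  rintro _ ⟨x, hx, rfl⟩ _ ⟨y, hy, rfl⟩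
  rcases le_total x y with hxy | hxy
  · have := h1 x hx y hy hxy
    rw [dist_comm, Real.dist_eq]; linarith
  · have := h1 y hy x hx hxy
    rw [Real.dist_eq]; linarith

lemma neBot_right (t : ℝ≥0) : (𝓝[Ioi t ∩ dyadics] t).NeBot := by
  rw [← mem_closure_iff_nhdsWithin_neBot, mem_closure_iff_nhds]
  intro U hU
  obtain ⟨s, hs, hsU⟩ := exists_Ico_subset_of_mem_nhds hU (exists_gt t)
  obtain ⟨q, hq, h1, h2⟩ := exists_dyadic_btwn hs
  exact ⟨q, hsU ⟨h1.le, h2⟩, h1, hq⟩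

lemma neBot_left {t : ℝ≥0} (ht : 0 < t) : (𝓝[Iio t ∩ dyadics] t).NeBot := by
  rw [← mem_closure_iff_nhdsWithin_neBot, mem_closure_iff_nhds]
  intro U hU
  obtain ⟨s, hs, hsU⟩ := exists_Ioc_subset_of_mem_nhds hU ⟨0, ht⟩
  obtain ⟨q, hq, h1, h2⟩ := exists_dyadic_btwn hs
  exact ⟨q, hsU ⟨h1, h2.le⟩, h2, hq⟩

/-- Without a right limit, every right neighbourhood of t contains an oscillation larger than some
fixed ε. Choosing each new one between t and all previous ones stacks arbitrarily many inside the
dyadic block containing t, against the hypothesis. -/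
lemma exists_right_limit {g : ℝ≥0 → ℝ}
    (hosc : ∀ δ > 0, ∃ r : ℕ, ∀ b : ℕ, ∃ p, ¬ OscOn g δ ((b + 1) / 2 ^ r) p (b / 2 ^ r)) (t : ℝ≥0) :
    ∃ L, Tendsto g (𝓝[Ioi t ∩ dyadics] t) (𝓝 L) := by
  have := neBot_right t
  refine exists_tendsto_of_small_osc fun ε hε => ?_
  obtain ⟨r, hr⟩ := hosc ε hε
  obtain ⟨p, hp⟩ := hr ⌊t * 2 ^ r⌋₊
  have h2 : (0 : ℝ≥0) < 2 ^ r := by positivity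
  have hb : (⌊t * 2 ^ r⌋₊ : ℝ≥0) / 2 ^ r ≤ t := by
    rw [div_le_iff₀ h2]; exact Nat.floor_le zero_le
  have hs : t < (⌊t * 2 ^ r⌋₊ + 1 : ℝ≥0) / 2 ^ r := by
    rw [lt_div_iff₀ h2]; exact Nat.lt_floor_add_one _
  set s := (⌊t * 2 ^ r⌋₊ + 1 : ℝ≥0) / 2 ^ r
  by_contra! hcon
  have key : ∀ p, ∃ a, t < a ∧ a < s ∧ OscOn g ε s p a := by
    intro p
    induction p with
    | zero => obtain ⟨a, h⟩ := exists_between hs; exact ⟨a, h.1, h.2, trivial⟩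
    | succ p ih =>
      obtain ⟨a, hta, has, ha⟩ := ih
      have hmem : Iio a ∩ (Ioi t ∩ dyadics) ∈ 𝓝[Ioi t ∩ dyadics] t :=
        inter_mem (mem_nhdsWithin_of_mem_nhds (Iio_mem_nhds hta)) self_mem_nhdsWithin
      obtain ⟨x, hx, y, hy, hxy, h⟩ := hcon _ hmem
      exact ⟨x, hx.2.1, hx.1.trans has, x, hx.2.2, y, hy.2.2, le_rfl, hxy, (hy.1.trans has).le, h,
        ha.mono hy.1.le⟩
  obtain ⟨a, hta, has, ha⟩ := key p
  exact hp (ha.mono (hb.trans hta.le))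

/-- Mirror image of the right limit: oscillations accumulating at t from the left are stacked in
increasing order of time. -/
lemma exists_left_limit {g : ℝ≥0 → ℝ}
    (hosc : ∀ δ > 0, ∃ r : ℕ, ∀ b : ℕ, ∃ p, ¬ OscOn g δ ((b + 1) / 2 ^ r) p (b / 2 ^ r))
    {t : ℝ≥0} (ht : 0 < t) : ∃ L, Tendsto g (𝓝[Iio t ∩ dyadics] t) (𝓝 L) := by
  have := neBot_left ht
  refine exists_tendsto_of_small_osc fun ε hε => ?_
  obtain ⟨r, hr⟩ := hosc ε hε
  -- Ceiling minus one selects the block that is open on the left and closed on the right, so that a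
  -- dyadic t belongs to the block ending at t.
  obtain ⟨p, hp⟩ := hr (⌈t * 2 ^ r⌉₊ - 1)
  have h2 : (0 : ℝ≥0) < 2 ^ r := by positivity
  have hc : 1 ≤ ⌈t * 2 ^ r⌉₊ := Nat.one_le_ceil_iff.2 (mul_pos ht h2)
  have hb : ((⌈t * 2 ^ r⌉₊ - 1 : ℕ) : ℝ≥0) / 2 ^ r < t := by
    rw [div_lt_iff₀ h2]; exact Nat.lt_ceil.1 (Nat.sub_lt hc one_pos)
  have hs : t ≤ (((⌈t * 2 ^ r⌉₊ - 1 : ℕ) : ℝ≥0) + 1) / 2 ^ r := by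
    have : (((⌈t * 2 ^ r⌉₊ - 1 : ℕ) : ℝ≥0) + 1) = (⌈t * 2 ^ r⌉₊ : ℝ≥0) := by
      exact_mod_cast Nat.sub_add_cancel hc
    rw [this, le_div_iff₀ h2]; exact Nat.le_ceil _
  set s := (((⌈t * 2 ^ r⌉₊ - 1 : ℕ) : ℝ≥0) + 1) / 2 ^ r
  by_contra! hcon
  have key : ∀ p, ∀ a, a < t → OscOn g ε s p a := by
    intro p
    induction p with
    | zero => exact fun _ _ => trivial
    | succ p ih =>
      intro a ha
      have hmem : Ioi a ∩ (Iio t ∩ dyadics) ∈ 𝓝[Iio t ∩ dyadics] t :=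
        inter_mem (mem_nhdsWithin_of_mem_nhds (Ioi_mem_nhds ha)) self_mem_nhdsWithin
      obtain ⟨x, hx, y, hy, hxy, h⟩ := hcon _ hmem
      exact ⟨x, hx.2.2, y, hy.2.2, hx.1.le, hxy, (hy.2.1.trans_le hs).le, h, ih y hy.2.1⟩
  exact hp (key p _ hb)

lemma right_limit_bound {g : ℝ≥0 → ℝ} {t : ℝ≥0} {L : ℝ}
    (h : Tendsto g (𝓝[Ioi t ∩ dyadics] t) (𝓝 L)) {ε : ℝ} (hε : 0 < ε) :
    ∃ s, t < s ∧ ∀ q ∈ dyadics, t < q → q < s → |g q - L| < ε := by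
  have h1 := eventually_nhdsWithin_iff.1 (Metric.tendsto_nhds.1 h ε hε)
  obtain ⟨s, hs, hsU⟩ := exists_Ico_subset_of_mem_nhds h1 (exists_gt t)
  exact ⟨s, hs, fun q hq h2 h3 => hsU ⟨h2.le, h3⟩ ⟨h2, hq⟩⟩

lemma left_limit_bound {g : ℝ≥0 → ℝ} {t : ℝ≥0} (ht : 0 < t) {L : ℝ}
    (h : Tendsto g (𝓝[Iio t ∩ dyadics] t) (𝓝 L)) {ε : ℝ} (hε : 0 < ε) :
    ∃ s, s < t ∧ ∀ q ∈ dyadics, s < q → q < t → |g q - L| < ε := by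
  have h1 := eventually_nhdsWithin_iff.1 (Metric.tendsto_nhds.1 h ε hε)
  obtain ⟨s, hs, hsU⟩ := exists_Ioc_subset_of_mem_nhds h1 ⟨0, ht⟩
  exact ⟨s, hs, fun q hq h2 h3 => hsU ⟨h2, h3.le⟩ ⟨h3, hq⟩⟩

/-- The right limit inherits bounds valid on an interval of dyadics. -/
lemma right_limit_le {g : ℝ≥0 → ℝ} {u s : ℝ≥0} (hus : u < s) {L M ε : ℝ}
    (h : Tendsto g (𝓝[Ioi u ∩ dyadics] u) (𝓝 L))
    (hb : ∀ q ∈ dyadics, u < q → q < s → |g q - M| < ε) : |L - M| ≤ ε := by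
  have := neBot_right u
  refine le_of_tendsto ((h.sub_const M).abs) ?_
  have hmem : Iio s ∩ (Ioi u ∩ dyadics) ∈ 𝓝[Ioi u ∩ dyadics] u :=
    inter_mem (mem_nhdsWithin_of_mem_nhds (Iio_mem_nhds hus)) self_mem_nhdsWithin
  filter_upwards [hmem] with q hq
  exact (hb q hq.2.2 hq.2.1 hq.1).le

/-- Regularization of a function on the dyadics. -/
theorem exists_cadlag_extension {g : ℝ≥0 → ℝ}
    (hosc : ∀ δ > 0, ∃ r : ℕ, ∀ b : ℕ, ∃ p, ¬ OscOn g δ ((b + 1) / 2 ^ r) p (b / 2 ^ r))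
    (hjump : ∀ ε > 0, ∀ N : ℕ, ∃ᶠ k : ℕ in atTop, ∀ j < N * 2 ^ k,
      g (((j + 1 : ℕ) : ℝ≥0) / 2 ^ k) - g ((j : ℝ≥0) / 2 ^ k) ≤ ε) :
    ∃ x : ℝ≥0 → ℝ, IsCadlagNoPosJumps x ∧
      ∀ t, Tendsto g (𝓝[Ioi t ∩ dyadics] t) (𝓝 (x t)) := by
  choose x hx using exists_right_limit hosc
  refine ⟨x, fun t => ⟨?_, ?_⟩, hx⟩
  · rw [Metric.continuousWithinAt_iff']
    intro ε hε
    obtain ⟨s, hs, hb⟩ := right_limit_bound (hx t) (half_pos hε)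
    filter_upwards [mem_nhdsWithin_of_mem_nhds (Iio_mem_nhds hs), self_mem_nhdsWithin] with u hu htu
    have := right_limit_le hu (hx u) (M := x t) (ε := ε / 2)
      (fun q hq h1 h2 => hb q hq (lt_of_le_of_lt htu h1) h2)
    rw [Real.dist_eq]; linarith
  · rcases (zero_le (a := t)).eq_or_lt with rfl | ht
    -- At time 0 the left neighbourhood filter is trivial, so any value serves as left limit.
    · refine ⟨x 0, ?_, le_rfl⟩
      have : Iio (0 : ℝ≥0) = ∅ := by ext; simp
      rw [this, nhdsWithin_empty]
      exact tendsto_bot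
    obtain ⟨l, hl⟩ := exists_left_limit hosc ht
    refine ⟨l, ?_, ?_⟩
    · rw [Metric.tendsto_nhds]
      intro ε hε
      obtain ⟨s, hs, hb⟩ := left_limit_bound ht hl (half_pos hε)
      filter_upwards [mem_nhdsWithin_of_mem_nhds (Ioi_mem_nhds hs), self_mem_nhdsWithin] with u hu hut
      have := right_limit_le hut (hx u) (M := l) (ε := ε / 2)
        (fun q hq h1 h2 => hb q hq (lt_trans hu h1) h2)
      rw [Real.dist_eq]; linarith
    · refine le_of_forall_pos_le_add fun ε hε => ?_
      obtain ⟨s, hs, hb⟩ := left_limit_bound ht hl (show 0 < ε / 4 by positivity)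
      obtain ⟨s', hs', hb'⟩ := right_limit_bound (hx t) (show 0 < ε / 4 by positivity)
      obtain ⟨N, hN⟩ := exists_nat_gt s'
      have hsmall : ∀ᶠ k : ℕ in atTop, (1 / 2 : ℝ≥0) ^ k < t - s ∧ 2 * (1 / 2 : ℝ≥0) ^ k < s' - t := by
        have h0 : Tendsto (fun k : ℕ => (1 / 2 : ℝ≥0) ^ k) atTop (𝓝 0) :=
          NNReal.tendsto_pow_atTop_nhds_zero_of_lt_one (by norm_num)
        refine (h0.eventually_lt_const (tsub_pos_of_lt hs)).and ?_
        have := h0.const_mul 2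
        rw [mul_zero] at this
        exact this.eventually_lt_const (tsub_pos_of_lt hs')
      obtain ⟨k, hk, hk1, hk2⟩ := ((hjump (ε / 4) (by positivity) N).and_eventually hsmall).exists
      have h2 : (0 : ℝ≥0) < 2 ^ k := by positivity
      have hpk : (1 / 2 : ℝ≥0) ^ k = 1 / 2 ^ k := by rw [one_div, one_div, inv_pow]
      -- Here j/2^k < t ≤ (j+1)/2^k. Since t may equal (j+1)/2^k, where `g` need not be near either
      -- limit, two mesh steps are used: each rises by at most ε/4, and comparing the outer points
      -- with the left and right limits costs ε/4 each.
      obtain ⟨j, hj⟩ : ∃ j, ⌈t * 2 ^ k⌉₊ = j + 1 :=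
        Nat.exists_eq_add_of_lt (Nat.one_le_ceil_iff.2 (mul_pos ht h2)) |>.imp fun j h => by omega
      have hjt : (j : ℝ≥0) < t * 2 ^ k := Nat.lt_ceil.1 (by omega)
      have htj : t * 2 ^ k ≤ ((j + 1 : ℕ) : ℝ≥0) := by rw [← hj]; exact Nat.le_ceil _
      have e1 : (j : ℝ≥0) / 2 ^ k < t := by rwa [div_lt_iff₀ h2]
      have e2 : t < ((j + 1 + 1 : ℕ) : ℝ≥0) / 2 ^ k := by
        rw [lt_div_iff₀ h2]
        exact htj.trans_lt (by exact_mod_cast Nat.lt_succ_self _)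
      have e3 : s < (j : ℝ≥0) / 2 ^ k := by
        have h3 : s + 1 / 2 ^ k < t := by
          rw [← hpk, add_comm]; exact lt_tsub_iff_right.1 hk1
        have h4 : t ≤ (j : ℝ≥0) / 2 ^ k + 1 / 2 ^ k := by
          rw [← add_div, le_div_iff₀ h2]; exact_mod_cast htj
        exact lt_of_add_lt_add_right (h3.trans_le h4)
      have e4 : ((j + 1 + 1 : ℕ) : ℝ≥0) / 2 ^ k < s' := by
        have h3 : 2 * (1 / 2 ^ k) + t < s' := by rw [← hpk]; exact lt_tsub_iff_right.1 hk2
        calc ((j + 1 + 1 : ℕ) : ℝ≥0) / 2 ^ k = 2 * (1 / 2 ^ k) + (j : ℝ≥0) / 2 ^ k := by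
              push_cast; ring
          _ < 2 * (1 / 2 ^ k) + t := by gcongr
          _ < s' := h3
      have hjN : j + 1 < N * 2 ^ k := by
        have : ((j + 1 : ℕ) : ℝ≥0) < N * 2 ^ k := by
          have h5 := (e4.trans hN)
          rw [div_lt_iff₀ h2] at h5
          refine lt_of_le_of_lt ?_ h5
          exact_mod_cast Nat.le_succ _
        exact_mod_cast this
      have f1 := hk j (by omega)
      have f2 := hk (j + 1) hjN
      have f3 := abs_lt.1 (hb _ ⟨k, j, rfl⟩ e3 e1)
      have f4 := abs_lt.1 (hb' _ ⟨k, j + 1 + 1, rfl⟩ e2 e4)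
      linarith [f3.1, f3.2, f4.1, f4.2]

end Dyadic

/-! ### Construction of the process from a convolution semigroup -/

section Existence

/-- A chain of oscillations involves finitely many dyadic points, and all of them are grid points
from some level on. -/
lemma Osc_of_oscOn {d : ℕ → ℕ → ℝ} {g : ℝ≥0 → ℝ} (hg : ∀ k j : ℕ, g (j / 2 ^ k) = d k j)
    {δ : ℝ} {s : ℝ≥0} (p : ℕ) : ∀ a, OscOn g δ s p a →
    ∃ K, ∀ k ≥ K, Osc (d k) δ ⌊s * 2 ^ k⌋₊ p ⌈a * 2 ^ k⌉₊ := by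
  have hlev : ∀ m j k : ℕ, m ≤ k → ((j : ℝ≥0) / 2 ^ m) * 2 ^ k = ((j * 2 ^ (k - m) : ℕ) : ℝ≥0) := by
    intro m j k hmk
    obtain ⟨i, rfl⟩ := Nat.exists_eq_add_of_le hmk
    have : (2 : ℝ≥0) ^ m ≠ 0 := by positivity
    rw [Nat.add_sub_cancel_left, pow_add, ← mul_assoc, div_mul_cancel₀ _ this]
    push_cast
    rfl
  have hgl : ∀ m j k : ℕ, m ≤ k → g ((j : ℝ≥0) / 2 ^ m) = d k (j * 2 ^ (k - m)) := by
    intro m j k hmk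
    rw [← hg k, ← hlev m j k hmk, mul_div_assoc, div_self (by positivity), mul_one]
  induction p with
  | zero => exact fun _ _ => ⟨0, fun _ _ => trivial⟩
  | succ p ih =>
    rintro a ⟨x, ⟨m, jx, rfl⟩, y, ⟨n, jy, rfl⟩, hax, hxy, hys, hδ, ho⟩
    obtain ⟨K, hK⟩ := ih _ ho
    refine ⟨max K (max m n), fun k hk => ?_⟩
    have hm : m ≤ k := by omega
    have hn : n ≤ k := by omega
    have h2 : (0 : ℝ≥0) < 2 ^ k := by positivity
    refine ⟨jx * 2 ^ (k - m), jy * 2 ^ (k - n), ?_, ?_, ?_, ?_, ?_⟩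
    · rw [Nat.ceil_le, ← hlev m jx k hm]; gcongr
    · have : ((jx * 2 ^ (k - m) : ℕ) : ℝ≥0) ≤ ((jy * 2 ^ (k - n) : ℕ) : ℝ≥0) := by
        rw [← hlev m jx k hm, ← hlev n jy k hn]; gcongr
      exact_mod_cast this
    · refine Nat.le_floor ?_
      rw [← hlev n jy k hn]; gcongr
    · rwa [← hgl m jx k hm, ← hgl n jy k hn]
    · have := hK k (by omega)
      rwa [hlev n jy k hn, Nat.ceil_natCast] at this

lemma OscOn.anti {g : ℝ≥0 → ℝ} {δ δ' : ℝ} (hδ : δ' ≤ δ) {s : ℝ≥0} (p : ℕ) : ∀ {a},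
    OscOn g δ s p a → OscOn g δ' s p a := by
  induction p with
  | zero => exact fun _ => trivial
  | succ p ih =>
    rintro a ⟨x, hx, y, hy, h1, h2, h3, h4, h5⟩
    exact ⟨x, hx, y, hy, h1, h2, h3, hδ.trans_lt h4, ih h5⟩

lemma measure_eventually_le {Ω : Type*} [MeasurableSpace Ω] {P : Measure Ω} {A : ℕ → Set Ω}
    {c : ℕ → ℝ≥0∞} {C : ℝ≥0∞} (h : ∀ᶠ k in atTop, P (A k) ≤ c k) (hc : Tendsto c atTop (𝓝 C)) :
    P {ω | ∀ᶠ k in atTop, ω ∈ A k} ≤ C := by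
  have : {ω | ∀ᶠ k in atTop, ω ∈ A k} = ⋃ K, ⋂ k ≥ K, A k := by
    ext ω; simp [eventually_atTop]
  rw [this, Monotone.measure_iUnion]
  · refine iSup_le fun K => ge_of_tendsto hc ?_
    filter_upwards [h, eventually_ge_atTop K] with k hk hKk
    exact (measure_mono (biInter_subset_of_mem hKk)).trans hk
  · intro a b hab
    exact biInter_mono (fun k (hk : b ≤ k) => hab.trans hk) fun _ _ => le_rfl

lemma tendsto_charFun_one {μ : ℝ≥0 → Measure ℝ} [∀ t, IsProbabilityMeasure (μ t)]
    (hc : ∀ ε > 0, Tendsto (fun t => μ t {x | ε < |x|}) (𝓝 0) (𝓝 0)) (θ : ℝ) :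
    Tendsto (fun s => charFun (μ s) θ) (𝓝 0) (𝓝 1) := by
  rw [Metric.tendsto_nhds]
  intro η hη
  set ε := η / (4 * (|θ| + 1)) with hε
  have hε0 : 0 < ε := by positivity
  have h1 : ∀ᶠ t in 𝓝 (0 : ℝ≥0), μ t {x | ε < |x|} < ENNReal.ofReal (η / 8) :=
    (hc ε hε0).eventually_lt_const (by simpa using (by positivity : 0 < η / 8))
  filter_upwards [h1] with t ht
  have hm : MeasurableSet {x : ℝ | ε < |x|} := measurableSet_lt measurable_const (by fun_prop)
  have h2 : ∀ x : ℝ, ‖Complex.exp (inner ℝ x θ * Complex.I) - 1‖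
      ≤ ε * |θ| + {x : ℝ | ε < |x|}.indicator (fun _ => 2) x := by
    intro x
    by_cases hx : ε < |x|
    · rw [indicator_of_mem (show x ∈ {x : ℝ | ε < |x|} from hx)]
      have : ‖Complex.exp (inner ℝ x θ * Complex.I) - 1‖ ≤ 2 := by
        refine (norm_sub_le _ _).trans ?_
        rw [Complex.norm_exp_ofReal_mul_I, norm_one]; norm_num
      have := mul_nonneg hε0.le (abs_nonneg θ)
      linarith
    · rw [indicator_of_notMem (show x ∉ {x : ℝ | ε < |x|} from hx), add_zero]
      have h3 := Real.norm_exp_I_mul_ofReal_sub_one_le (x := inner ℝ x θ)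
      rw [mul_comm Complex.I] at h3
      refine h3.trans ?_
      rw [real_inner_comm]
      simp only [RCLike.inner_apply, conj_trivial, Real.norm_eq_abs, abs_mul]
      gcongr
      exact not_lt.1 hx
  have hi : Integrable (fun x : ℝ => Complex.exp (inner ℝ x θ * Complex.I)) (μ t) :=
    Integrable.of_bound (by fun_prop) 1 (.of_forall fun x => by rw [Complex.norm_exp_ofReal_mul_I])
  have h3 : charFun (μ t) θ - 1 = ∫ x, (Complex.exp (inner ℝ x θ * Complex.I) - 1) ∂μ t := by
    rw [integral_sub hi (integrable_const _), charFun_apply]; simp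
  rw [dist_eq_norm, h3]
  have h4 : (μ t).real {x | ε < |x|} < η / 8 := by
    rw [Measure.real, ← ENNReal.lt_ofReal_iff_toReal_lt (measure_ne_top _ _)]; exact ht
  calc ‖∫ x, (Complex.exp (inner ℝ x θ * Complex.I) - 1) ∂μ t‖
      ≤ ∫ x, ‖Complex.exp (inner ℝ x θ * Complex.I) - 1‖ ∂μ t := norm_integral_le_integral_norm _
    _ ≤ ∫ x, (ε * |θ| + {x : ℝ | ε < |x|}.indicator (fun _ => 2) x) ∂μ t := by
        refine integral_mono (hi.sub (integrable_const _)).norm ?_ h2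
        exact (integrable_const _).add ((integrable_const _).indicator hm)
    _ = ε * |θ| + 2 * (μ t).real {x | ε < |x|} := by
        rw [integral_add (integrable_const _) ((integrable_const _).indicator hm),
          integral_indicator hm]
        simp [mul_comm]
    _ < η := by
        have h5 : ε * |θ| ≤ η / 4 := by
          rw [hε, div_mul_eq_mul_div, div_le_div_iff₀ (by positivity) (by positivity)]
          nlinarith [abs_nonneg θ]
        linarith

/-- Adding up consecutive pairs of a sequence. -/
def pairSum (x : ℕ → ℝ) (j : ℕ) : ℝ := x (2 * j) + x (2 * j + 1)

lemma measurable_pairSum : Measurable pairSum := by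
  unfold pairSum; fun_prop

/-- This is the consistency condition of the dyadic skeletons: consecutive pairs of i.i.d.
increments over time r add up to i.i.d. increments over time 2r. -/
lemma map_pairSum_infinitePi {μ : ℝ≥0 → Measure ℝ} [∀ t, IsProbabilityMeasure (μ t)]
    (h0 : μ 0 = Measure.dirac 0) (hμ : ∀ s t, μ (s + t) = (μ s).conv (μ t)) (r : ℝ≥0) :
    (Measure.infinitePi (fun _ : ℕ => μ r)).map pairSum = Measure.infinitePi (fun _ => μ (2 * r)) := by
  set Q := Measure.infinitePi (fun _ : ℕ => μ r)
  let Y : ℕ → (ℕ → ℝ) → ℝ := fun i ω => ω i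
  have hY : ∀ i, Measurable (Y i) := fun i => by fun_prop
  have hind : iIndepFun Y Q := iIndepFun_infinitePi (X := fun _ x => x) (fun _ => measurable_id)
  have hlaw : ∀ i, Q.map (Y i) = μ r := fun i => Measure.infinitePi_map_eval _ i
  have hpair : ∀ i, (fun x : ℕ → ℝ => pairSum x i)
      = fun ω => walk Y (2 * (i + 1)) ω - walk Y (2 * i) ω := fun i => by
    ext ω
    simp only [walk, mul_add, mul_one, Finset.sum_range_succ, pairSum, Y]
    ring
  have h1 := iIndepFun_walk_sub hY hind (t := fun i => 2 * i) (fun a b h => by simpa using h)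
  have h2 := h1.map_fun_eq_infinitePi_map (fun i => (measurable_walk hY _).sub (measurable_walk hY _))
  have h3 : ∀ i, Q.map (fun ω => walk Y (2 * (i + 1)) ω - walk Y (2 * i) ω) = μ (2 * r) := fun i => by
    have := map_walk_sub hY hind hlaw h0 hμ (2 * i) 2
    exact_mod_cast this
  have h2 : Q.map (fun ω i => walk Y (2 * (i + 1)) ω - walk Y (2 * i) ω)
      = Measure.infinitePi (fun i => Q.map (fun ω => walk Y (2 * (i + 1)) ω - walk Y (2 * i) ω)) := h2
  simp_rw [h3] at h2
  rw [← h2]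
  congr 1
  ext x i
  exact congrFun (hpair i) x

lemma exists_dyadic_function {d : ℕ → ℕ → ℝ} (hd : ∀ k j, d (k + 1) (2 * j) = d k j) :
    ∃ g : ℝ≥0 → ℝ, ∀ k j : ℕ, g (j / 2 ^ k) = d k j := by
  classical
  have hd' : ∀ m k j, d (k + m) (j * 2 ^ m) = d k j := by
    intro m
    induction m with
    | zero => simp
    | succ m ih =>
      intro k j
      rw [← ih k j, ← hd (k + m) (j * 2 ^ m), pow_succ]
      congr 1
      ring
  refine ⟨fun q => if h : ∃ k j : ℕ, q = j / 2 ^ k then d h.choose h.choose_spec.choose else 0,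
    fun k j => ?_⟩
  have h : ∃ k' j' : ℕ, (j : ℝ≥0) / 2 ^ k = j' / 2 ^ k' := ⟨k, j, rfl⟩
  simp only [dif_pos h]
  have h1 := h.choose_spec.choose_spec
  set k' := h.choose
  set j' := h.choose_spec.choose
  rw [div_eq_div_iff (by positivity) (by positivity)] at h1
  have h2 : j * 2 ^ k' = j' * 2 ^ k :=
    Nat.cast_injective (R := ℝ≥0) (by push_cast; exact h1)
  rw [← hd' k k' j', ← hd' k' k j, h2, add_comm]

lemma tendsto_floor_div (t : ℝ≥0) :
    Tendsto (fun k : ℕ => (⌊t * 2 ^ k⌋₊ : ℝ≥0) / 2 ^ k) atTop (𝓝 t) := by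
  have h1 : Tendsto (fun k : ℕ => t - (1 / 2 : ℝ≥0) ^ k) atTop (𝓝 (t - 0)) :=
    tendsto_const_nhds.sub (NNReal.tendsto_pow_atTop_nhds_zero_of_lt_one (by norm_num))
  rw [tsub_zero] at h1
  refine tendsto_of_tendsto_of_tendsto_of_le_of_le h1 tendsto_const_nhds (fun k => ?_) fun k => ?_
  · have h2 : (0 : ℝ≥0) < 2 ^ k := by positivity
    rw [tsub_le_iff_right, div_pow, one_pow, ← add_div, le_div_iff₀ h2]
    exact (Nat.lt_floor_add_one _).le
  · have h2 : (0 : ℝ≥0) < 2 ^ k := by positivity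
    change _ / _ ≤ _
    rw [div_le_iff₀ h2]
    exact Nat.floor_le (by positivity)

lemma tendsto_two_pow_inv : Tendsto (fun k : ℕ => (1 : ℝ≥0) / 2 ^ k) atTop (𝓝 0) := by
  have := NNReal.tendsto_pow_atTop_nhds_zero_of_lt_one (r := (1 / 2 : ℝ≥0)) (by norm_num)
  simpa using this

/-- Dyadic skeletons with controlled oscillations and upward jumps extend to càdlàg paths. -/
lemma exists_cadlag_of_skeleton {d : ℕ → ℕ → ℝ} (hd : ∀ k j, d (k + 1) (2 * j) = d k j)
    (hosc : ∀ n : ℕ, ∃ r : ℕ, ∀ b : ℕ, ∃ p, ¬ ∀ᶠ k in atTop,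
      Osc (d k) (1 / (n + 1)) ⌊((b : ℝ≥0) + 1) / 2 ^ r * 2 ^ k⌋₊ p ⌈(b : ℝ≥0) / 2 ^ r * 2 ^ k⌉₊)
    (hjump : ∀ n N : ℕ, ∃ᶠ k : ℕ in atTop, ∀ j < N * 2 ^ k, d k (j + 1) - d k j ≤ 1 / (n + 1)) :
    ∃ x : ℝ≥0 → ℝ, IsCadlagNoPosJumps x ∧
      ∀ t : ℝ≥0, Tendsto (fun k => d k (⌊t * 2 ^ k⌋₊ + 1)) atTop (𝓝 (x t)) := by
  obtain ⟨g, hg⟩ := exists_dyadic_function hd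
  obtain ⟨x, hx, hlim⟩ := exists_cadlag_extension (g := g) (fun δ hδ => by
      obtain ⟨n, hn⟩ := exists_nat_one_div_lt hδ
      obtain ⟨r, hr⟩ := hosc n
      refine ⟨r, fun b => ?_⟩
      obtain ⟨p, hp⟩ := hr b
      refine ⟨p, fun ho => hp ?_⟩
      obtain ⟨K, hK⟩ := Osc_of_oscOn hg p _ (ho.anti hn.le)
      exact eventually_atTop.2 ⟨K, hK⟩) (fun ε hε N => by
      obtain ⟨n, hn⟩ := exists_nat_one_div_lt hε
      refine (hjump n N).mono fun k hk j hj => ?_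
      rw [hg, hg]
      exact (hk j hj).trans hn.le)
  refine ⟨x, hx, fun t => ?_⟩
  -- The added 1 places the sampling points strictly to the right of t, so that they see the right
  -- limit.
  have h1 : Tendsto (fun k : ℕ => ((⌊t * 2 ^ k⌋₊ + 1 : ℕ) : ℝ≥0) / 2 ^ k) atTop
      (𝓝[Ioi t ∩ dyadics] t) := by
    refine tendsto_nhdsWithin_iff.2 ⟨?_, .of_forall fun k => ⟨?_, k, _, rfl⟩⟩
    · have := (tendsto_floor_div t).add tendsto_two_pow_inv
      rw [add_zero] at this
      refine this.congr fun k => ?_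
      push_cast
      rw [add_div]
    · have h2 : (0 : ℝ≥0) < 2 ^ k := by positivity
      rw [mem_Ioi, lt_div_iff₀ h2]
      exact_mod_cast Nat.lt_floor_add_one (t * 2 ^ k)
  refine ((hlim t).comp h1).congr fun k => ?_
  exact hg k _

/-- The increments of the dyadic skeletons of a convolution semigroup. -/
theorem exists_skeleton {μ : ℝ≥0 → Measure ℝ} [∀ t, IsProbabilityMeasure (μ t)]
    (h0 : μ 0 = Measure.dirac 0) (hμ : ∀ s t, μ (s + t) = (μ s).conv (μ t)) :
    ∃ (P : Measure (ℕ → ℕ → ℝ)) (_ : IsProbabilityMeasure P),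
      (∀ k, iIndepFun (fun i (ω : ℕ → ℕ → ℝ) => ω k i) P) ∧
      (∀ k i, P.map (fun ω => ω k i) = μ (1 / 2 ^ k)) ∧
      ∀ᵐ ω ∂P, ∀ k j, walk (fun i (ω : ℕ → ℕ → ℝ) => ω (k + 1) i) (2 * j) ω
        = walk (fun i (ω : ℕ → ℕ → ℝ) => ω k i) j ω := by
  obtain ⟨P, hP, hlaw, hcons⟩ := exists_projective_limit pairSum measurable_pairSum
    (fun k => Measure.infinitePi (fun _ : ℕ => μ (1 / 2 ^ k))) (fun k => by
      rw [map_pairSum_infinitePi h0 hμ]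
      congr 1
      ext i : 1
      congr 1
      rw [pow_succ]
      field_simp)
  have hl : ∀ k i, P.map (fun ω => ω k i) = μ (1 / 2 ^ k) := fun k i => by
    have h1 : (fun ω : ℕ → ℕ → ℝ => ω k i) = (fun x : ℕ → ℝ => x i) ∘ fun ω => ω k := rfl
    rw [h1, ← Measure.map_map (by fun_prop) (by fun_prop), hlaw k]
    exact Measure.infinitePi_map_eval _ i
  refine ⟨P, hP, fun k => ?_, hl, ?_⟩
  · rw [iIndepFun_iff_map_fun_eq_infinitePi_map (fun i => by fun_prop)]
    simp_rw [hl k]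
    exact hlaw k
  · filter_upwards [hcons] with ω hω k j
    induction j with
    | zero => simp [walk]
    | succ j ih =>
      have h1 := congrFun (hω k) j
      simp only [walk, mul_add, mul_one, Finset.sum_range_succ, pairSum] at *
      linarith

lemma ae_exists_not_of_measure_le {Ω : Type*} [MeasurableSpace Ω] {P : Measure Ω}
    {A : ℕ → Set Ω} {c : ℝ≥0∞} (hc : c < 1) (h : ∀ p, P (A p) ≤ c ^ p) :
    ∀ᵐ ω ∂P, ∃ p, ω ∉ A p := by
  rw [ae_iff]
  have h1 : {ω | ¬ ∃ p, ω ∉ A p} = ⋂ p, A p := by ext ω; simp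
  rw [h1]
  refine le_antisymm (ge_of_tendsto (ENNReal.tendsto_pow_atTop_nhds_zero_of_lt_one hc) ?_) bot_le
  exact .of_forall fun p => (measure_mono (iInter_subset _ p)).trans (h p)

/-- A convolution semigroup that is continuous in probability and asymptotically has no upward
jumps is the family of laws of a Lévy process with no positive jumps. -/
theorem exists_levy {μ : ℝ≥0 → Measure ℝ} [∀ t, IsProbabilityMeasure (μ t)]
    (h0 : μ 0 = Measure.dirac 0) (hμ : ∀ s t, μ (s + t) = (μ s).conv (μ t))
    (hc : ∀ ε > 0, Tendsto (fun t => μ t {x | ε < |x|}) (𝓝 0) (𝓝 0))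
    (hj : ∀ ε > 0, Tendsto (fun k : ℕ => 2 ^ k * μ (1 / 2 ^ k) (Ioi ε)) atTop (𝓝 0)) :
    ∃ (Ω : Type) (_ : MeasurableSpace Ω) (P : Measure Ω) (_ : IsProbabilityMeasure P)
      (X : ℝ≥0 → Ω → ℝ), IsSpectrallyNegative P X ∧ ∀ t, P.map (X t) = μ t := by
  obtain ⟨P, hP, hind, hlaw, hcons⟩ := exists_skeleton h0 hμ
  let Y : ℕ → ℕ → (ℕ → ℕ → ℝ) → ℝ := fun k i ω => ω k i
  have hY : ∀ k i, Measurable (Y k i) := fun k i => by fun_prop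
  let D : ℕ → ℕ → (ℕ → ℕ → ℝ) → ℝ := fun k => walk (Y k)
  have hD : ∀ k j, Measurable (D k j) := fun k j => measurable_walk (hY k) j
  have hDlaw : ∀ k i m, P.map (fun ω => D k (i + m) ω - D k i ω) = μ (m * (1 / 2 ^ k)) :=
    fun k i m => map_walk_sub (hY k) (hind k) (hlaw k) h0 hμ i m
  have hosc : ∀ᵐ ω ∂P, ∀ n : ℕ, ∃ r : ℕ, ∀ b : ℕ, ∃ p, ¬ ∀ᶠ k in atTop,
      Osc (fun j => D k j ω) (1 / (n + 1)) ⌊((b : ℝ≥0) + 1) / 2 ^ r * 2 ^ k⌋₊ p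
        ⌈(b : ℝ≥0) / 2 ^ r * 2 ^ k⌉₊ := by
    rw [ae_all_iff]
    intro n
    set ε : ℝ := 1 / (n + 1) / 4 with hε
    have hε0 : 0 < ε := by positivity
    have h1 : ∀ᶠ t in 𝓝 (0 : ℝ≥0), μ t {x | ε < |x|} ≤ 1 / 4 :=
      ((hc ε hε0).eventually_lt_const (by simp)).mono fun _ h => h.le
    obtain ⟨s, hs, h1⟩ := exists_Ico_subset_of_mem_nhds h1 (exists_gt 0)
    -- Blocks of length 2^{-r} < s are so short that every increment inside exceeds ε in modulus
    -- with probability at most 1/4; p oscillations larger than 4ε = 1/(n+1) then have probability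
    -- at most (1/2)^p.
    obtain ⟨r, hr⟩ := (tendsto_two_pow_inv.eventually_lt_const hs).exists
    refine (ae_all_iff.2 fun b : ℕ => ?_).mono fun ω h => ⟨r, h⟩
    refine ae_exists_not_of_measure_le (c := 2 * (1 / 4))
      (A := fun p => {ω | ∀ᶠ k in atTop, Osc (fun j => D k j ω) (1 / (n + 1))
        ⌊((b : ℝ≥0) + 1) / 2 ^ r * 2 ^ k⌋₊ p ⌈(b : ℝ≥0) / 2 ^ r * 2 ^ k⌉₊}) ?_ fun p => ?_
    · rw [show (2 : ℝ≥0∞) * (1 / 4) = ENNReal.ofReal (2 * (1 / 4)) by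
        rw [ENNReal.ofReal_mul (by norm_num), ENNReal.ofReal_div_of_pos (by norm_num)]; simp]
      rw [← ENNReal.ofReal_one, ENNReal.ofReal_lt_ofReal_iff one_pos]
      norm_num
    refine measure_eventually_le (c := fun _ => (2 * (1 / 4)) ^ p)
      (eventually_atTop.2 ⟨r, fun k hk => ?_⟩) tendsto_const_nhds
    have h2 : (0 : ℝ≥0) < 2 ^ k := by positivity
    have h4 : (1 : ℝ) / (n + 1) = 4 * ε := by rw [hε]; ring
    rw [h4]
    refine measure_osc_walk_le (hY k) (hind k) (by
      rw [ENNReal.div_le_iff (by simp) (by simp)]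
      rw [show (4 : ℝ≥0∞) = 2 * 2 by norm_num, ← mul_assoc, one_div,
        ENNReal.inv_mul_cancel (by simp) (by simp), one_mul]
      norm_num) p _ ?_ ?_
    · obtain ⟨i, rfl⟩ := Nat.exists_eq_add_of_le hk
      have h5 : ∀ b : ℝ≥0, b / 2 ^ r * 2 ^ (r + i) = b * 2 ^ i := fun b => by
        rw [pow_add, ← mul_assoc, div_mul_cancel₀ _ (by positivity)]
      rw [h5, h5]
      have h6 : (b : ℝ≥0) * 2 ^ i = ((b * 2 ^ i : ℕ) : ℝ≥0) := by push_cast; rfl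
      have h7 : ((b : ℝ≥0) + 1) * 2 ^ i = (((b + 1) * 2 ^ i : ℕ) : ℝ≥0) := by push_cast; rfl
      rw [h6, h7, Nat.ceil_natCast, Nat.floor_natCast]
      gcongr
      omega
    · intro i j hi hij hjn
      obtain ⟨m, rfl⟩ := Nat.exists_eq_add_of_le hij
      have hms : MeasurableSet {x : ℝ | ε < |x|} := measurableSet_lt measurable_const (by fun_prop)
      have h5 := hDlaw k i m
      have h6 : P {ω | ε < |walk (Y k) (i + m) ω - walk (Y k) i ω|}
          = μ (m * (1 / 2 ^ k)) {x | ε < |x|} := by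
        rw [← h5, Measure.map_apply (f := fun ω => D k (i + m) ω - D k i ω)
          ((hD _ _).sub (hD _ _)) hms]
        rfl
      refine h6.trans_le (h1 ⟨zero_le, lt_of_le_of_lt ?_ hr⟩)
      rw [mul_one_div, div_le_iff₀ h2]
      have h7 := (Nat.ceil_le.1 hi)
      have h8 := (Nat.le_floor_iff (by positivity)).1 hjn
      rw [add_div, add_mul] at h8
      push_cast at h8
      refine (add_le_add_iff_left ((b : ℝ≥0) / 2 ^ r * 2 ^ k)).1 (le_trans ?_ h8)
      gcongr
  -- Union bound over the N 2^k increments before time N; if the bound on increments failed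
  -- eventually in k with positive probability, this would contradict `hj`.
  have hjump : ∀ᵐ ω ∂P, ∀ n N : ℕ, ∃ᶠ k : ℕ in atTop, ∀ j < N * 2 ^ k,
      D k (j + 1) ω - D k j ω ≤ 1 / (n + 1) := by
    simp_rw [ae_all_iff]
    intro n N
    have hε0 : (0 : ℝ) < 1 / (n + 1) := by positivity
    rw [ae_iff]
    refine le_antisymm ?_ bot_le
    refine (measure_mono ?_).trans (measure_eventually_le
      (A := fun k => {ω | ∃ j < N * 2 ^ k, 1 / ((n : ℝ) + 1) < Y k j ω})
      (c := fun k => N * (2 ^ k * μ (1 / 2 ^ k) (Ioi (1 / (n + 1))))) (C := 0) ?_ ?_)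
    · intro ω hω
      simp only [mem_ofPred_eq, Filter.not_frequently, not_forall, not_le] at hω
      refine hω.mono fun k hk => ?_
      obtain ⟨j, hj, h⟩ := hk
      refine ⟨j, hj, h.trans_eq ?_⟩
      simp [D, walk, Finset.sum_range_succ]
    · refine .of_forall fun k => ?_
      have h1 : {ω | ∃ j < N * 2 ^ k, 1 / ((n : ℝ) + 1) < Y k j ω}
          = ⋃ j ∈ Finset.range (N * 2 ^ k), {ω | 1 / ((n : ℝ) + 1) < Y k j ω} := by
        ext ω; simp
      rw [h1]
      refine (measure_biUnion_finset_le _ _).trans_eq ?_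
      have h2 : ∀ j, P {ω | 1 / ((n : ℝ) + 1) < Y k j ω}
          = μ (1 / 2 ^ k) (Ioi (1 / (n + 1))) := fun j => by
        rw [← hlaw k j, Measure.map_apply (hY k j) measurableSet_Ioi]
        rfl
      simp_rw [h2]
      simp [mul_assoc]
    · simpa using ENNReal.Tendsto.const_mul (hj _ hε0) (Or.inr (ENNReal.natCast_ne_top N))
  have hpath : ∀ᵐ ω ∂P, ∃ x : ℝ≥0 → ℝ, IsCadlagNoPosJumps x ∧
      ∀ t : ℝ≥0, Tendsto (fun k => D k (⌊t * 2 ^ k⌋₊ + 1) ω) atTop (𝓝 (x t)) := by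
    filter_upwards [hosc, hjump, hcons] with ω h1 h2 h3
    exact exists_cadlag_of_skeleton (d := fun k j => D k j ω) h3 h1 h2
  -- The upper limit is measurable without discarding null sets, and agrees almost surely with the
  -- regularised path at all times at once.
  let X : ℝ≥0 → (ℕ → ℕ → ℝ) → ℝ := fun t ω => limsup (fun k => D k (⌊t * 2 ^ k⌋₊ + 1) ω) atTop
  have hX : ∀ t, Measurable (X t) := fun t => Measurable.limsup fun k => hD k _
  have hlim : ∀ᵐ ω ∂P, ∀ t, Tendsto (fun k => D k (⌊t * 2 ^ k⌋₊ + 1) ω) atTop (𝓝 (X t ω)) := by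
    filter_upwards [hpath] with ω ⟨x, hx, h⟩ t
    rw [show X t ω = x t from (h t).limsup_eq]
    exact h t
  -- Increments over grid times have laws in the semigroup, so continuity of its characteristic
  -- functions identifies the law of any almost sure limit.
  have hlawlim : ∀ {W : (ℕ → ℕ → ℝ) → ℝ} {i m : ℕ → ℕ} {t : ℝ≥0}, Measurable W →
      (∀ᵐ ω ∂P, Tendsto (fun k => D k (i k + m k) ω - D k (i k) ω) atTop (𝓝 (W ω))) →
      Tendsto (fun k => (m k : ℝ≥0) * (1 / 2 ^ k)) atTop (𝓝 t) → P.map W = μ t := by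
    intro W i m t hW h hm
    have := Measure.isProbabilityMeasure_map (μ := P) hW.aemeasurable
    refine Measure.ext_of_charFun (funext fun θ => ?_)
    refine tendsto_nhds_unique (tendsto_charFun_of_ae
      (Z := fun k ω => D k (i k + m k) ω - D k (i k) ω) (fun k => (hD _ _).sub (hD _ _)) hW h θ) ?_
    simp_rw [hDlaw]
    exact tendsto_charFun_semigroup hμ (tendsto_charFun_one hc) hm θ
  have hXlaw : ∀ t, P.map (X t) = μ t := fun t => by
    refine hlawlim (i := fun _ => 0) (m := fun k => ⌊t * 2 ^ k⌋₊ + 1) (hX t) ?_ ?_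
    · filter_upwards [hlim] with ω h
      simpa [D, walk] using h t
    · have := (tendsto_floor_div t).add tendsto_two_pow_inv
      rw [add_zero] at this
      refine this.congr fun k => ?_
      push_cast
      ring
  refine ⟨_, inferInstance, P, hP, X, ⟨hX, ?_, ?_, ?_, ?_⟩, hXlaw⟩
  · have h1 : P.map (X 0) {0}ᶜ = 0 := by rw [hXlaw, h0]; simp
    rw [Measure.map_apply (hX 0) (measurableSet_singleton 0).compl] at h1
    exact h1
  · rw [hasIndepIncrements_iff_nat]
    intro t ht
    refine iIndepFun_of_tendsto_ae (Z := fun k i ω => D k (⌊t (i + 1) * 2 ^ k⌋₊ + 1) ω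
      - D k (⌊t i * 2 ^ k⌋₊ + 1) ω) (fun k i => (hD _ _).sub (hD _ _))
      (fun i => (hX _).sub (hX _)) (fun k => ?_) fun i => ?_
    · refine iIndepFun_walk_sub (hY k) (hind k) (t := fun i => ⌊t i * 2 ^ k⌋₊ + 1) ?_
      intro a b hab
      have := ht hab
      dsimp only
      gcongr
    · filter_upwards [hlim] with ω h
      exact (h _).sub (h _)
  · intro s t
    refine ⟨((hX _).sub (hX _)).aemeasurable, (hX _).aemeasurable, ?_⟩
    rw [hXlaw]
    have hle : ∀ k : ℕ, ⌊s * 2 ^ k⌋₊ ≤ ⌊(s + t) * 2 ^ k⌋₊ := fun k => by gcongr; exact le_self_add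
    refine hlawlim (i := fun k => ⌊s * 2 ^ k⌋₊ + 1)
      (m := fun k => ⌊(s + t) * 2 ^ k⌋₊ - ⌊s * 2 ^ k⌋₊) ((hX _).sub (hX _)) ?_ ?_
    · filter_upwards [hlim] with ω h
      refine ((h (s + t)).sub (h s)).congr fun k => ?_
      congr 2
      have := hle k
      omega
    · have := (tendsto_floor_div (s + t)).sub (tendsto_floor_div s)
      rw [add_tsub_cancel_left] at this
      refine this.congr fun k => ?_
      rw [Nat.cast_tsub, tsub_mul, mul_one_div, mul_one_div]
  · filter_upwards [hpath] with ω ⟨x, hx, h⟩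
    have : (fun t => X t ω) = x := funext fun t => (h t).limsup_eq
    rwa [this]

end Existence

/-! ### From exponents linear in time to a process -/

lemma HasLaplace.integrable_sq_exp_sub_one {c : ℝ} {ν : Measure ℝ} [IsProbabilityMeasure ν]
    {f : ℝ → ℝ} (h : HasLaplace c ν f) {u : ℝ} (hu : 0 ≤ u) :
    Integrable (fun x => (Real.exp (u * x) - 1) ^ 2) ν := by
  have h1 := h.integrable (u := u) (.inr hu)
  have h2 := h.integrable (u := 2 * u) (.inr (by positivity))
  refine ((h2.sub (h1.const_mul 2)).add (integrable_const 1)).congr (.of_forall fun x => ?_)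
  simp only [Pi.add_apply, Pi.sub_apply]
  rw [mul_assoc 2 u x, two_mul, Real.exp_add]
  ring

lemma HasLaplace.integral_sq_exp_sub_one {c : ℝ} {ν : Measure ℝ} [IsProbabilityMeasure ν]
    {f : ℝ → ℝ} (h : HasLaplace c ν f) {u : ℝ} (hu : 0 ≤ u) :
    ∫ x, (Real.exp (u * x) - 1) ^ 2 ∂ν = Real.exp (f (2 * u)) - 2 * Real.exp (f u) + 1 := by
  have h1 := h.integrable (u := u) (.inr hu)
  have h2 := h.integrable (u := 2 * u) (.inr (by positivity))
  have : ∀ x, (Real.exp (u * x) - 1) ^ 2 = Real.exp (2 * u * x) - 2 * Real.exp (u * x) + 1 := by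
    intro x
    rw [mul_assoc 2 u x, two_mul, Real.exp_add]
    ring
  simp_rw [this]
  have h3 : Integrable (fun x => Real.exp (2 * u * x) - 2 * Real.exp (u * x)) ν :=
    h2.sub (h1.const_mul 2)
  rw [integral_add h3 (integrable_const 1), integral_sub h2 (h1.const_mul 2), integral_const_mul, h.integral (.inr hu),
    h.integral (.inr (by positivity))]
  simp

/-- Laws whose Laplace exponents are linear in time are continuous in probability at `0`. -/
lemma tendsto_measure_abs_gt {c : ℝ} {F : ℝ → ℝ} {μ : ℝ≥0 → Measure ℝ}
    [∀ t, IsProbabilityMeasure (μ t)] (h : ∀ t, HasLaplace c (μ t) (fun u => t * F u))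
    {ε : ℝ} (hε : 0 < ε) : Tendsto (fun t => μ t {x | ε < |x|}) (𝓝 0) (𝓝 0) := by
  set m : ℝ := (1 - Real.exp (-ε)) ^ 2 with hm
  have hlt : Real.exp (-ε) < 1 := by simpa using hε
  have hm0 : 0 < m := by have : 0 < 1 - Real.exp (-ε) := by linarith
                         positivity
  -- Markov's inequality for (e^x − 1)², which is at least m where |x| > ε and whose mean is
  -- explicit in t and vanishes at t = 0.
  have key : ∀ t : ℝ≥0, μ t {x | ε < |x|}
      ≤ ENNReal.ofReal ((Real.exp (t * F 2) - 2 * Real.exp (t * F 1) + 1) / m) := by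
    intro t
    have h1 := (h t).integrable_sq_exp_sub_one zero_le_one
    have h2 := (h t).integral_sq_exp_sub_one zero_le_one
    have h3 := mul_meas_ge_le_integral_of_nonneg (.of_forall fun x => sq_nonneg _) h1 m
    rw [h2, mul_one, mul_comm, ← le_div_iff₀ hm0] at h3
    refine le_trans ?_ (ENNReal.ofReal_le_ofReal h3)
    rw [ofReal_measureReal]
    refine measure_mono fun x (hx : ε < |x|) => ?_
    have h4 : 1 - Real.exp (-ε) ≤ |Real.exp (1 * x) - 1| := by
      rw [one_mul]
      rcases lt_abs.1 hx with hx | hx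
      · have h5 := Real.add_one_le_exp x
        have h6 := Real.add_one_le_exp (-ε)
        exact le_trans (by linarith) (le_abs_self _)
      · have h5 : Real.exp x ≤ Real.exp (-ε) := Real.exp_le_exp.2 (by linarith)
        exact le_trans (by linarith) (neg_le_abs _)
    change m ≤ _
    rw [hm, ← sq_abs (Real.exp (1 * x) - 1)]
    exact pow_le_pow_left₀ (by linarith) h4 2
  refine tendsto_of_tendsto_of_tendsto_of_le_of_le tendsto_const_nhds ?_ (fun _ => bot_le) key
  have hcont : Continuous fun t : ℝ≥0 =>
      ENNReal.ofReal ((Real.exp (t * F 2) - 2 * Real.exp (t * F 1) + 1) / m) :=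
    ENNReal.continuous_ofReal.comp (by fun_prop)
  have := hcont.tendsto 0
  norm_num at this
  exact this

/-- Laws with Laplace exponents linear in time and asymptotically without upward jumps are those of
a Lévy process without positive jumps. -/
theorem isLaplaceExponent_of_laws {c : ℝ} {F : ℝ → ℝ} {μ : ℝ≥0 → Measure ℝ}
    [∀ t, IsProbabilityMeasure (μ t)] (h : ∀ t, HasLaplace c (μ t) (fun u => t * F u))
    (hj : ∀ ε > 0, Tendsto (fun k : ℕ => 2 ^ k * μ (1 / 2 ^ k) (Ioi ε)) atTop (𝓝 0)) :
    IsLaplaceExponent c 0 F := by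
  -- Linearity of the exponent in t and uniqueness of Laplace transforms give the semigroup
  -- property.
  have h0 : μ 0 = Measure.dirac 0 := (h 0).unique
    ((hasLaplace_dirac c 0).congr fun u _ => by simp)
  have hμ : ∀ s t, μ (s + t) = (μ s).conv (μ t) := fun s t => (h _).unique
    (((h s).conv (h t)).congr fun u _ => by push_cast; ring)
  obtain ⟨Ω, mΩ, P, hP, X, hX, hlaw⟩ := exists_levy h0 hμ (fun ε hε => tendsto_measure_abs_gt h hε) hj
  refine ⟨Ω, mΩ, P, hP, X, fun _ => ∞, hX, ⟨le_rfl, measurable_const, fun t => by simp,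
    indepFun_const_left _ _⟩, fun u hu t => ?_⟩
  have h1 : {ω : Ω | (t : ℝ≥0∞) < ∞} = univ := by ext; simp
  simp only [h1, indicator_univ]
  have h2 := (h t).integrable hu
  have h3 := (h t).integral hu
  rw [← hlaw t] at h2 h3
  rw [integrable_map_measure (by fun_prop) (hX.measurable t).aemeasurable] at h2
  rw [integral_map (hX.measurable t).aemeasurable (by fun_prop)] at h3
  exact ⟨h2, h3⟩

/-! ### Upward jumps in short time, and the laws before killing -/

/-- Near t, values on the left are close to l and values from t on are close to x(t) ≤ l, so
crossing t cannot raise the path by more than the two errors ε/2. -/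
lemma IsCadlagNoPosJumps.exists_nhds {x : ℝ≥0 → ℝ} (hx : IsCadlagNoPosJumps x) {ε : ℝ} (hε : 0 < ε)
    (t : ℝ≥0) : ∃ S ∈ 𝓝 t, ∀ a ∈ S, ∀ b ∈ S, a ≤ b → x b - x a ≤ ε := by

  obtain ⟨hr, l, hl, hlt⟩ := hx t
  have h1 := eventually_nhdsWithin_iff.1 (Metric.tendsto_nhds.1 hr (ε / 2) (by positivity))
  have h2 := eventually_nhdsWithin_iff.1 (Metric.tendsto_nhds.1 hl (ε / 2) (by positivity))
  refine ⟨_, h1.and h2, fun a ha b hb hab => ?_⟩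
  rcases lt_or_ge a t with hat | hat
  · have ha' := abs_lt.1 (ha.2 hat)
    rcases lt_or_ge b t with hbt | hbt
    · have hb' := abs_lt.1 (hb.2 hbt); linarith
    · have hb' := abs_lt.1 (hb.1 hbt); linarith
  · have ha' := abs_lt.1 (ha.1 hat)
    have hb' := abs_lt.1 (hb.1 (hat.trans hab))
    linarith

/-- Lebesgue's number lemma makes the local bound uniform over [0,1]. -/
lemma IsCadlagNoPosJumps.eventually_increment_le {x : ℝ≥0 → ℝ} (hx : IsCadlagNoPosJumps x) {ε : ℝ}
    (hε : 0 < ε) : ∀ᶠ n : ℕ in atTop, ∀ j < n,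
      x (((j + 1 : ℕ) : ℝ≥0) / n) - x ((j : ℝ≥0) / n) ≤ ε := by
  choose S hS hSx using fun t => hx.exists_nhds hε t
  obtain ⟨δ, hδ, h⟩ := lebesgue_number_lemma_of_emetric_nhds (isCompact_Icc (a := (0 : ℝ≥0)) (b := 1))
    (c := S) (fun t _ => hS t)
  have h1 : Tendsto (fun n : ℕ => ((n : ℝ≥0∞))⁻¹) atTop (𝓝 0) := ENNReal.tendsto_inv_nat_nhds_zero
  filter_upwards [h1.eventually_lt_const hδ, eventually_gt_atTop 0] with n hn hn0 j hj
  have hn' : (0 : ℝ≥0) < n := by exact_mod_cast hn0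
  obtain ⟨y, hy⟩ := h ((j : ℝ≥0) / n) ⟨zero_le, by
    rw [div_le_one hn']; exact_mod_cast hj.le⟩
  refine hSx y _ (hy ?_) _ (hy ?_) ?_
  · exact Metric.mem_eball_self hδ
  · rw [Metric.mem_eball]
    refine lt_of_le_of_lt (le_of_eq ?_) hn
    push_cast
    rw [add_div, edist_nndist, NNReal.nndist_eq, add_tsub_cancel_left, tsub_eq_zero_of_le le_self_add]
    rw [max_eq_left zero_le, one_div, ENNReal.coe_inv hn'.ne']
    rfl
  · gcongr; omega

/-- From log(1 − p) ≤ −p one gets n p ≤ −log((1 − p)^n), which tends to −log 1 = 0. -/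
lemma tendsto_mul_of_one_sub_pow {p : ℕ → ℝ} (h0 : ∀ n, 0 ≤ p n) (h1 : ∀ n, p n ≤ 1)
    (h : Tendsto (fun n => (1 - p n) ^ n) atTop (𝓝 1)) :
    Tendsto (fun n => n * p n) atTop (𝓝 0) := by
  have h2 : Tendsto (fun n => -Real.log ((1 - p n) ^ n)) atTop (𝓝 0) := by
    have := ((Real.continuousAt_log one_ne_zero).tendsto.comp h).neg
    simpa using this
  refine tendsto_of_tendsto_of_tendsto_of_le_of_le' tendsto_const_nhds h2
    (.of_forall fun n => mul_nonneg n.cast_nonneg (h0 n)) ?_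
  filter_upwards [h.eventually_const_lt (show (0 : ℝ) < 1 by norm_num), eventually_gt_atTop 0]
    with n hn hn0
  have h3 : 0 < 1 - p n := by
    refine lt_of_le_of_ne (by linarith [h1 n]) fun h4 => ?_
    rw [← h4, zero_pow hn0.ne'] at hn
    exact lt_irrefl _ hn
  rw [Real.log_pow]
  have := Real.log_le_sub_one_of_pos h3
  nlinarith [(n.cast_nonneg : (0 : ℝ) ≤ n)]

/-- A Lévy process with no positive jumps is unlikely to jump upwards in a short time. -/
lemma IsSpectrallyNegative.tendsto_mul_measure_Ioi {Ω : Type*} [MeasurableSpace Ω] {P : Measure Ω}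
    [IsProbabilityMeasure P] {X : ℝ≥0 → Ω → ℝ} (hX : IsSpectrallyNegative P X) {ε : ℝ} (hε : 0 < ε) :
    Tendsto (fun n : ℕ => n * (P.map (X (1 / n))).real (Ioi ε)) atTop (𝓝 0) := by
  have := fun t => Measure.isProbabilityMeasure_map (μ := P) (hX.measurable t).aemeasurable
  refine tendsto_mul_of_one_sub_pow (fun n => measureReal_nonneg) (fun n => measureReal_le_one) ?_
  let Y : ℕ → ℕ → Ω → ℝ := fun n j ω => X (((j + 1 : ℕ) : ℝ≥0) / n) ω - X ((j : ℝ≥0) / n) ω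
  have hY : ∀ n j, Measurable (Y n j) := fun n j => (hX.measurable _).sub (hX.measurable _)
  -- All n increments over the mesh 1/n of [0,1] are at most ε. Path regularity makes this hold
  -- eventually, almost surely, and independence gives it probability (1 − p)^n.
  let A : ℕ → Set Ω := fun n => ⋂ j ∈ Finset.range n, Y n j ⁻¹' (Iic ε)
  have hA : ∀ n, MeasurableSet (A n) := fun n =>
    Finset.measurableSet_biInter _ fun j _ => hY n j measurableSet_Iic
  have hlaw : ∀ n j, P.map (Y n j) = P.map (X (1 / n)) := fun n j => by
    have h1 := (hX.stationary ((j : ℝ≥0) / n) (1 / n)).map_eq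
    rw [← h1]
    congr 1
    ext ω
    simp only [Y]
    push_cast
    rw [add_div]
  have hPA : ∀ n, P.real (A n) = (1 - (P.map (X (1 / n))).real (Ioi ε)) ^ n := fun n => by
    have hind : iIndepFun (Y n) P := by
      refine hX.indep.nat (t := fun j => (j : ℝ≥0) / n) fun a b hab => ?_
      dsimp only
      gcongr
    have h1 := hind.measure_inter_preimage_eq_mul (Finset.range n) (sets := fun _ => Iic ε)
      (fun _ _ => measurableSet_Iic)
    have h2 : ∀ j, P (Y n j ⁻¹' Iic ε) = P.map (X (1 / n)) (Iic ε) := fun j => by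
      rw [← hlaw n j, Measure.map_apply (hY n j) measurableSet_Iic]
    simp_rw [h2, Finset.prod_const, Finset.card_range] at h1
    rw [Measure.real, h1, ENNReal.toReal_pow, ← probReal_compl_eq_one_sub measurableSet_Ioi,
      compl_Ioi]
    rfl
  simp_rw [← hPA]
  have h3 : Tendsto (fun n => P (A n)) atTop (𝓝 (P univ)) := by
    refine tendsto_measure_of_ae_tendsto_indicator_of_isFiniteMeasure atTop MeasurableSet.univ hA ?_
    filter_upwards [hX.paths] with ω hω
    filter_upwards [hω.eventually_increment_le hε] with n hn
    simp only [mem_univ, iff_true, A, mem_iInter, Finset.mem_range]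
    exact hn
  have := (ENNReal.tendsto_toReal (measure_ne_top P univ)).comp h3
  rw [measure_univ, ENNReal.toReal_one] at this
  exact this

/-- The laws of the process before killing. -/
theorem IsLaplaceExponent.exists_laws {ℓ κ : ℝ} {ψ : ℝ → ℝ} (h : IsLaplaceExponent ℓ κ ψ) :
    0 ≤ κ ∧ ψ 0 = -κ ∧ ∃ μ : ℝ≥0 → Measure ℝ, (∀ t, IsProbabilityMeasure (μ t)) ∧
      (∀ t, HasLaplace ℓ (μ t) (fun u => t * (ψ u + κ))) ∧
      ∀ ε > 0, Tendsto (fun n : ℕ => n * (μ (1 / n)).real (Ioi ε)) atTop (𝓝 0) := by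
  obtain ⟨Ω, mΩ, P, hP, X, ζ, hX, hζ, h⟩ := h
  have hm : ∀ t : ℝ≥0, MeasurableSet {ω | (t : ℝ≥0∞) < ζ ω} := fun t =>
    measurableSet_lt measurable_const hζ.measurable
  refine ⟨hζ.rate_nonneg, ?_, fun t => P.map (X t),
    fun t => Measure.isProbabilityMeasure_map (hX.measurable t).aemeasurable, fun t u hu => ?_,
    fun ε hε => hX.tendsto_mul_measure_Ioi hε⟩
  · have h1 := (h 0 (.inr le_rfl) 1).2
    simp only [zero_mul, Real.exp_zero] at h1
    rw [integral_indicator (hm 1)] at h1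
    simp only [integral_const, measureReal_restrict_apply_univ, smul_eq_mul, mul_one] at h1
    rw [Measure.real, hζ.law 1, ENNReal.toReal_ofReal (Real.exp_pos _).le] at h1
    simpa using (Real.exp_injective h1).symm
  · rw [lintegral_map (by fun_prop) (hX.measurable t)]
    have h1 := h u hu t
    have h2 := ofReal_integral_eq_lintegral_ofReal h1.1
      (.of_forall fun ω => indicator_nonneg (fun _ _ => (Real.exp_pos _).le) _)
    rw [h1.2] at h2
    -- Independence of ζ and X splits off the survival probability e^{-κt}, which is then divided
    -- out.
    have h3 : ∀ ω, ENNReal.ofReal ({ω | (t : ℝ≥0∞) < ζ ω}.indicator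
        (fun ω => Real.exp (u * X t ω)) ω) = ((Ioi (t : ℝ≥0∞)).indicator (fun _ => (1 : ℝ≥0∞)) ∘ ζ) ω *
        ((fun x => ENNReal.ofReal (Real.exp (u * x t))) ∘ fun ω t => X t ω) ω := fun ω => by
      by_cases hω : (t : ℝ≥0∞) < ζ ω
      · simp [indicator, hω]
      · simp [indicator, hω]
    simp_rw [h3] at h2
    have h4 := lintegral_mul_eq_lintegral_mul_lintegral_of_indepFun
      (f := (Ioi (t : ℝ≥0∞)).indicator (fun _ => (1 : ℝ≥0∞)) ∘ ζ)
      (g := (fun x : ℝ≥0 → ℝ => ENNReal.ofReal (Real.exp (u * x t))) ∘ fun ω t => X t ω)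
      ((measurable_const.indicator measurableSet_Ioi).comp hζ.measurable)
      (Measurable.comp (by fun_prop) (measurable_pi_lambda _ hX.measurable))
      (hζ.indep.comp (measurable_const.indicator measurableSet_Ioi) (by fun_prop))
    simp only [Pi.mul_apply] at h4
    rw [h4] at h2
    have h5 : ∫⁻ ω, ((Ioi (t : ℝ≥0∞)).indicator (fun _ => (1 : ℝ≥0∞)) ∘ ζ) ω ∂P
        = ENNReal.ofReal (Real.exp (-κ * t)) := by
      rw [← hζ.law t, ← lintegral_indicator_one (hm t)]
      rfl
    rw [h5] at h2
    have h6 : ENNReal.ofReal (Real.exp (t * (ψ u + κ)))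
        = ENNReal.ofReal (Real.exp (κ * t)) * ENNReal.ofReal (Real.exp (t * ψ u)) := by
      rw [← ENNReal.ofReal_mul (Real.exp_pos _).le, ← Real.exp_add]; ring_nf
    rw [h6, h2, ← mul_assoc, ← ENNReal.ofReal_mul (Real.exp_pos _).le, ← Real.exp_add]
    simp

/-! ### One-dimensional laws and their behaviour as time tends to zero -/

/-- The marginal laws of a process with Laplace exponent `Ψ` and no positive jumps. -/
structure LevyLaws (ℓ : ℝ) (Ψ : ℝ → ℝ) (μ : ℝ≥0 → Measure ℝ) : Prop where
  prob : ∀ t, IsProbabilityMeasure (μ t)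
  laplace : ∀ t : ℝ≥0, HasLaplace ℓ (μ t) (fun u => t * Ψ u)
  jump : ∀ ε > 0, Tendsto (fun n : ℕ => n * (μ (1 / n)).real (Ioi ε)) atTop (𝓝 0)

lemma tendsto_mul_exp_sub_one (a : ℝ) :
    Tendsto (fun n : ℕ => n * (Real.exp (((1 / n : ℝ≥0) : ℝ) * a) - 1)) atTop (𝓝 a) := by
  have h1 : HasDerivAt (fun x : ℝ => Real.exp (x * a)) a 0 := by
    have := ((hasDerivAt_id (0 : ℝ)).mul_const a).exp
    simpa using this
  have h2 : Tendsto (fun n : ℕ => ((1 / n : ℝ≥0) : ℝ)) atTop (𝓝[≠] 0) := by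
    refine tendsto_nhdsWithin_iff.2 ⟨?_, ?_⟩
    · simpa using tendsto_one_div_atTop_nhds_zero_nat (𝕜 := ℝ)
    · filter_upwards [eventually_gt_atTop 0] with n hn
      have : (n : ℝ) ≠ 0 := by exact_mod_cast hn.ne'
      simpa using hn.ne'
  refine ((hasDerivAt_iff_tendsto_slope.1 h1).comp h2).congr fun n => ?_
  simp [slope]

/-! ### The primitive of the exponential -/

section Primitive

/-- The primitive of `exp (v y)` vanishing at `0`. -/
def expPrim (v z : ℝ) : ℝ := ∫ y in (0 : ℝ)..z, Real.exp (v * y)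

lemma expPrim_zero_left (z : ℝ) : expPrim 0 z = z := by simp [expPrim]

lemma expPrim_of_ne {v : ℝ} (hv : v ≠ 0) (z : ℝ) : expPrim v z = (Real.exp (v * z) - 1) / v := by
  rw [expPrim, intervalIntegral.integral_comp_mul_left _ hv, integral_exp]
  simp [div_eq_inv_mul]

lemma expPrim_zero_right (v : ℝ) : expPrim v 0 = 0 := by simp [expPrim]

@[fun_prop]
lemma continuous_expPrim (v : ℝ) : Continuous (expPrim v) := by
  by_cases hv : v = 0
  · subst hv
    exact continuous_id.congr fun z => (expPrim_zero_left z).symm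
  · exact Continuous.congr (by fun_prop) fun z => (expPrim_of_ne hv z).symm

lemma expPrim_sub (u β z : ℝ) :
    expPrim (u + β) z - expPrim β z = ∫ y in (0 : ℝ)..z, (Real.exp (u * y) - 1) * Real.exp (β * y) := by
  rw [expPrim, expPrim, ← intervalIntegral.integral_sub
    (Continuous.intervalIntegrable (by fun_prop) _ _) (Continuous.intervalIntegrable (by fun_prop) _ _)]
  congr 1
  ext y
  rw [add_mul, Real.exp_add]
  ring

lemma abs_expPrim_le {v z M : ℝ} (hz : 0 ≤ z) (hM : |v| + 1 ≤ M) :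
    |expPrim v z| ≤ Real.exp (M * z) := by
  have h1 : ‖expPrim v z‖ ≤ Real.exp (|v| * z) * |z - 0| := by
    refine intervalIntegral.norm_integral_le_of_norm_le_const fun y hy => ?_
    rw [uIoc_of_le hz] at hy
    rw [Real.norm_eq_abs, Real.abs_exp, Real.exp_le_exp]
    calc v * y ≤ |v| * y := mul_le_mul_of_nonneg_right (le_abs_self _) hy.1.le
      _ ≤ |v| * z := mul_le_mul_of_nonneg_left hy.2 (abs_nonneg _)
  rw [Real.norm_eq_abs, sub_zero, abs_of_nonneg hz] at h1
  have h2 : z ≤ Real.exp z := by linarith [Real.add_one_le_exp z]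
  calc |expPrim v z| ≤ Real.exp (|v| * z) * Real.exp z :=
        h1.trans (mul_le_mul_of_nonneg_left h2 (Real.exp_pos _).le)
    _ = Real.exp ((|v| + 1) * z) := by rw [← Real.exp_add]; ring_nf
    _ ≤ _ := Real.exp_le_exp.2 (mul_le_mul_of_nonneg_right hM hz)

/-- Completing the square. With w = e^{Mz}, it absorbs exponential growth into a small multiple of
(e^{Mz} − 1)² plus a constant. -/
lemma mul_exp_le {K ε w : ℝ} (hε : 0 < ε) : K * w ≤ ε * (w - 1) ^ 2 + (K + K ^ 2 / (4 * ε)) := by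
  have h1 : K ^ 2 / (4 * ε) = ε * (K / (2 * ε)) ^ 2 := by field_simp; ring
  have h2 : K * (w - 1) = 2 * ε * ((w - 1) * (K / (2 * ε))) := by field_simp
  nlinarith [sq_nonneg (w - 1 - K / (2 * ε))]

lemma sq_le_sq_exp_sub_one {M z : ℝ} (hM : 1 ≤ M) (hz : 0 ≤ z) : z ^ 2 ≤ (Real.exp (M * z) - 1) ^ 2 := by
  have h1 := Real.add_one_le_exp (M * z)
  have h2 : z ≤ M * z := by nlinarith
  exact pow_le_pow_left₀ hz (by linarith) 2

/-- The integrand (e^{uy} − 1)e^{βy} is uy + o(y) at 0, so its primitive is uz²/2 + o(z²), and z² ≤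
(e^{Mz} − 1)². Away from 0 everything grows at most like e^{Mz}, and the constant left over is
charged to {z > η}. -/
lemma expPrim_sub_bound (u : ℝ) {β ε : ℝ} (hε : 0 < ε) : ∃ η > 0, ∃ C, ∀ z : ℝ,
    |(expPrim (u + β) (max z 0) - expPrim β (max z 0)) - u / 2 * (min (max z 0) 1) ^ 2|
      ≤ ε * (Real.exp ((|u + β| + |β| + 1) * z) - 1) ^ 2 + C * (Ioi η).indicator 1 z := by
  set M := |u + β| + |β| + 1 with hM
  have hM1 : 1 ≤ M := by have := abs_nonneg (u + β); have := abs_nonneg β; linarith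
  have hder : HasDerivAt (fun y : ℝ => (Real.exp (u * y) - 1) * Real.exp (β * y)) u 0 := by
    have h1 := (((hasDerivAt_id (0 : ℝ)).const_mul u).exp.sub_const 1).mul
      (((hasDerivAt_id (0 : ℝ)).const_mul β).exp)
    refine HasDerivAt.congr_deriv h1 ?_
    simp
  have h1 := (hasDerivAt_iff_isLittleO.1 hder).bound hε
  obtain ⟨η₀, hη₀, h2⟩ := Metric.eventually_nhds_iff.1 h1
  -- The 1 keeps the truncation min(z,1) inactive for z ≤ η. The factor 2 + |u| in C counts the two
  -- primitives, each at most e^{Mz}, and the quadratic term, at most |u|e^{Mz}.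
  refine ⟨min (η₀ / 2) 1, by positivity, (2 + |u|) + (2 + |u|) ^ 2 / (4 * ε), fun z => ?_⟩
  rcases le_or_gt z 0 with hz | hz
  · have hCn : 0 ≤ ((2 + |u|) + (2 + |u|) ^ 2 / (4 * ε)) * (Ioi (min (η₀ / 2) 1)).indicator 1 z :=
      mul_nonneg (by positivity) (indicator_nonneg (fun _ _ => zero_le_one) _)
    rw [max_eq_right hz, expPrim_zero_right, expPrim_zero_right, min_eq_left zero_le_one]
    simp only [sub_self, ne_eq, OfNat.ofNat_ne_zero, not_false_eq_true, zero_pow, mul_zero, abs_zero]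
    positivity
  rw [max_eq_left hz.le]
  by_cases hzη : min (η₀ / 2) 1 < z
  · rw [indicator_of_mem (show z ∈ Ioi _ from hzη), Pi.one_apply, mul_one]
    refine le_trans ?_ (mul_exp_le hε)
    have h3 := abs_expPrim_le (v := u + β) (M := M) hz.le (by rw [hM]; linarith [abs_nonneg β])
    have h4 := abs_expPrim_le (v := β) (M := M) hz.le (by rw [hM]; linarith [abs_nonneg (u + β)])
    have h5 : |u / 2 * (min z 1) ^ 2| ≤ |u| * Real.exp (M * z) := by
      have h6 : (min z 1) ^ 2 ≤ 1 := pow_le_one₀ (by positivity) (min_le_right _ _)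
      have h7 : 1 ≤ Real.exp (M * z) := Real.one_le_exp (by positivity)
      rw [abs_mul, abs_div, abs_of_nonneg (sq_nonneg (min z 1)), abs_two]
      have := abs_nonneg u
      calc |u| / 2 * (min z 1) ^ 2 ≤ |u| * 1 :=
            mul_le_mul (by linarith) h6 (sq_nonneg _) this
        _ ≤ _ := mul_le_mul_of_nonneg_left h7 this
    calc _ ≤ |expPrim (u + β) z - expPrim β z| + |u / 2 * (min z 1) ^ 2| := abs_sub _ _
      _ ≤ |expPrim (u + β) z| + |expPrim β z| + |u / 2 * (min z 1) ^ 2| := by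
          gcongr; exact abs_sub _ _
      _ ≤ _ := by linarith
  · rw [indicator_of_notMem (show z ∉ Ioi _ from hzη), mul_zero, add_zero]
    have hz1 : z ≤ 1 := (not_lt.1 hzη).trans (min_le_right _ _)
    have hz2 : z ≤ η₀ / 2 := (not_lt.1 hzη).trans (min_le_left _ _)
    have h3 : (expPrim (u + β) z - expPrim β z) - u / 2 * (min z 1) ^ 2
        = ∫ y in (0 : ℝ)..z, ((Real.exp (u * y) - 1) * Real.exp (β * y) - u * y) := by
      rw [intervalIntegral.integral_sub (Continuous.intervalIntegrable (by fun_prop) _ _)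
        (Continuous.intervalIntegrable (by fun_prop) _ _), expPrim_sub, min_eq_left hz1,
        intervalIntegral.integral_const_mul, integral_id]
      ring
    have h4 : ‖∫ y in (0 : ℝ)..z, ((Real.exp (u * y) - 1) * Real.exp (β * y) - u * y)‖
        ≤ ε * z * |z - 0| := by
      refine intervalIntegral.norm_integral_le_of_norm_le_const fun y hy => ?_
      rw [uIoc_of_le hz.le] at hy
      have h5 := h2 (y := y) (by
        rw [Real.dist_eq, sub_zero, abs_of_pos hy.1]; linarith [hy.2])
      simp only [mul_zero, Real.exp_zero, sub_self, zero_mul, sub_zero, smul_eq_mul,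
        Real.norm_eq_abs, abs_of_pos hy.1] at h5
      rw [Real.norm_eq_abs]
      rw [mul_comm y u] at h5
      exact h5.trans (mul_le_mul_of_nonneg_left hy.2 hε.le)
    rw [h3, ← Real.norm_eq_abs]
    refine h4.trans ?_
    rw [sub_zero, abs_of_pos hz, mul_assoc, ← pow_two]
    exact mul_le_mul_of_nonneg_left (sq_le_sq_exp_sub_one hM1 hz.le) hε.le

end Primitive

/-- `Ψ v / v`, continued by the derivative at `0`. -/
def ratio (Ψ : ℝ → ℝ) (v : ℝ) : ℝ := if v = 0 then derivWithin Ψ (Ioi 0) 0 else Ψ v / v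

/-! ### Rescaled expectations at time 1/n -/

namespace LevyLaws

variable {ℓ : ℝ} {Ψ : ℝ → ℝ} {μ : ℝ≥0 → Measure ℝ}

lemma apply_zero (h : LevyLaws ℓ Ψ μ) : Ψ 0 = 0 := by
  have := h.prob 1
  have h1 := (h.laplace 1).integral (u := 0) (.inr le_rfl)
  simp only [zero_mul, Real.exp_zero, integral_const, probReal_univ, smul_eq_mul, mul_one,
    NNReal.coe_one, one_mul] at h1
  exact (Real.exp_eq_one_iff _).1 h1.symm

/-- Convergence is used as boundedness: it makes any error ε(e^{Mz} − 1)² negligible after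
multiplication by n. -/
lemma tendsto_mul_integral_sq (h : LevyLaws ℓ Ψ μ) {M : ℝ} (hM : 0 ≤ M) :
    Tendsto (fun n : ℕ => (n : ℝ) * ∫ z, (Real.exp (M * z) - 1) ^ 2 ∂μ (1 / n)) atTop
      (𝓝 (Ψ (2 * M) - 2 * Ψ M)) := by
  have := h.prob
  refine ((tendsto_mul_exp_sub_one (Ψ (2 * M))).sub
    ((tendsto_mul_exp_sub_one (Ψ M)).const_mul 2)).congr fun n => ?_
  rw [(h.laplace _).integral_sq_exp_sub_one hM]
  ring

lemma integrable_of_bound (h : LevyLaws ℓ Ψ μ) {D : ℝ → ℝ} (hD : Measurable D) {M : ℝ} (hM : 0 ≤ M)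
    {ε η C : ℝ} (hb : ∀ z, |D z| ≤ ε * (Real.exp (M * z) - 1) ^ 2 + C * (Ioi η).indicator 1 z)
    (t : ℝ≥0) : Integrable D (μ t) := by
  have := h.prob
  refine Integrable.mono' (((h.laplace t).integrable_sq_exp_sub_one hM).const_mul ε |>.add
    (((integrable_const (1 : ℝ)).indicator (measurableSet_Ioi (a := η))).const_mul C))
    hD.aestronglyMeasurable (.of_forall hb)

/-- Functions that are `o(z²)` at `0+`, vanish on the negative half-line and grow at most
exponentially do not contribute in the limit. -/
lemma tendsto_mul_integral_zero (h : LevyLaws ℓ Ψ μ) {D : ℝ → ℝ} (hD : Measurable D) {M : ℝ}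
    (hM : 0 ≤ M) (hb : ∀ ε > 0, ∃ η > 0, ∃ C, ∀ z,
      |D z| ≤ ε * (Real.exp (M * z) - 1) ^ 2 + C * (Ioi η).indicator 1 z) :
    Tendsto (fun n : ℕ => (n : ℝ) * ∫ z, D z ∂μ (1 / n)) atTop (𝓝 0) := by
  have := h.prob
  set L := Ψ (2 * M) - 2 * Ψ M
  have hL := h.tendsto_mul_integral_sq hM
  have hB := hL.eventually_lt_const (show L < |L| + 1 by linarith [le_abs_self L])
  rw [Metric.tendsto_nhds]
  intro e he
  have hB0 : 0 < |L| + 1 := by positivity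
  -- The rescaled square is eventually below |L| + 1, so this choice of ε leaves e/2 for it and e/2
  -- for the term n μ(η,∞).
  obtain ⟨η, hη, C, hC⟩ := hb (e / (2 * (|L| + 1))) (by positivity)
  have hj := (h.jump η hη).const_mul C
  rw [mul_zero] at hj
  filter_upwards [hB, hj.eventually_lt_const (show (0 : ℝ) < e / 2 by positivity)] with n hn hn2
  have hi := h.integrable_of_bound hD hM hC (1 / n)
  have h1 : ∫ z, |D z| ∂μ (1 / n) ≤ e / (2 * (|L| + 1)) * ∫ z, (Real.exp (M * z) - 1) ^ 2 ∂μ (1 / n)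
      + C * (μ (1 / n)).real (Ioi η) := by
    have i1 := ((h.laplace (1 / n)).integrable_sq_exp_sub_one hM).const_mul (e / (2 * (|L| + 1)))
    have i2 : Integrable (fun z => C * (Ioi η).indicator 1 z) (μ (1 / n)) :=
      ((integrable_const (1 : ℝ)).indicator (measurableSet_Ioi (a := η))).const_mul C
    refine (integral_mono hi.abs (i1.add i2) hC).trans_eq ?_
    rw [integral_add' i1 i2, integral_const_mul, integral_const_mul, integral_indicator_one
      measurableSet_Ioi]
  rw [dist_zero_right, Real.norm_eq_abs, abs_mul, Nat.abs_cast]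
  calc (n : ℝ) * |∫ z, D z ∂μ (1 / n)| ≤ (n : ℝ) * ∫ z, |D z| ∂μ (1 / n) :=
        mul_le_mul_of_nonneg_left abs_integral_le_integral_abs n.cast_nonneg
    _ ≤ n * (e / (2 * (|L| + 1)) * ∫ z, (Real.exp (M * z) - 1) ^ 2 ∂μ (1 / n)
      + C * (μ (1 / n)).real (Ioi η)) := mul_le_mul_of_nonneg_left h1 n.cast_nonneg
    _ = e / (2 * (|L| + 1)) * ((n : ℝ) * ∫ z, (Real.exp (M * z) - 1) ^ 2 ∂μ (1 / n))
      + C * (n * (μ (1 / n)).real (Ioi η)) := by ring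
    _ < e / (2 * (|L| + 1)) * (|L| + 1) + e / 2 := by gcongr
    _ = e := by field_simp; ring

lemma mem_interior_integrableExpSet (h : LevyLaws ℓ Ψ μ) {v : ℝ} (hv : ℓ < v ∨ 0 < v) (t : ℝ≥0) :
    v ∈ interior (integrableExpSet id (μ t)) := by
  refine mem_interior.2 ⟨Ioi ℓ ∪ Ioi 0, fun u hu => ?_, isOpen_Ioi.union isOpen_Ioi, hv⟩
  exact (h.laplace t).integrable (hu.imp id fun h => le_of_lt h)

lemma mgf_eq (h : LevyLaws ℓ Ψ μ) {v : ℝ} (hv : ℓ < v ∨ 0 < v) (t : ℝ≥0) :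
    mgf id (μ t) =ᶠ[𝓝 v] fun v => Real.exp (t * Ψ v) := by
  filter_upwards [(isOpen_Ioi.union isOpen_Ioi : IsOpen (Ioi ℓ ∪ Ioi 0)).mem_nhds hv] with u hu
  exact (h.laplace t).integral (hu.imp id fun h => le_of_lt h)

lemma differentiableAt (h : LevyLaws ℓ Ψ μ) {v : ℝ} (hv : ℓ < v ∨ 0 < v) : DifferentiableAt ℝ Ψ v := by
  have h1 := (differentiableAt_mgf (h.mem_interior_integrableExpSet hv 1)).congr_of_eventuallyEq
    (h.mgf_eq hv 1).symm
  have h2 := h1.log (Real.exp_pos _).ne'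
  simpa using h2

lemma integral_id (h : LevyLaws ℓ Ψ μ) (hℓ : ℓ < 0) (t : ℝ≥0) :
    Integrable id (μ t) ∧ ∫ x, x ∂μ t = t * deriv Ψ 0 := by
  have hi := h.mem_interior_integrableExpSet (.inl hℓ) t
  refine ⟨integrable_of_mem_interior_integrableExpSet hi, ?_⟩
  have h1 := (hasDerivAt_mgf hi).congr_of_eventuallyEq (h.mgf_eq (.inl hℓ) t).symm
  have h2 := ((h.differentiableAt (.inl hℓ)).hasDerivAt.const_mul (t : ℝ)).exp
  have h3 := h1.unique h2
  simpa [h.apply_zero] using h3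

lemma integrable_expPrim (h : LevyLaws ℓ Ψ μ) {v : ℝ} (hv : ℓ < v ∨ 0 < v) (t : ℝ≥0) :
    Integrable (expPrim v) (μ t) := by
  have := h.prob
  by_cases hv0 : v = 0
  · subst hv0
    have := (h.integral_id (hv.resolve_right (lt_irrefl _)) t).1
    exact this.congr (.of_forall fun z => (expPrim_zero_left z).symm)
  · refine ((((h.laplace t).integrable (hv.imp id fun h => le_of_lt h)).sub
      (integrable_const 1)).div_const v).congr (.of_forall fun z => (expPrim_of_ne hv0 z).symm)

/-- For v ≠ 0 the expectation is (e^{Ψ(v)/n} − 1)/v, and the limit is a derivative at 0. At v = 0,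
possible only for ℓ < 0, the primitive is z itself and the mean is exactly Ψ'(0)/n. -/
lemma tendsto_mul_integral_expPrim (h : LevyLaws ℓ Ψ μ) {v : ℝ} (hv : ℓ < v ∨ 0 < v) :
    Tendsto (fun n : ℕ => (n : ℝ) * ∫ z, expPrim v z ∂μ (1 / n)) atTop (𝓝 (ratio Ψ v)) := by
  have := h.prob
  by_cases hv0 : v = 0
  · subst hv0
    have hℓ := hv.resolve_right (lt_irrefl _)
    have h1 : ratio Ψ 0 = deriv Ψ 0 := by
      rw [ratio, if_pos rfl]
      exact (h.differentiableAt hv).derivWithin (uniqueDiffWithinAt_Ioi 0)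
    rw [h1]
    refine tendsto_const_nhds.congr' ?_
    filter_upwards [eventually_gt_atTop 0] with n hn
    have hn' : (n : ℝ) ≠ 0 := by exact_mod_cast hn.ne'
    simp_rw [expPrim_zero_left, (h.integral_id hℓ _).2]
    push_cast
    field_simp
  · rw [ratio, if_neg hv0]
    refine ((tendsto_mul_exp_sub_one (Ψ v)).div_const v).congr fun n => ?_
    have hi := (h.laplace (1 / n)).integrable (hv.imp id fun h => le_of_lt h)
    have h2 := (h.laplace (1 / n)).integral (hv.imp id fun h => le_of_lt h)
    simp_rw [expPrim_of_ne hv0]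
    rw [integral_div, integral_sub hi (integrable_const 1), h2]
    simp [mul_div_assoc]

lemma continuousAt_ratio (h : LevyLaws ℓ Ψ μ) {v : ℝ} (hv : ℓ < v ∨ 0 < v) (hv0 : v ≠ 0) :
    ContinuousAt (ratio Ψ) v := by
  refine ((h.differentiableAt hv).continuousAt.div continuousAt_id hv0).congr ?_
  filter_upwards [isOpen_ne.mem_nhds hv0] with u hu
  rw [ratio, if_neg hu]; rfl

end LevyLaws

/-! ### Compound Poisson laws -/

section CompoundPoisson

/-- Convolution powers. -/
def convPow (m : Measure ℝ) : ℕ → Measure ℝ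
  | 0 => Measure.dirac 0
  | k + 1 => (convPow m k).conv m

instance isFiniteMeasure_convPow (m : Measure ℝ) [IsFiniteMeasure m] (k : ℕ) :
    IsFiniteMeasure (convPow m k) := by
  induction k with
  | zero => unfold convPow; infer_instance
  | succ k ih => unfold convPow; infer_instance

lemma convPow_Ioi {m : Measure ℝ} [IsFiniteMeasure m] (hm : m (Ioi 0) = 0) (k : ℕ) :
    convPow m k (Ioi 0) = 0 := by
  induction k with
  | zero => simp [convPow]
  | succ k ih => exact conv_Ioi_zero ih hm

lemma lintegral_exp_convPow {m : Measure ℝ} [IsFiniteMeasure m] (u : ℝ) (k : ℕ) :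
    ∫⁻ x, ENNReal.ofReal (Real.exp (u * x)) ∂convPow m k
      = (∫⁻ x, ENNReal.ofReal (Real.exp (u * x)) ∂m) ^ k := by
  induction k with
  | zero => rw [convPow, lintegral_dirac' _ (by fun_prop)]; simp
  | succ k ih =>
    rw [convPow, Measure.lintegral_conv (by fun_prop)]
    simp_rw [mul_add, Real.exp_add, ENNReal.ofReal_mul (Real.exp_pos _).le]
    simp_rw [lintegral_const_mul' _ _ ENNReal.ofReal_ne_top,
      lintegral_mul_const'' _ (show AEMeasurable (fun x => ENNReal.ofReal (Real.exp (u * x)))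
        (convPow m k) by fun_prop), ih, pow_succ]

/-- The compound Poisson law with jump measure `m`. -/
def compoundPoisson (m : Measure ℝ) : Measure ℝ :=
  Measure.sum fun k => ENNReal.ofReal (Real.exp (-m.real univ) / k.factorial) • convPow m k

lemma compoundPoisson_Ioi {m : Measure ℝ} [IsFiniteMeasure m] (hm : m (Ioi 0) = 0) :
    compoundPoisson m (Ioi 0) = 0 := by
  rw [compoundPoisson, Measure.sum_apply _ measurableSet_Ioi]
  simp [convPow_Ioi hm]

/-- Convolution powers have transforms a^k, and the Poisson weights sum them to an exponential
series. -/
lemma hasLaplace_compoundPoisson {m : Measure ℝ} [IsFiniteMeasure m] {c : ℝ}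
    (hint : ∀ u : ℝ, (c < u ∨ 0 ≤ u) → Integrable (fun x => Real.exp (u * x)) m) :
    HasLaplace c (compoundPoisson m) (fun u => ∫ x, (Real.exp (u * x) - 1) ∂m) := fun u hu => by
  have h1 := hint u hu
  set a := ∫ x, Real.exp (u * x) ∂m with ha
  have ha0 : 0 ≤ a := integral_nonneg fun _ => (Real.exp_pos _).le
  have h2 : ∫⁻ x, ENNReal.ofReal (Real.exp (u * x)) ∂m = ENNReal.ofReal a :=
    (ofReal_integral_eq_lintegral_ofReal h1 (.of_forall fun _ => (Real.exp_pos _).le)).symm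
  have hs : HasSum (fun k : ℕ => Real.exp (-m.real univ) / k.factorial * a ^ k)
      (Real.exp (-m.real univ) * Real.exp a) := by
    have := (NormedSpace.expSeries_div_hasSum_exp a).mul_left (Real.exp (-m.real univ))
    rw [← Real.exp_eq_exp_ℝ] at this
    refine this.congr_fun fun k => ?_
    ring
  rw [compoundPoisson, lintegral_sum_measure]
  simp_rw [lintegral_smul_measure, lintegral_exp_convPow, h2, smul_eq_mul,
    ← ENNReal.ofReal_pow ha0]
  have h3 : ∀ k : ℕ, ENNReal.ofReal (Real.exp (-m.real univ) / k.factorial) * ENNReal.ofReal (a ^ k)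
      = ENNReal.ofReal (Real.exp (-m.real univ) / k.factorial * a ^ k) := fun k =>
    (ENNReal.ofReal_mul (by positivity)).symm
  simp_rw [h3]
  rw [← ENNReal.ofReal_tsum_of_nonneg (fun k => by positivity) hs.summable, hs.tsum_eq,
    ← Real.exp_add, integral_sub h1 (integrable_const 1)]
  congr 2
  simp
  ring

end CompoundPoisson

/-! ### Exponents of laws on the negative half-line -/

/-- `t * f` is, for every `t ≥ 0`, the Laplace exponent of a law on `(-∞, 0]`. -/
def IsSubExponent (c : ℝ) (f : ℝ → ℝ) : Prop :=
  ∀ t : ℝ≥0, ∃ ν : Measure ℝ, IsProbabilityMeasure ν ∧ ν (Ioi 0) = 0 ∧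
    HasLaplace c ν (fun u => t * f u)

namespace IsSubExponent

variable {c : ℝ} {f g : ℝ → ℝ}

lemma mono {c' : ℝ} (h : IsSubExponent c f) (hc : c ≤ c') : IsSubExponent c' f := fun t => by
  obtain ⟨ν, h1, h2, h3⟩ := h t
  exact ⟨ν, h1, h2, h3.mono hc⟩

lemma congr (h : IsSubExponent c f) (hfg : ∀ u, (c < u ∨ 0 ≤ u) → f u = g u) :
    IsSubExponent c g := fun t => by
  obtain ⟨ν, h1, h2, h3⟩ := h t
  exact ⟨ν, h1, h2, h3.congr fun u hu => by rw [hfg u hu]⟩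

lemma add (hf : IsSubExponent c f) (hg : IsSubExponent c g) :
    IsSubExponent c (fun u => f u + g u) := fun t => by
  obtain ⟨ν, h1, h2, h3⟩ := hf t
  obtain ⟨ν', h1', h2', h3'⟩ := hg t
  exact ⟨ν.conv ν', inferInstance, conv_Ioi_zero h2 h2', (h3.conv h3').congr fun u _ => by ring⟩

lemma const_mul (hf : IsSubExponent c f) {b : ℝ} (hb : 0 ≤ b) :
    IsSubExponent c (fun u => b * f u) := fun t => by
  obtain ⟨ν, h1, h2, h3⟩ := hf (t * b.toNNReal)
  refine ⟨ν, h1, h2, h3.congr fun u _ => ?_⟩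
  rw [NNReal.coe_mul, Real.coe_toNNReal _ hb, mul_assoc]

lemma drift (c : ℝ) {s : ℝ} (hs : 0 ≤ s) : IsSubExponent c (fun u => -(u * s)) := fun t =>
  ⟨Measure.dirac (-(t * s)), inferInstance, by
    have : 0 ≤ t * s := by positivity
    rw [Measure.dirac_apply' _ measurableSet_Ioi]
    simpa using this, (hasLaplace_dirac c _).congr fun u _ => by ring⟩

lemma of_tendsto {f : ℕ → ℝ → ℝ} (h : ∀ n, IsSubExponent c (f n))
    (hlim : ∀ u, (c < u ∨ 0 ≤ u) → Tendsto (fun n => f n u) atTop (𝓝 (g u)))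
    (h0 : Tendsto g (𝓝[>] 0) (𝓝 0)) : IsSubExponent c g := fun t => by
  choose ν h1 h2 h3 using fun n => h n t
  refine exists_hasLaplace_of_tendsto h2 h3 (fun u hu => (hlim u hu).const_mul _) ?_
  simpa using h0.const_mul (t : ℝ)

lemma of_measure {m : Measure ℝ} [IsFiniteMeasure m] (hm : m (Ioi 0) = 0)
    (hint : ∀ u : ℝ, (c < u ∨ 0 ≤ u) → Integrable (fun x => Real.exp (u * x)) m) :
    IsSubExponent c (fun u => ∫ x, (Real.exp (u * x) - 1) ∂m) := fun t => by
  have h1 := hasLaplace_compoundPoisson (m := t • m) (c := c)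
    (fun u hu => (hint u hu).smul_measure_nnreal)
  refine ⟨compoundPoisson (t • m), ⟨?_⟩, compoundPoisson_Ioi (by simp [hm]),
    h1.congr fun u _ => by rw [integral_smul_nnreal_measure]; rfl⟩
  have h2 := h1 0 (.inr le_rfl)
  simpa using h2

end IsSubExponent

/-! ### Integration against the tail of a jump measure -/

section Tail

/-- The measure `b e^{βx} Λ(-∞, x) dx` on the negative half-line. -/
def tailMeasure (b β : ℝ) (Lam : Measure ℝ) : Measure ℝ :=
  (volume.restrict (Iio 0)).withDensity
    (fun x => ENNReal.ofReal (b * Real.exp (β * x)) * Lam (Iio x))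

lemma measurable_measure_Iio (Lam : Measure ℝ) : Measurable fun x => Lam (Iio x) :=
  Monotone.measurable fun _ _ h => measure_mono (Iio_subset_Iio h)

lemma measurable_tail_density (b β : ℝ) (Lam : Measure ℝ) :
    Measurable fun x => ENNReal.ofReal (b * Real.exp (β * x)) * Lam (Iio x) :=
  Measurable.mul (by fun_prop) (measurable_measure_Iio Lam)

lemma tailMeasure_Ici (b β : ℝ) (Lam : Measure ℝ) : tailMeasure b β Lam (Ici 0) = 0 := by
  refine withDensity_absolutelyContinuous _ _ ?_
  rw [Measure.restrict_apply measurableSet_Ici, Ici_inter_Iio, Ico_self, measure_empty]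

/-- Tonelli, with Λ(−∞,y) written as the integral of the indicator of x < y. -/
lemma lintegral_tailMeasure (b β : ℝ) (Lam : Measure ℝ) [SFinite Lam] {g : ℝ → ℝ≥0∞}
    (hg : Measurable g) :
    ∫⁻ y, g y ∂tailMeasure b β Lam
      = ∫⁻ x, (∫⁻ y in Ioo x 0, g y * ENNReal.ofReal (b * Real.exp (β * y))) ∂Lam := by
  rw [tailMeasure, lintegral_withDensity_eq_lintegral_mul _ (measurable_tail_density b β Lam) hg]
  have h1 : ∀ y, ((fun x => ENNReal.ofReal (b * Real.exp (β * x)) * Lam (Iio x)) * g) y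
      = ∫⁻ x, {p : ℝ × ℝ | p.2 < p.1}.indicator
        (fun p => g p.1 * ENNReal.ofReal (b * Real.exp (β * p.1))) (y, x) ∂Lam := fun y => by
    have : ∀ x, {p : ℝ × ℝ | p.2 < p.1}.indicator
        (fun p => g p.1 * ENNReal.ofReal (b * Real.exp (β * p.1))) (y, x)
        = (Iio y).indicator (fun _ => g y * ENNReal.ofReal (b * Real.exp (β * y))) x := fun x => rfl
    simp_rw [this]
    rw [lintegral_indicator_const measurableSet_Iio, Pi.mul_apply]
    ring
  simp_rw [h1]
  rw [lintegral_lintegral_swap]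
  · refine lintegral_congr fun x => ?_
    have : ∀ y, {p : ℝ × ℝ | p.2 < p.1}.indicator
        (fun p => g p.1 * ENNReal.ofReal (b * Real.exp (β * p.1))) (y, x)
        = (Ioi x).indicator (fun y => g y * ENNReal.ofReal (b * Real.exp (β * y))) y := fun y => rfl
    simp_rw [this]
    rw [lintegral_indicator measurableSet_Ioi, Measure.restrict_restrict measurableSet_Ioi,
      Ioi_inter_Iio]
  · refine Measurable.aemeasurable ?_
    exact Measurable.indicator (f := fun p : ℝ × ℝ => g p.1 * ENNReal.ofReal (b * Real.exp (β * p.1)))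
      (by fun_prop) (measurableSet_lt measurable_snd measurable_fst)

lemma integral_tailMeasure {b β : ℝ} (hb : 0 ≤ b) (Lam : Measure ℝ) [SFinite Lam] {k : ℝ → ℝ}
    (hk : Continuous k) (hk0 : ∀ y < 0, 0 ≤ k y)
    (hi : Integrable (fun x => ∫ y in Ioo x 0, k y * (b * Real.exp (β * y))) Lam) :
    Integrable k (tailMeasure b β Lam) ∧
      ∫ y, k y ∂tailMeasure b β Lam = ∫ x, (∫ y in Ioo x 0, k y * (b * Real.exp (β * y))) ∂Lam := by
  have hae : ∀ᵐ y ∂tailMeasure b β Lam, 0 ≤ k y := by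
    rw [ae_iff]
    refine measure_mono_null (fun y hy => ?_) (tailMeasure_Ici b β Lam)
    by_contra h
    exact hy (hk0 y (not_le.1 h))
  have hq0 : ∀ x, 0 ≤ ∫ y in Ioo x 0, k y * (b * Real.exp (β * y)) := fun x =>
    setIntegral_nonneg measurableSet_Ioo fun y hy =>
      mul_nonneg (hk0 y hy.2) (mul_nonneg hb (Real.exp_pos _).le)
  have h1 : ∫⁻ y, ENNReal.ofReal (k y) ∂tailMeasure b β Lam
      = ENNReal.ofReal (∫ x, (∫ y in Ioo x 0, k y * (b * Real.exp (β * y))) ∂Lam) := by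
    rw [lintegral_tailMeasure b β Lam (by fun_prop),
      ofReal_integral_eq_lintegral_ofReal hi (.of_forall hq0)]
    refine lintegral_congr fun x => ?_
    rw [ofReal_integral_eq_lintegral_ofReal]
    · refine setLIntegral_congr_fun measurableSet_Ioo fun y hy => ?_
      exact (ENNReal.ofReal_mul (hk0 y hy.2)).symm
    · exact (Continuous.integrableOn_Icc (by fun_prop)).mono_set Ioo_subset_Icc_self
    · exact ae_restrict_of_forall_mem measurableSet_Ioo fun y hy =>
        mul_nonneg (hk0 y hy.2) (mul_nonneg hb (Real.exp_pos _).le)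
  refine ⟨(lintegral_ofReal_ne_top_iff_integrable hk.aestronglyMeasurable hae).1 (by simp [h1]), ?_⟩
  rw [integral_eq_lintegral_of_nonneg_ae hae hk.aestronglyMeasurable, h1,
    ENNReal.toReal_ofReal (integral_nonneg hq0)]

lemma setIntegral_exp_sub_one (u b β x : ℝ) :
    ∫ y in Ioo x 0, (Real.exp (u * y) - 1) * (b * Real.exp (β * y))
      = -(b * (expPrim (u + β) (min x 0) - expPrim β (min x 0))) := by
  rw [expPrim_sub]
  rcases le_total x 0 with hx | hx
  · rw [min_eq_left hx, intervalIntegral.integral_symm, intervalIntegral.integral_of_le hx,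
      integral_Ioc_eq_integral_Ioo, mul_neg, neg_neg, ← integral_const_mul]
    congr 1
    ext y
    ring
  · rw [min_eq_right hx, Ioo_eq_empty (not_lt.2 hx)]
    simp

lemma integral_exp_sub_one_tailMeasure {u b β : ℝ} (hb : 0 ≤ b) (Lam : Measure ℝ) [SFinite Lam]
    (hi : Integrable (fun x => expPrim (u + β) (min x 0) - expPrim β (min x 0)) Lam) :
    Integrable (fun y => Real.exp (u * y) - 1) (tailMeasure b β Lam) ∧
      ∫ y, (Real.exp (u * y) - 1) ∂tailMeasure b β Lam
        = -(b * ∫ x, (expPrim (u + β) (min x 0) - expPrim β (min x 0)) ∂Lam) := by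
  have h0 : Integrable (fun x => ∫ y in Ioo x 0, (Real.exp (u * y) - 1) * (b * Real.exp (β * y))) Lam := by
    simp_rw [setIntegral_exp_sub_one]
    exact (hi.const_mul b).neg
  have h1 : ∫ x, (∫ y in Ioo x 0, (Real.exp (u * y) - 1) * (b * Real.exp (β * y))) ∂Lam
      = -(b * ∫ x, (expPrim (u + β) (min x 0) - expPrim β (min x 0)) ∂Lam) := by
    simp_rw [setIntegral_exp_sub_one, integral_neg, integral_const_mul]
  rw [← h1]
  -- On y < 0 the function e^{uy} − 1 has a constant sign, decided by u; up to this sign the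
  -- nonnegative case applies.
  rcases le_total u 0 with hu | hu
  · exact integral_tailMeasure hb Lam (by fun_prop) (fun y hy => by
      have : 0 ≤ u * y := mul_nonneg_of_nonpos_of_nonpos hu hy.le
      linarith [Real.one_le_exp this]) h0
  · have h2 := integral_tailMeasure (k := fun y => -(Real.exp (u * y) - 1)) (β := β) hb Lam
      (by fun_prop) (fun y hy => by
        have : u * y ≤ 0 := mul_nonpos_of_nonneg_of_nonpos hu hy.le
        linarith [Real.exp_le_one_iff.2 this]) (by
        simp_rw [neg_mul, integral_neg]; exact h0.neg)
    refine ⟨h2.1.neg.congr (.of_forall fun y => by simp), ?_⟩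
    have h3 := h2.2
    simp_rw [neg_mul, integral_neg] at h3
    exact neg_injective h3

lemma isFiniteMeasure_tailMeasure {b β : ℝ} (hb : 0 ≤ b) (hβ : 0 < β) (Lam : Measure ℝ)
    [IsFiniteMeasure Lam] : IsFiniteMeasure (tailMeasure b β Lam) := by
  refine ⟨?_⟩
  rw [tailMeasure, withDensity_apply _ MeasurableSet.univ, Measure.restrict_univ]
  have h1 : ∫⁻ y in Iio 0, ENNReal.ofReal (b * Real.exp (β * y)) < ∞ := by
    have h2 : IntegrableOn (fun y => b * Real.exp (β * y)) (Iio 0) :=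
      ((integrableOn_exp_mul_Iic hβ 0).mono_set Iio_subset_Iic_self).const_mul b
    rw [← ofReal_integral_eq_lintegral_ofReal h2
      (.of_forall fun y => mul_nonneg hb (Real.exp_pos _).le)]
    exact ENNReal.ofReal_lt_top
  calc _ ≤ ∫⁻ y in Iio 0, ENNReal.ofReal (b * Real.exp (β * y)) * Lam univ :=
        lintegral_mono fun y => mul_le_mul_right (measure_mono (subset_univ _)) _
    _ = (∫⁻ y in Iio 0, ENNReal.ofReal (b * Real.exp (β * y))) * Lam univ :=
        lintegral_mul_const _ (by fun_prop)
    _ < ∞ := ENNReal.mul_lt_top h1 (measure_lt_top _ _)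

end Tail

/-! ### The jump measure created by killing -/

section ExpMeasure

/-- The measure `b e^{βx} dx` on the negative half-line. -/
def expMeasure (b β : ℝ) : Measure ℝ :=
  (volume.restrict (Iio 0)).withDensity (fun x => ENNReal.ofReal (b * Real.exp (β * x)))

lemma expMeasure_Ici (b β : ℝ) : expMeasure b β (Ici 0) = 0 := by
  refine withDensity_absolutelyContinuous _ _ ?_
  rw [Measure.restrict_apply measurableSet_Ici, Ici_inter_Iio, Ico_self, measure_empty]

lemma integral_exp_expMeasure {b β u : ℝ} (hb : 0 ≤ b) (hu : 0 < u + β) :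
    Integrable (fun y => Real.exp (u * y)) (expMeasure b β) ∧
      ∫ y, Real.exp (u * y) ∂expMeasure b β = b / (u + β) := by
  refine integrable_of_lintegral_eq (by fun_prop) (fun _ => (Real.exp_pos _).le) (by positivity) ?_
  rw [expMeasure, lintegral_withDensity_eq_lintegral_mul _ (by fun_prop) (by fun_prop)]
  have h1 : ∀ y, ((fun x => ENNReal.ofReal (b * Real.exp (β * x)))
      * fun y => ENNReal.ofReal (Real.exp (u * y))) y
      = ENNReal.ofReal (b * Real.exp ((u + β) * y)) := fun y => by
    rw [Pi.mul_apply, ← ENNReal.ofReal_mul (by positivity), mul_assoc, ← Real.exp_add]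
    ring_nf
  simp_rw [h1]
  rw [← ofReal_integral_eq_lintegral_ofReal
    (((integrableOn_exp_mul_Iic hu 0).mono_set Iio_subset_Iic_self).const_mul b)
    (.of_forall fun y => by positivity), integral_const_mul, ← integral_Iic_eq_integral_Iio,
    integral_exp_mul_Iic hu]
  simp [div_eq_mul_inv]

lemma isFiniteMeasure_expMeasure {b β : ℝ} (hb : 0 ≤ b) (hβ : 0 < β) :
    IsFiniteMeasure (expMeasure b β) := by
  have := (integral_exp_expMeasure (u := 0) hb (by simpa using hβ)).1
  simp only [zero_mul, Real.exp_zero] at this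
  exact (integrable_const_iff_isFiniteMeasure one_ne_zero).1 this

lemma integral_exp_sub_one_expMeasure {b β u : ℝ} (hb : 0 ≤ b) (hβ : 0 < β) (hu : 0 < u + β) :
    ∫ y, (Real.exp (u * y) - 1) ∂expMeasure b β = b * (1 / (u + β) - 1 / β) := by
  have := isFiniteMeasure_expMeasure hb hβ
  have h0 := integral_exp_expMeasure (u := 0) hb (by simpa using hβ)
  have h1 := integral_exp_expMeasure hb hu
  simp only [zero_mul, Real.exp_zero, zero_add] at h0
  rw [integral_sub h1.1 h0.1, h1.2, h0.2]
  ring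

/-- Killing contributes an exponential jump measure. -/
lemma isSubExponent_inv_sub_inv {β : ℝ} (hβ : 0 < β) :
    IsSubExponent (-β) (fun u => 1 / (u + β) - 1 / β) := by
  have := isFiniteMeasure_expMeasure zero_le_one hβ
  have hu : ∀ u : ℝ, (-β < u ∨ 0 ≤ u) → 0 < u + β := by
    rintro u (hu | hu) <;> linarith
  refine (IsSubExponent.of_measure (measure_mono_null Ioi_subset_Ici_self (expMeasure_Ici 1 β))
    fun u h => (integral_exp_expMeasure zero_le_one (hu u h)).1).congr fun u h => ?_
  rw [integral_exp_sub_one_expMeasure zero_le_one hβ (hu u h), one_mul]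

end ExpMeasure

/-! ### The subordinator part of the transform -/

namespace LevyLaws

variable {ℓ : ℝ} {Ψ : ℝ → ℝ} {μ : ℝ≥0 → Measure ℝ}

lemma integrable_expPrim_min (h : LevyLaws ℓ Ψ μ) {v : ℝ} (hv : ℓ < v ∨ 0 < v) (t : ℝ≥0) :
    Integrable (fun x => expPrim v (min x 0)) (μ t) := by
  refine ((h.integrable_expPrim hv t).indicator (measurableSet_Iic (a := (0 : ℝ)))).congr
    (.of_forall fun x => ?_)
  by_cases hx : x ≤ 0
  · rw [indicator_of_mem (show x ∈ Iic 0 from hx)]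
    simp only [min_eq_left hx]
  · rw [indicator_of_notMem (show x ∉ Iic 0 from hx)]
    simp only [min_eq_right (not_le.1 hx).le, expPrim_zero_right]

lemma expPrim_add_min_max (v x : ℝ) : expPrim v (max x 0) = expPrim v x - expPrim v (min x 0) := by
  rcases le_total x 0 with hx | hx
  · rw [max_eq_right hx, min_eq_left hx, expPrim_zero_right, sub_self]
  · rw [max_eq_left hx, min_eq_right hx, expPrim_zero_right, sub_zero]

/-- Half the truncated second moment of the positive part. -/
def posVar (ν : Measure ℝ) : ℝ := 1 / 2 * ∫ z, (min (max z 0) 1) ^ 2 ∂ν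

lemma posVar_nonneg (ν : Measure ℝ) : 0 ≤ posVar ν :=
  mul_nonneg (by norm_num) (integral_nonneg fun _ => sq_nonneg _)

/-- The target is the limit of −n E[expPrim (u+β) X − expPrim β X] with X = X_{1/n}. The negative
part of X gives exactly a compound Poisson exponent with the tail density. The positive part is
replaced by the drift −(u/2) n E[(X⁺ ∧ 1)²], whose sign is admissible; the drift itself need not be
shown to converge, since only the sum is required to. -/
theorem isSubExponent_ratio (h : LevyLaws ℓ Ψ μ) {β : ℝ} (hβ : 0 < β) :
    IsSubExponent (ℓ - β) (fun u => -(ratio Ψ (u + β) - ratio Ψ β)) := by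
  have := h.prob
  have hdom : ∀ u : ℝ, (ℓ - β < u ∨ 0 ≤ u) → (ℓ < u + β ∨ 0 < u + β) := by
    rintro u (hu | hu)
    · left; linarith
    · right; linarith
  have hfin : ∀ n : ℕ, IsFiniteMeasure (tailMeasure n β (μ (1 / n))) := fun n =>
    isFiniteMeasure_tailMeasure n.cast_nonneg hβ _
  have hint : ∀ (n : ℕ) (u : ℝ), (ℓ - β < u ∨ 0 ≤ u) →
      Integrable (fun y => Real.exp (u * y) - 1) (tailMeasure n β (μ (1 / n))) ∧
      ∫ y, (Real.exp (u * y) - 1) ∂tailMeasure n β (μ (1 / n))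
        = -(n * ∫ x, (expPrim (u + β) (min x 0) - expPrim β (min x 0)) ∂μ (1 / n)) := fun n u hu =>
    integral_exp_sub_one_tailMeasure n.cast_nonneg _
      ((h.integrable_expPrim_min (hdom u hu) _).sub (h.integrable_expPrim_min (.inr hβ) _))
  refine IsSubExponent.of_tendsto (f := fun n u =>
    ∫ y, (Real.exp (u * y) - 1) ∂tailMeasure n β (μ (1 / n)) + -(u * (n * posVar (μ (1 / n)))))
    (fun n => ?_) (fun u hu => ?_) ?_
  · refine (IsSubExponent.of_measure (measure_mono_null Ioi_subset_Ici_self (tailMeasure_Ici _ _ _))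
      fun u hu => ?_).add (IsSubExponent.drift _ (mul_nonneg n.cast_nonneg (posVar_nonneg _)))
    refine ((hint n u hu).1.add (integrable_const 1)).congr (.of_forall fun y => ?_)
    simp
  · obtain ⟨M, hM⟩ : ∃ M, M = |u + β| + |β| + 1 := ⟨_, rfl⟩
    have hM0 : 0 ≤ M := by rw [hM]; positivity
    -- The error made by replacing the positive part with a drift.
    have h1 := h.tendsto_mul_integral_zero (D := fun z =>
      (expPrim (u + β) (max z 0) - expPrim β (max z 0)) - u / 2 * (min (max z 0) 1) ^ 2)
      (Continuous.measurable (by fun_prop)) hM0 (fun ε hε => by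
        rw [hM]; exact expPrim_sub_bound u hε)
    have h2 := (h1.sub (h.tendsto_mul_integral_expPrim (hdom u hu))).add
      (h.tendsto_mul_integral_expPrim (.inr hβ))
    rw [show -(ratio Ψ (u + β) - ratio Ψ β) = 0 - ratio Ψ (u + β) + ratio Ψ β by ring]
    refine h2.congr fun n => ?_
    have i1 := h.integrable_expPrim (hdom u hu) (1 / n)
    have i2 := h.integrable_expPrim (v := β) (.inr hβ) (1 / n)
    have i3 := h.integrable_expPrim_min (hdom u hu) (1 / n)
    have i4 := h.integrable_expPrim_min (v := β) (.inr hβ) (1 / n)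
    have i5 : Integrable (fun z : ℝ => (min (max z 0) 1) ^ 2) (μ (1 / n)) :=
      Integrable.of_bound (by fun_prop) 1 (.of_forall fun z => by
        rw [Real.norm_eq_abs, abs_of_nonneg (sq_nonneg _)]
        exact pow_le_one₀ (by positivity) (min_le_right _ _))
    rw [(hint n u hu).2, integral_sub i3 i4]
    have h3 : ∫ z, ((expPrim (u + β) (max z 0) - expPrim β (max z 0))
        - u / 2 * (min (max z 0) 1) ^ 2) ∂μ (1 / n)
        = (∫ z, expPrim (u + β) z ∂μ (1 / n)) - (∫ z, expPrim (u + β) (min z 0) ∂μ (1 / n))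
          - ((∫ z, expPrim β z ∂μ (1 / n)) - (∫ z, expPrim β (min z 0) ∂μ (1 / n)))
          - u / 2 * ∫ z, (min (max z 0) 1) ^ 2 ∂μ (1 / n) := by
      simp_rw [expPrim_add_min_max]
      have i6 : Integrable (fun z => expPrim (u + β) z - expPrim (u + β) (min z 0)) (μ (1 / n)) :=
        i1.sub i3
      have i7 : Integrable (fun z => expPrim β z - expPrim β (min z 0)) (μ (1 / n)) := i2.sub i4
      have i8 : Integrable (fun z => expPrim (u + β) z - expPrim (u + β) (min z 0)
        - (expPrim β z - expPrim β (min z 0))) (μ (1 / n)) := i6.sub i7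
      rw [integral_sub i8 (i5.const_mul _), integral_sub i6 i7,
        integral_sub i1 i3, integral_sub i2 i4, integral_const_mul]
    rw [h3, posVar]
    ring
  -- Vanishing of the limit exponent at 0+, which ensures that no mass escapes to −∞.
  · have hc := h.continuousAt_ratio (v := β) (.inr hβ) hβ.ne'
    have h1 : Tendsto (fun u => u + β) (𝓝[>] (0 : ℝ)) (𝓝 β) := by
      have : Tendsto (fun u : ℝ => u + β) (𝓝 0) (𝓝 (0 + β)) := tendsto_id.add_const β
      rw [zero_add] at this
      exact this.mono_left nhdsWithin_le_nhds
    have h2 := ((hc.tendsto.comp h1).sub_const (ratio Ψ β)).neg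
    simpa using h2

/-- The case without tilting. -/
theorem isSubExponent_ratio_zero (h : LevyLaws ℓ Ψ μ) (hder : HasDerivWithinAt Ψ 0 (Ioi 0) 0) :
    IsSubExponent ℓ (fun u => -(ratio Ψ u)) := by
  have h0 : ratio Ψ 0 = 0 := by
    rw [ratio, if_pos rfl]
    exact hder.derivWithin (uniqueDiffWithinAt_Ioi 0)
  have hlim : Tendsto (ratio Ψ) (𝓝[>] 0) (𝓝 0) := by
    have h1 := (hasDerivWithinAt_iff_tendsto_slope' (s := Ioi (0 : ℝ)) (by simp)).1 hder
    refine h1.congr' ?_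
    filter_upwards [self_mem_nhdsWithin] with u (hu : 0 < u)
    rw [ratio, if_neg hu.ne', slope_def_field, h.apply_zero]
    simp
  have hk : Tendsto (fun n : ℕ => 1 / ((n : ℝ) + 1)) atTop (𝓝[>] 0) :=
    tendsto_nhdsWithin_iff.2 ⟨tendsto_one_div_add_atTop_nhds_zero_nat, .of_forall fun n => by
      simp only [mem_Ioi]; positivity⟩
  -- Tilt by β = 1/(n+1) and let it tend to 0; the constant `ratio Ψ (1/(n+1))` disappears because
  -- Ψ'(0+) = 0.
  refine IsSubExponent.of_tendsto (f := fun n u =>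
    -(ratio Ψ (u + 1 / ((n : ℝ) + 1)) - ratio Ψ (1 / ((n : ℝ) + 1)))) (fun n => ?_) (fun u hu => ?_) ?_
  · have hn : (0 : ℝ) < 1 / ((n : ℝ) + 1) := by positivity
    exact (h.isSubExponent_ratio hn).mono (by linarith)
  · have h2 := hlim.comp hk
    have h1 : Tendsto (fun n : ℕ => ratio Ψ (u + 1 / ((n : ℝ) + 1))) atTop (𝓝 (ratio Ψ u)) := by
      by_cases hu0 : u = 0
      · subst hu0
        rw [h0]
        simpa [Function.comp_def] using h2
      · have hu' : ℓ < u ∨ 0 < u := hu.imp id fun h => lt_of_le_of_ne h (Ne.symm hu0)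
        refine (h.continuousAt_ratio hu' hu0).tendsto.comp ?_
        have := (tendsto_nhdsWithin_iff.1 hk).1.const_add u
        rwa [add_zero] at this
    simpa using (h1.sub h2).neg
  · simpa using hlim.neg

end LevyLaws

/-! ### Exponential tilting and the transformed process -/

lemma HasLaplace.tilted {c β : ℝ} {ν : Measure ℝ} {f : ℝ → ℝ} (h : HasLaplace c ν f)
    (hβ : c < β ∨ 0 ≤ β) (hβ0 : 0 ≤ β) :
    HasLaplace (c - β) (ν.tilted (fun x => β * x)) (fun u => f (u + β) - f β) := fun u hu => by
  have hu' : c < u + β ∨ 0 ≤ u + β := hu.imp (fun h => by linarith) fun h => by linarith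
  rw [lintegral_tilted, h.integral hβ]
  have h1 : ∀ x, ENNReal.ofReal (Real.exp (β * x) / Real.exp (f β)) * ENNReal.ofReal (Real.exp (u * x))
      = ENNReal.ofReal (Real.exp (-f β)) * ENNReal.ofReal (Real.exp ((u + β) * x)) := fun x => by
    rw [← ENNReal.ofReal_mul (by positivity), ← ENNReal.ofReal_mul (by positivity), ← Real.exp_sub,
      ← Real.exp_add, ← Real.exp_add]
    ring_nf
  simp_rw [h1]
  rw [lintegral_const_mul' _ _ ENNReal.ofReal_ne_top, h _ hu', ← ENNReal.ofReal_mul (by positivity),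
    ← Real.exp_add]
  ring_nf

lemma exp_indicator_bound {β ε e : ℝ} (he : 0 < e) (hε : 0 < ε) : ∃ η > 0, ∃ C, ∀ z : ℝ,
    |(Ioi ε).indicator (fun z => Real.exp (β * z)) z|
      ≤ e * (Real.exp (|β| * z) - 1) ^ 2 + C * (Ioi η).indicator 1 z := by
  refine ⟨ε, hε, 1 + 1 ^ 2 / (4 * e), fun z => ?_⟩
  by_cases hz : ε < z
  · rw [indicator_of_mem (show z ∈ Ioi ε from hz), indicator_of_mem (show z ∈ Ioi ε from hz),
      Pi.one_apply, mul_one, Real.abs_exp]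
    refine le_trans ?_ (mul_exp_le he)
    rw [one_mul, Real.exp_le_exp]
    exact mul_le_mul_of_nonneg_right (le_abs_self _) (hε.trans hz).le
  · rw [indicator_of_notMem (show z ∉ Ioi ε from hz), indicator_of_notMem (show z ∉ Ioi ε from hz)]
    simp only [abs_zero, mul_zero, add_zero]
    positivity

/-- The function e^{βz} on {z > ε} vanishes near 0 and grows at most exponentially, so it does not
contribute in the limit; the normalisation e^{-Ψ(β)/n} tends to 1. -/
lemma LevyLaws.tendsto_tilted {ℓ β : ℝ} {Ψ : ℝ → ℝ} {μ : ℝ≥0 → Measure ℝ} (h : LevyLaws ℓ Ψ μ)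
    (hβ : 0 ≤ β) {ε : ℝ} (hε : 0 < ε) :
    Tendsto (fun n : ℕ => n * ((μ (1 / n)).tilted (fun x => β * x)) (Ioi ε)) atTop (𝓝 0) := by
  have h1 := h.tendsto_mul_integral_zero
    (D := (Ioi ε).indicator (fun z => Real.exp (β * z)))
    (Measurable.indicator (by fun_prop) measurableSet_Ioi) (abs_nonneg β)
    (fun e he => exp_indicator_bound he hε)
  have h2 : Tendsto (fun n : ℕ => Real.exp (-(((1 / n : ℝ≥0) : ℝ) * Ψ β))) atTop (𝓝 1) := by
    have h3 : Tendsto (fun n : ℕ => ((1 / n : ℝ≥0) : ℝ)) atTop (𝓝 0) := by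
      simpa using tendsto_one_div_atTop_nhds_zero_nat (𝕜 := ℝ)
    have h4 : Continuous fun x : ℝ => Real.exp (-(x * Ψ β)) := by fun_prop
    have := (h4.tendsto 0).comp h3
    simpa [Function.comp_def] using this
  have h5 := ENNReal.tendsto_ofReal (h2.mul h1)
  rw [mul_zero, ENNReal.ofReal_zero] at h5
  refine h5.congr fun n => ?_
  rw [tilted_apply_eq_ofReal_integral' _ measurableSet_Ioi, (h.laplace _).integral (.inr hβ),
    integral_indicator measurableSet_Ioi, integral_div, ← ENNReal.ofReal_natCast n,
    ← ENNReal.ofReal_mul n.cast_nonneg, Real.exp_neg]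
  congr 1
  ring

/-- Adding an independent nonpositive variable cannot help to exceed ε. -/
lemma conv_Ioi_le {μ ν : Measure ℝ} [SFinite μ] [IsProbabilityMeasure ν] (hν : ν (Ioi 0) = 0) (ε : ℝ) :
    (μ.conv ν) (Ioi ε) ≤ μ (Ioi ε) := by
  rw [Measure.conv, Measure.map_apply (by fun_prop) measurableSet_Ioi]
  refine (measure_mono (t := (Ioi ε ×ˢ univ) ∪ (univ ×ˢ Ioi 0)) ?_).trans ?_
  · rintro ⟨x, y⟩ h
    simp only [mem_preimage, mem_Ioi] at h
    simp only [mem_union, mem_prod, mem_Ioi, mem_univ, and_true, true_and]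
    by_contra! hh
    linarith
  · refine (measure_union_le _ _).trans ?_
    simp [Measure.prod_prod, hν]

/-- Tilting the laws and convolving with laws on the negative half-line. -/
theorem LevyLaws.isLaplaceExponent_tilted_add {ℓ β : ℝ} {Ψ f : ℝ → ℝ} {μ : ℝ≥0 → Measure ℝ}
    (h : LevyLaws ℓ Ψ μ) (hβ : 0 ≤ β) (hf : IsSubExponent (ℓ - β) f) :
    IsLaplaceExponent (ℓ - β) 0 (fun u => (Ψ (u + β) - Ψ β) + f u) := by
  have := h.prob
  choose ν h1 h2 h3 using hf
  have hp : ∀ t, IsProbabilityMeasure ((μ t).tilted (fun x => β * x)) := fun t =>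
    isProbabilityMeasure_tilted ((h.laplace t).integrable (.inr hβ))
  refine isLaplaceExponent_of_laws (μ := fun t => ((μ t).tilted (fun x => β * x)).conv (ν t))
    (fun t => ?_) fun ε hε => ?_
  · refine ((((h.laplace t).tilted (.inr hβ) hβ)).conv (h3 t)).congr fun u _ => ?_
    ring
  -- The limit along n is needed only along n = 2^k.
  · have h4 := (h.tendsto_tilted hβ hε).comp
      (tendsto_pow_atTop_atTop_of_one_lt (r := 2) one_lt_two : Tendsto (fun k : ℕ => 2 ^ k) atTop atTop)
    refine tendsto_of_tendsto_of_tendsto_of_le_of_le tendsto_const_nhds h4 (fun _ => bot_le) fun k => ?_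
    simp only [Function.comp_apply, Nat.cast_pow, Nat.cast_ofNat]
    exact mul_le_mul_right
      (conv_Ioi_le (μ := (μ (1 / 2 ^ k)).tilted fun x => β * x) (h2 (1 / 2 ^ k)) ε) _

/-! ### The transform maps exponents to exponents -/

lemma ratioTerm_eq (δ : ℝ) (ψ : ℝ → ℝ) (v : ℝ) : ratioTerm δ ψ v = ψ v - δ * ratio ψ v := by
  rw [ratioTerm, ratio]
  split_ifs with hv
  · rw [hv]
  · field_simp

lemma T_eq (δ β : ℝ) (ψ : ℝ → ℝ) (u : ℝ) :
    T δ β ψ u = (ψ (u + β) - ψ β) + δ * -(ratio ψ (u + β) - ratio ψ β) := by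
  rw [T, ratioTerm_eq, ratioTerm_eq]
  ring

lemma IsLaplaceExponent.congr {c κ : ℝ} {f g : ℝ → ℝ} (h : IsLaplaceExponent c κ f)
    (hfg : ∀ u, (c < u ∨ 0 ≤ u) → f u = g u) : IsLaplaceExponent c κ g := by
  obtain ⟨Ω, mΩ, P, hP, X, ζ, hX, hζ, h⟩ := h
  exact ⟨Ω, mΩ, P, hP, X, ζ, hX, hζ, fun u hu t => by rw [← hfg u hu]; exact h u hu t⟩

lemma IsLaplaceExponent.mono {c c' κ : ℝ} {f : ℝ → ℝ} (h : IsLaplaceExponent c κ f)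
    (hc : c ≤ c') : IsLaplaceExponent c' κ f := by
  obtain ⟨Ω, mΩ, P, hP, X, ζ, hX, hζ, h⟩ := h
  exact ⟨Ω, mΩ, P, hP, X, ζ, hX, hζ, fun u hu t => h u (hu.imp_left hc.trans_lt) t⟩

/-- Since ψ = Ψ − κ with Ψ the unkilled exponent, the ratio of ψ is that of Ψ minus κ/v. If κ and δ
are both nonzero, the extra term κ(1/(u+β) − 1/β) restricts u to (−β,∞), hence ℓ = 0; moreover β >
0, because β = 0 forces ψ(0) = 0. -/
lemma isSubExponent_ratio_sub {ℓ δ β κ : ℝ} {ψ : ℝ → ℝ} {μ : ℝ≥0 → Measure ℝ}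
    (hδ : 0 ≤ δ) (hβ : 0 ≤ β) (hκ : 0 ≤ κ) (hκ0 : ψ 0 = -κ)
    (h : LevyLaws ℓ (fun u => ψ u + κ) μ)
    (hzero : β = 0 → ψ 0 = 0 ∧ HasDerivWithinAt ψ 0 (Ioi 0) 0) (hcase : κ = 0 ∨ δ = 0 ∨ ℓ = 0) :
    IsSubExponent (ℓ - β) (fun u => δ * -(ratio ψ (u + β) - ratio ψ β)) := by
  by_cases hδ0 : δ = 0
  · exact (IsSubExponent.drift _ le_rfl).congr fun u _ => by rw [hδ0]; ring
  refine IsSubExponent.const_mul ?_ hδ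
  by_cases hκ' : κ = 0
  · have hL : LevyLaws ℓ ψ μ := by simpa [hκ'] using h
    rcases hβ.eq_or_lt with hβ0 | hβ0
    · have hd := (hzero hβ0.symm).2
      refine (hL.isSubExponent_ratio_zero hd).mono (by linarith) |>.congr fun u _ => ?_
      have : ratio ψ 0 = 0 := by
        rw [ratio, if_pos rfl]
        exact hd.derivWithin (uniqueDiffWithinAt_Ioi 0)
      rw [← hβ0, this]
      simp
    · exact hL.isSubExponent_ratio hβ0
  · have hℓ : ℓ = 0 := (hcase.resolve_left hκ').resolve_left hδ0
    have hβ0 : 0 < β := lt_of_le_of_ne hβ fun hb => hκ' (by linarith [(hzero hb.symm).1])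
    subst hℓ
    rw [zero_sub]
    have h1 := h.isSubExponent_ratio hβ0
    rw [zero_sub] at h1
    refine (h1.add ((isSubExponent_inv_sub_inv hβ0).const_mul hκ)).congr fun u hu => ?_
    have hu' : u + β ≠ 0 := by
      rcases hu with hu | hu <;> linarith
    rw [ratio, ratio, ratio, ratio, if_neg hu', if_neg hu', if_neg hβ0.ne', if_neg hβ0.ne']
    field_simp
    ring

/-- The transform of a Laplace exponent is a Laplace exponent. -/
theorem isLaplaceExponent_T {ℓ δ β κ : ℝ} {ψ : ℝ → ℝ} (hδ : 0 ≤ δ) (hβ : 0 ≤ β)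
    (hψ : IsLaplaceExponent ℓ κ ψ)
    (hzero : β = 0 → ψ 0 = 0 ∧ HasDerivWithinAt ψ 0 (Ioi 0) 0) (hcase : κ = 0 ∨ δ = 0 ∨ ℓ = 0) :
    IsLaplaceExponent (ℓ - β) 0 (T δ β ψ) := by
  obtain ⟨hκ, hκ0, μ, h1, h2, h3⟩ := hψ.exists_laws
  have h : LevyLaws ℓ (fun u => ψ u + κ) μ := ⟨h1, h2, h3⟩
  refine (h.isLaplaceExponent_tilted_add hβ
    (isSubExponent_ratio_sub hδ hβ hκ hκ0 h hzero hcase)).congr fun u _ => ?_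
  rw [T_eq]
  ring

lemma Psi_mono {ℓ ℓ' : ℝ} (h : ℓ' ≤ ℓ) : Psi ℓ' ⊆ Psi ℓ := fun _ ⟨κ, hκ⟩ => ⟨κ, hκ.mono h⟩

/-! ### Lévy measures and the Lévy–Khintchine integrand -/

section LevyMeasure

/-- The integrand of the Lévy–Khintchine formula. -/
def levyKernel (u x : ℝ) : ℝ := Real.exp (u * x) - 1 - u * x * (if |x| < 1 then 1 else 0)

lemma measurable_ite_abs_lt : Measurable fun x : ℝ => if |x| < 1 then (1 : ℝ) else 0 :=
  Measurable.ite (measurableSet_lt (by fun_prop) measurable_const) measurable_const measurable_const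

@[fun_prop]
lemma measurable_levyKernel (u : ℝ) : Measurable (levyKernel u) := by
  have hmeas := measurable_ite_abs_lt
  unfold levyKernel
  fun_prop

lemma abs_exp_sub_one_sub_le {w : ℝ} (hw : w ≤ 0) : |Real.exp w - 1 - w| ≤ w ^ 2 := by
  rw [abs_of_nonneg (by linarith [Real.add_one_le_exp w])]
  have h1 : Real.exp w * Real.exp (-w) = 1 := by rw [← Real.exp_add]; simp
  have h2 := Real.add_one_le_exp (-w)
  have h3 := Real.exp_pos w
  have h4 : Real.exp w * (1 - w) ≤ 1 := by nlinarith
  by_contra! h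
  have h5 : 1 + w + w ^ 2 < Real.exp w := by linarith
  nlinarith [mul_lt_mul_of_pos_right h5 (show 0 < 1 - w by linarith), mul_nonneg (sq_nonneg w) (neg_nonneg.2 hw)]

lemma abs_levyKernel_le {u x : ℝ} (hu : 0 ≤ u) (hx : x < 0) :
    |levyKernel u x| ≤ (1 + u ^ 2) * min 1 (x ^ 2) := by
  have hux : u * x ≤ 0 := mul_nonpos_of_nonneg_of_nonpos hu hx.le
  unfold levyKernel
  split_ifs with h
  · have hx2 : x ^ 2 ≤ 1 := by rw [← sq_abs]; exact pow_le_one₀ (abs_nonneg _) h.le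
    rw [mul_one, min_eq_right hx2]
    refine (abs_exp_sub_one_sub_le hux).trans ?_
    nlinarith [sq_nonneg x]
  · have hx2 : 1 ≤ x ^ 2 := by
      rw [← sq_abs]; exact one_le_pow₀ (not_lt.1 h)
    rw [mul_zero, sub_zero, min_eq_left hx2, mul_one, abs_le]
    have h1 := Real.exp_pos (u * x)
    have h2 := Real.exp_le_one_iff.2 hux
    constructor <;> nlinarith [sq_nonneg u]

namespace IsLevyMeasure

variable {Lam : Measure ℝ}

lemma ae_neg (h : IsLevyMeasure Lam) : ∀ᵐ x ∂Lam, x < 0 := by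
  rw [ae_iff]
  refine measure_mono_null (fun x hx => ?_) h.conc
  exact not_lt.1 hx

lemma restrict_eq (h : IsLevyMeasure Lam) : Lam.restrict (Iio 0) = Lam :=
  Measure.restrict_eq_self_of_ae_mem h.ae_neg

lemma integrable_min (h : IsLevyMeasure Lam) : Integrable (fun x : ℝ => min 1 (x ^ 2)) Lam :=
  (lintegral_ofReal_ne_top_iff_integrable (by fun_prop)
    (.of_forall fun x => le_min zero_le_one (sq_nonneg x))).1 h.finite.ne

lemma integrable_of_le (h : IsLevyMeasure Lam) {f : ℝ → ℝ} (hf : Measurable f) (C : ℝ)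
    (hb : ∀ x < 0, |f x| ≤ C * min 1 (x ^ 2)) : Integrable f Lam :=
  (h.integrable_min.const_mul C).mono' hf.aestronglyMeasurable
    (h.ae_neg.mono fun x hx => hb x hx)

lemma integrable_levyKernel (h : IsLevyMeasure Lam) {u : ℝ} (hu : 0 ≤ u) :
    Integrable (levyKernel u) Lam :=
  h.integrable_of_le (by fun_prop) _ fun _ hx => abs_levyKernel_le hu hx

/-- The density 1 ∧ x² is positive almost everywhere and makes the measure finite; dividing it out
again gives the s-finiteness that Tonelli needs. -/
lemma sFinite (h : IsLevyMeasure Lam) : SFinite Lam := by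
  have hw : Measurable fun x : ℝ => ENNReal.ofReal (min 1 (x ^ 2)) := by fun_prop
  have h1 : IsFiniteMeasure (Lam.withDensity fun x => ENNReal.ofReal (min 1 (x ^ 2))) :=
    isFiniteMeasure_withDensity h.finite.ne
  have h2 := withDensity_inv_same hw (μ := Lam)
    (h.ae_neg.mono fun x hx => by
      have : 0 < min 1 (x ^ 2) := lt_min one_pos (sq_pos_of_neg hx)
      exact (ENNReal.ofReal_pos.2 this).ne')
    (.of_forall fun x => ENNReal.ofReal_ne_top)
  rw [← h2]
  infer_instance

lemma add {Lam' : Measure ℝ} (h : IsLevyMeasure Lam) (h' : IsLevyMeasure Lam') :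
    IsLevyMeasure (Lam + Lam') :=
  ⟨by simp [h.conc, h'.conc], by
    rw [lintegral_add_measure]; exact ENNReal.add_lt_top.2 ⟨h.finite, h'.finite⟩⟩

lemma withDensity_exp (h : IsLevyMeasure Lam) {β : ℝ} (hβ : 0 ≤ β) :
    IsLevyMeasure (Lam.withDensity fun x => ENNReal.ofReal (Real.exp (β * x))) := by
  refine ⟨withDensity_absolutelyContinuous _ _ h.conc, ?_⟩
  rw [lintegral_withDensity_eq_lintegral_mul _ (by fun_prop) (by fun_prop)]
  refine (lintegral_mono_ae (h.ae_neg.mono fun x hx => ?_)).trans_lt h.finite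
  rw [Pi.mul_apply]
  refine mul_le_of_le_one_left zero_le ?_
  rw [← ENNReal.ofReal_one]
  exact ENNReal.ofReal_le_ofReal
    (Real.exp_le_one_iff.2 (mul_nonpos_of_nonneg_of_nonpos hβ hx.le))

end IsLevyMeasure

lemma min_abs_le {y : ℝ} (hy : y < 0) : min 1 |y| ≤ 2 * |Real.exp y - 1| := by
  have h1 : Real.exp y * Real.exp (-y) = 1 := by rw [← Real.exp_add]; simp
  have h2 := Real.add_one_le_exp (-y)
  have h3 := Real.exp_pos y
  have h4 : Real.exp y * (1 - y) ≤ 1 := by nlinarith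
  have h5 : Real.exp y < 1 := Real.exp_lt_one_iff.2 hy
  rw [abs_of_neg hy, abs_of_neg (by linarith)]
  rcases le_total (-y) 1 with h | h
  · rw [min_eq_right h]; nlinarith
  · rw [min_eq_left h]; nlinarith

/-- Jump measures of bounded variation. -/
lemma isLevyMeasure_of_integrable {m : Measure ℝ} (hm : m (Ici 0) = 0)
    (hi : Integrable (fun y => Real.exp y - 1) m) : IsLevyMeasure m ∧
      Integrable (fun y => y * (if |y| < 1 then 1 else 0)) m := by
  have hae : ∀ᵐ y ∂m, y < 0 := by
    rw [ae_iff]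
    exact measure_mono_null (fun x hx => not_lt.1 hx) hm
  refine ⟨⟨hm, ?_⟩, ?_⟩
  · have h1 : Integrable (fun y : ℝ => min 1 (y ^ 2)) m := by
      refine (hi.abs.const_mul 2).mono' (by fun_prop) (hae.mono fun y hy => ?_)
      rw [Real.norm_eq_abs, abs_of_nonneg (le_min zero_le_one (sq_nonneg y))]
      refine le_trans ?_ (min_abs_le hy)
      rcases le_total |y| 1 with h | h
      · rw [min_eq_right h]
        refine (min_le_right _ _).trans ?_
        rw [← sq_abs, pow_two]
        exact mul_le_of_le_one_left (abs_nonneg y) h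
      · rw [min_eq_left h]; exact min_le_left _ _
    exact lt_top_iff_ne_top.2 ((lintegral_ofReal_ne_top_iff_integrable (by fun_prop)
      (.of_forall fun x => le_min zero_le_one (sq_nonneg x))).2 h1)
  · have hmeas := measurable_ite_abs_lt
    refine (hi.abs.const_mul 2).mono' (by fun_prop) (hae.mono fun y hy => ?_)
    refine le_trans ?_ (min_abs_le hy)
    split_ifs with h
    · rw [mul_one, min_eq_right h.le, Real.norm_eq_abs]
    · simp

lemma integral_levyKernel_of_integrable {m : Measure ℝ} {u : ℝ}
    (hi : Integrable (fun y => Real.exp (u * y) - 1) m)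
    (hy : Integrable (fun y => y * (if |y| < 1 then 1 else 0)) m) :
    ∫ y, levyKernel u y ∂m = ∫ y, (Real.exp (u * y) - 1) ∂m
      - u * ∫ y, y * (if |y| < 1 then 1 else 0) ∂m := by
  unfold levyKernel
  simp_rw [mul_assoc u]
  rw [integral_sub hi (hy.const_mul u), integral_const_mul]

/-- Multiplying the kernel at u by e^{βx} gives the difference of the kernels at u + β and β, up to
a term linear in u. That term changes only the drift and is integrable, as 1 − e^{βx} is of order x.
-/
lemma integral_levyKernel_withDensity {Lam : Measure ℝ} (h : IsLevyMeasure Lam) {β u : ℝ}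
    (hβ : 0 ≤ β) (hu : 0 ≤ u) :
    ∫ x, levyKernel u x ∂Lam.withDensity (fun x => ENNReal.ofReal (Real.exp (β * x)))
      = ∫ x, levyKernel (u + β) x ∂Lam - ∫ x, levyKernel β x ∂Lam
        + u * ∫ x, (x * (1 - Real.exp (β * x))) * (if |x| < 1 then 1 else 0) ∂Lam := by
  have hmeas := measurable_ite_abs_lt
  have hi : Integrable (fun x => (x * (1 - Real.exp (β * x))) * (if |x| < 1 then 1 else 0)) Lam := by
    refine h.integrable_of_le (by fun_prop) β fun x hx => ?_
    split_ifs with h1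
    · have hx2 : x ^ 2 ≤ 1 := by rw [← sq_abs]; exact pow_le_one₀ (abs_nonneg _) h1.le
      have h2 := Real.add_one_le_exp (β * x)
      have h3 := Real.exp_le_one_iff.2 (mul_nonpos_of_nonneg_of_nonpos hβ hx.le)
      rw [mul_one, min_eq_right hx2, abs_mul, abs_of_neg hx, abs_of_nonneg (by linarith)]
      nlinarith
    · rw [mul_zero, abs_zero]
      exact mul_nonneg hβ (le_min zero_le_one (sq_nonneg x))
  rw [integral_withDensity_eq_integral_toReal_smul (by fun_prop)
    (.of_forall fun x => ENNReal.ofReal_lt_top)]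
  have h1 : ∀ x, (ENNReal.ofReal (Real.exp (β * x))).toReal • levyKernel u x
      = levyKernel (u + β) x - levyKernel β x
        + u * ((x * (1 - Real.exp (β * x))) * (if |x| < 1 then 1 else 0)) := fun x => by
    rw [ENNReal.toReal_ofReal (Real.exp_pos _).le, smul_eq_mul]
    unfold levyKernel
    rw [add_mul, Real.exp_add]
    ring
  simp_rw [h1]
  have i1 := h.integrable_levyKernel (add_nonneg hu hβ)
  have i2 := h.integrable_levyKernel hβ
  have i3 : Integrable (fun x => levyKernel (u + β) x - levyKernel β x) Lam := i1.sub i2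
  rw [integral_add i3 (hi.const_mul u), integral_sub i1 i2, integral_const_mul]

end LevyMeasure

/-! ### Characteristics of the transform -/

lemma expPrim_mono {u w x : ℝ} (huw : u ≤ w) (hx : x ≤ 0) : expPrim u x ≤ expPrim w x := by
  rw [expPrim, expPrim, intervalIntegral.integral_symm, intervalIntegral.integral_symm x 0]
  refine neg_le_neg (intervalIntegral.integral_mono_on hx
    (Continuous.intervalIntegrable (by fun_prop) _ _)
    (Continuous.intervalIntegrable (by fun_prop) _ _) fun y hy => ?_)
  exact Real.exp_le_exp.2 (mul_le_mul_of_nonpos_right huw hy.2)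

lemma tendsto_expPrim_inv (x : ℝ) :
    Tendsto (fun n : ℕ => expPrim (1 / ((n : ℝ) + 1)) x) atTop (𝓝 x) := by
  have h1 : HasDerivAt (fun u : ℝ => Real.exp (u * x)) x 0 := by
    have := ((hasDerivAt_id (0 : ℝ)).mul_const x).exp
    simpa using this
  have h2 : Tendsto (fun n : ℕ => 1 / ((n : ℝ) + 1)) atTop (𝓝[≠] 0) :=
    tendsto_nhdsWithin_iff.2 ⟨tendsto_one_div_add_atTop_nhds_zero_nat, .of_forall fun n => by
      simp only [mem_compl_iff, mem_singleton_iff]; positivity⟩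
  refine ((hasDerivAt_iff_tendsto_slope.1 h1).comp h2).congr fun n => ?_
  rw [expPrim_of_ne (by positivity), Function.comp_apply, slope_def_field]
  simp

/-- The truncation term does not depend on v, so it cancels in differences of primitives; for
nonzero parameters these are differences of Lévy–Khintchine integrands. -/
lemma expPrim_eq_levyKernel {v : ℝ} (hv : v ≠ 0) (x : ℝ) :
    expPrim v x = levyKernel v x / v + x * (if |x| < 1 then 1 else 0) := by
  rw [expPrim_of_ne hv, levyKernel]
  field_simp
  ring

lemma tendsto_ratio_of_hasDerivWithinAt {ψ : ℝ → ℝ} (h0 : ψ 0 = 0)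
    (hder : HasDerivWithinAt ψ 0 (Ioi 0) 0) : Tendsto (ratio ψ) (𝓝[>] 0) (𝓝 0) := by
  have h1 := (hasDerivWithinAt_iff_tendsto_slope' (s := Ioi (0 : ℝ)) (by simp)).1 hder
  refine h1.congr' ?_
  filter_upwards [self_mem_nhdsWithin] with u (hu : 0 < u)
  rw [ratio, if_neg hu.ne', slope_def_field, h0]
  simp

namespace HasCharacteristics

variable {ψ : ℝ → ℝ} {κ a σ : ℝ} {Lam : Measure ℝ}

lemma formula' (h : HasCharacteristics ψ κ a σ Lam) {u : ℝ} (hu : 0 ≤ u) :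
    ψ u = -κ + a * u + 1 / 2 * σ ^ 2 * u ^ 2 + ∫ x, levyKernel u x ∂Lam := by
  have := h.formula u hu
  rwa [h.levy.restrict_eq] at this

lemma ratio_eq (h : HasCharacteristics ψ κ a σ Lam) {u : ℝ} (hu : 0 < u) :
    ratio ψ u = -κ * (1 / u) + a + 1 / 2 * σ ^ 2 * u + (∫ x, levyKernel u x ∂Lam) / u := by
  rw [ratio, if_neg hu.ne', h.formula' hu.le]
  field_simp

/-- If `ψ(0) = ψ'(0+) = 0` then the large jumps have finite mean, equal to `-a`. -/
lemma integral_large_jumps (h : HasCharacteristics ψ κ a σ Lam) (h0 : ψ 0 = 0)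
    (hder : HasDerivWithinAt ψ 0 (Ioi 0) 0) :
    Integrable (fun x => x - x * (if |x| < 1 then 1 else 0)) Lam ∧
      ∫ x, (x - x * (if |x| < 1 then 1 else 0)) ∂Lam = -a := by
  have hκ : κ = 0 := by
    have := h.formula' le_rfl
    simp only [h0, levyKernel, zero_mul, Real.exp_zero, sub_self, integral_zero] at this
    linarith
  have hmeas := measurable_ite_abs_lt
  let v : ℕ → ℝ := fun n => 1 / ((n : ℝ) + 1)
  have hv : ∀ n, 0 < v n := fun n => by positivity
  have hv1 : ∀ n, v n ≤ 1 := fun n => by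
    rw [div_le_one (by positivity)]; linarith [(n.cast_nonneg : (0 : ℝ) ≤ n)]
  set K := ∫ x, levyKernel 1 x ∂Lam
  have hi1 := h.levy.integrable_levyKernel zero_le_one
  have hin := fun n => (h.levy.integrable_levyKernel (hv n).le).div_const (v n)
  have hker : ∀ n x, levyKernel 1 x - levyKernel (v n) x / v n = expPrim 1 x - expPrim (v n) x := by
    intro n x
    rw [expPrim_eq_levyKernel (hv n).ne', expPrim_eq_levyKernel one_ne_zero]
    ring
  -- The ratio at v is a + σ²v/2 + (∫ levyKernel v)/v and tends to ψ'(0+) = 0, so the last quotient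
  -- tends to −a.
  have hlimK : Tendsto (fun n => K - (∫ x, levyKernel (v n) x ∂Lam) / v n) atTop (𝓝 (K + a)) := by
    have hvt : Tendsto v atTop (𝓝[>] 0) :=
      tendsto_nhdsWithin_iff.2 ⟨tendsto_one_div_add_atTop_nhds_zero_nat, .of_forall hv⟩
    have h1 := (tendsto_ratio_of_hasDerivWithinAt h0 hder).comp hvt
    have h2 := (((tendsto_nhdsWithin_iff.1 hvt).1.const_mul (1 / 2 * σ ^ 2)).add_const (K + a)).sub h1
    rw [mul_zero, zero_add, sub_zero] at h2
    refine h2.congr fun n => ?_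
    rw [Function.comp_apply, h.ratio_eq (hv n), hκ]
    ring
  have hint : ∀ n, ∫⁻ x, ENNReal.ofReal (levyKernel 1 x - levyKernel (v n) x / v n) ∂Lam
      = ENNReal.ofReal (K - (∫ x, levyKernel (v n) x ∂Lam) / v n) := fun n => by
    rw [← ofReal_integral_eq_lintegral_ofReal
      (f := fun x => levyKernel 1 x - levyKernel (v n) x / v n) (hi1.sub (hin n)) (h.levy.ae_neg.mono fun x hx => ?_),
      integral_sub hi1 (hin n), integral_div]
    simp only [Pi.zero_apply]
    rw [hker]
    exact sub_nonneg.2 (expPrim_mono (hv1 n) hx.le)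
  -- For x ≤ 0 the primitive decreases to x as v ↓ 0, so monotone convergence yields both
  -- integrability and the value of the limit.
  have hmct := lintegral_tendsto_of_tendsto_of_monotone (μ := Lam)
    (f := fun n x => ENNReal.ofReal (levyKernel 1 x - levyKernel (v n) x / v n))
    (F := fun x => ENNReal.ofReal (expPrim 1 x - x)) (fun n => by fun_prop)
    (h.levy.ae_neg.mono fun x hx m n hmn => by
      simp only [hker]
      refine ENNReal.ofReal_le_ofReal (sub_le_sub_left (expPrim_mono ?_ hx.le) _)
      exact one_div_le_one_div_of_le (by positivity) (by gcongr))
    (.of_forall fun x => by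
      simp only [hker]
      exact ENNReal.tendsto_ofReal ((tendsto_expPrim_inv x).const_sub _))
  simp_rw [hint] at hmct
  have hK := tendsto_nhds_unique hmct (ENNReal.tendsto_ofReal hlimK)
  have hKa : 0 ≤ K + a := ge_of_tendsto hlimK (.of_forall fun n => by
    rw [← integral_div, ← integral_sub hi1 (hin n)]
    refine integral_nonneg_of_ae (h.levy.ae_neg.mono fun x hx => ?_)
    simp only [Pi.zero_apply]
    rw [hker]
    exact sub_nonneg.2 (expPrim_mono (hv1 n) hx.le))
  have hnn : 0 ≤ᵐ[Lam] fun x => expPrim 1 x - x := h.levy.ae_neg.mono fun x hx => by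
    have := expPrim_mono zero_le_one hx.le
    rw [expPrim_zero_left] at this
    exact sub_nonneg.2 this
  have hI : Integrable (fun x => expPrim 1 x - x) Lam :=
    (lintegral_ofReal_ne_top_iff_integrable (by fun_prop) hnn).1 (by rw [hK]; exact ENNReal.ofReal_ne_top)
  have hV : ∫ x, (expPrim 1 x - x) ∂Lam = K + a := by
    rw [integral_eq_lintegral_of_nonneg_ae hnn (by fun_prop), hK, ENNReal.toReal_ofReal hKa]
  have heq : ∀ x : ℝ, x - x * (if |x| < 1 then 1 else 0) = levyKernel 1 x - (expPrim 1 x - x) := by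
    intro x
    rw [expPrim_eq_levyKernel one_ne_zero]
    ring
  simp_rw [heq]
  refine ⟨hi1.sub hI, ?_⟩
  rw [integral_sub hi1 hI, hV]
  ring

/-- The tail of the jump measure integrated against exponentials. -/
lemma integral_expPrim_sub (h : HasCharacteristics ψ κ a σ Lam) {β u : ℝ} (hβ : 0 ≤ β) (hu : 0 ≤ u)
    (hzero : β = 0 → ψ 0 = 0 ∧ HasDerivWithinAt ψ 0 (Ioi 0) 0) :
    Integrable (fun x => expPrim (u + β) x - expPrim β x) Lam ∧
      ∫ x, (expPrim (u + β) x - expPrim β x) ∂Lam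
        = ratio ψ (u + β) - ratio ψ β + κ * (1 / (u + β) - 1 / β) - 1 / 2 * σ ^ 2 * u := by
  rcases hβ.eq_or_lt with hb | hb
  -- Here κ = 0, so the default value 1/0 = 0 in the statement is multiplied by zero.
  · subst hb
    obtain ⟨h0, hder⟩ := hzero rfl
    have hκ : κ = 0 := by
      have := h.formula' le_rfl
      simp only [h0, levyKernel, zero_mul, Real.exp_zero, sub_self, integral_zero] at this
      linarith
    have hr : ratio ψ 0 = 0 := by
      rw [ratio, if_pos rfl]
      exact hder.derivWithin (uniqueDiffWithinAt_Ioi 0)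
    rcases hu.eq_or_lt with hu0 | hu0
    · subst hu0
      simp [hr]
    · have hi := (h.levy.integrable_levyKernel hu).div_const u
      obtain ⟨hl, hl'⟩ := h.integral_large_jumps h0 hder
      have heq : ∀ x, expPrim (u + 0) x - expPrim 0 x
          = levyKernel u x / u - (x - x * (if |x| < 1 then 1 else 0)) := fun x => by
        rw [add_zero, expPrim_zero_left, expPrim_eq_levyKernel hu0.ne']
        ring
      simp_rw [heq]
      refine ⟨hi.sub hl, ?_⟩
      rw [integral_sub hi hl, hl', add_zero, hr, h.ratio_eq hu0, hκ, integral_div]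
      ring
  · have hv : 0 < u + β := by linarith
    have i1 := (h.levy.integrable_levyKernel hv.le).div_const (u + β)
    have i2 := (h.levy.integrable_levyKernel hβ).div_const β
    have heq : ∀ x, expPrim (u + β) x - expPrim β x
        = levyKernel (u + β) x / (u + β) - levyKernel β x / β := fun x => by
      rw [expPrim_eq_levyKernel hv.ne', expPrim_eq_levyKernel hb.ne']
      ring
    simp_rw [heq]
    refine ⟨i1.sub i2, ?_⟩
    rw [integral_sub i1 i2, integral_div, integral_div, h.ratio_eq hv, h.ratio_eq hb]
    ring

lemma integral_tail (h : HasCharacteristics ψ κ a σ Lam) {δ β u : ℝ} (hδ : 0 ≤ δ) (hβ : 0 ≤ β)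
    (hu : 0 ≤ u) (hzero : β = 0 → ψ 0 = 0 ∧ HasDerivWithinAt ψ 0 (Ioi 0) 0) :
    Integrable (fun y => Real.exp (u * y) - 1) (tailMeasure δ β Lam) ∧
      ∫ y, (Real.exp (u * y) - 1) ∂tailMeasure δ β Lam
        = -(δ * (ratio ψ (u + β) - ratio ψ β + κ * (1 / (u + β) - 1 / β) - 1 / 2 * σ ^ 2 * u)) := by
  have := h.levy.sFinite
  obtain ⟨h1, h2⟩ := h.integral_expPrim_sub hβ hu hzero
  have hae : (fun x => expPrim (u + β) (min x 0) - expPrim β (min x 0))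
      =ᵐ[Lam] fun x => expPrim (u + β) x - expPrim β x := h.levy.ae_neg.mono fun x hx => by
    simp only [min_eq_left hx.le]
  have h3 := integral_exp_sub_one_tailMeasure hδ Lam (h1.congr hae.symm)
  rw [integral_congr_ae hae, h2] at h3
  exact h3

lemma integral_killing (h : HasCharacteristics ψ κ a σ Lam) {δ β u : ℝ} (hδ : 0 ≤ δ) (hβ : 0 ≤ β)
    (hu : 0 ≤ u) (hzero : β = 0 → ψ 0 = 0) :
    Integrable (fun y => Real.exp (u * y) - 1) (expMeasure (δ * κ) β) ∧
      ∫ y, (Real.exp (u * y) - 1) ∂expMeasure (δ * κ) β = δ * κ * (1 / (u + β) - 1 / β) := by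
  rcases hβ.eq_or_lt with hb | hb
  · have hκ : κ = 0 := by
      have := h.formula' le_rfl
      simp only [hzero hb.symm, levyKernel, zero_mul, Real.exp_zero, sub_self, integral_zero] at this
      linarith
    have : expMeasure (δ * κ) β = 0 := by simp [expMeasure, hκ]
    rw [this, hκ]
    simp
  · have hδκ := mul_nonneg hδ h.rate_nonneg
    have hv : 0 < u + β := by linarith
    have := isFiniteMeasure_expMeasure hδκ hb
    exact ⟨(integral_exp_expMeasure hδκ hv).1.sub (integrable_const 1),
      integral_exp_sub_one_expMeasure hδκ hb hv⟩

/-- The characteristics of the transform. -/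
theorem transform (h : HasCharacteristics ψ κ a σ Lam) {δ β : ℝ} (hδ : 0 ≤ δ) (hβ : 0 ≤ β)
    (hzero : β = 0 → ψ 0 = 0 ∧ HasDerivWithinAt ψ 0 (Ioi 0) 0) :
    ∃ a' : ℝ, HasCharacteristics (T δ β ψ) 0 a' σ (newJumpMeasure δ β κ Lam) := by
  have hN : newJumpMeasure δ β κ Lam
      = Lam.withDensity (fun x => ENNReal.ofReal (Real.exp (β * x))) + tailMeasure δ β Lam
        + expMeasure (δ * κ) β := rfl
  have ht := fun {u : ℝ} (hu : 0 ≤ u) => h.integral_tail hδ hβ hu hzero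
  have hk := fun {u : ℝ} (hu : 0 ≤ u) => h.integral_killing hδ hβ hu fun hb => (hzero hb).1
  obtain ⟨l2, j2⟩ := isLevyMeasure_of_integrable (tailMeasure_Ici δ β Lam)
    (by simpa using (ht zero_le_one).1)
  obtain ⟨l3, j3⟩ := isLevyMeasure_of_integrable (expMeasure_Ici (δ * κ) β)
    (by simpa using (hk zero_le_one).1)
  have l1 := h.levy.withDensity_exp hβ
  have hl : IsLevyMeasure (newJumpMeasure δ β κ Lam) := by rw [hN]; exact (l1.add l2).add l3
  -- The new linear coefficient collects the terms linear in u: the cross term of the Gaussian part,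
  -- the tilt correction, the drift −δσ²/2, and the truncation terms of the two added jump measures.
  refine ⟨a + σ ^ 2 * β - (∫ x, (x * (1 - Real.exp (β * x))) * (if |x| < 1 then 1 else 0) ∂Lam)
    - 1 / 2 * δ * σ ^ 2
    + (∫ y, y * (if |y| < 1 then 1 else 0) ∂tailMeasure δ β Lam)
    + (∫ y, y * (if |y| < 1 then 1 else 0) ∂expMeasure (δ * κ) β),
    le_rfl, h.gauss_nonneg, hl, fun u hu => ?_⟩
  change _ = _ + ∫ x in Iio (0 : ℝ), levyKernel u x ∂_
  rw [hl.restrict_eq, hN, integral_add_measure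
    ((l1.integrable_levyKernel hu).add_measure (l2.integrable_levyKernel hu))
    (l3.integrable_levyKernel hu), integral_add_measure (l1.integrable_levyKernel hu)
    (l2.integrable_levyKernel hu), integral_levyKernel_withDensity h.levy hβ hu,
    integral_levyKernel_of_integrable (ht hu).1 j2, integral_levyKernel_of_integrable (hk hu).1 j3,
    (ht hu).2, (hk hu).2, T_eq, h.formula' (add_nonneg hu hβ), h.formula' hβ]
  ring

end HasCharacteristics

end SNLevy

end

theorem mainTheorem5 (ℓ δ β κ : ℝ) (ψ : ℝ → ℝ) (hℓ : ℓ ≤ 0) (hδ : 0 ≤ δ) (hβ : 0 ≤ β)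
    (hψ : SNLevy.IsLaplaceExponent ℓ κ ψ)
    (hzero : β = 0 → ψ 0 = 0 ∧ HasDerivWithinAt ψ 0 (Set.Ioi 0) 0) :
    (κ = 0 ∨ δ = 0 ∨ ℓ = 0 → SNLevy.IsLaplaceExponent (ℓ - β) 0 (SNLevy.T δ β ψ)) ∧
    SNLevy.IsLaplaceExponent (-β) 0 (SNLevy.T δ β ψ) ∧
    SNLevy.Psi (ℓ - β) ⊆ SNLevy.Psi ℓ ∧
    ∀ (a σ : ℝ) (Lam : MeasureTheory.Measure ℝ), SNLevy.HasCharacteristics ψ κ a σ Lam →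
      ∃ a' : ℝ, SNLevy.HasCharacteristics (SNLevy.T δ β ψ) 0 a' σ
        (SNLevy.newJumpMeasure δ β κ Lam) := by
  refine ⟨SNLevy.isLaplaceExponent_T hδ hβ hψ hzero, ?_, SNLevy.Psi_mono (by linarith),
    fun a σ Lam h => ?_⟩
  -- Forgetting the strip (ℓ,0] reduces any killing rate to the case ℓ = 0.
  · have := SNLevy.isLaplaceExponent_T hδ hβ (hψ.mono hℓ) hzero (.inr (.inr rfl))
    rwa [zero_sub] at this
  · exact h.transform hδ hβ hzero
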